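/- Let $\mathrm{Gin}(M,N;\sigma^2)$ denote the law of an $M\times N$ random matrix with i.i.d. centered circularly symmetric complex Gaussian entries of variance $\sigma^2$ (real and imaginary parts independent real centered Gaussians of variance $\sigma^2/2$). For a matrix $A$ put $|A|=(A^*A)^{1/2}$, let $\overline A$ be its entrywise complex conjugate, and let $\|A\|_1=\mathrm{Tr}\,|A|$ be its trace norm. Let $\omega_N=\Omega_N\Omega_N^*$ with $\Omega_N=N^{-1/2}\sum_{i=1}^N e_i\otimes e_i\in\mathbb C^N\otimes\mathbb C^N$. For integers $M\ge 1$, $N\ge 2$ define $$\chi_{M,N}=\frac{\mathbb E\|Y\|_1^2-1}{N^2-1},\qquad Y\in\mathrm{Gin}(M,N;1/M).$$ 1. Let $M\ge N\ge 1$ be integers and $Y\in\mathrm{Gin}(M,N;1/M)$. Then $|Y|\otimes|\overline Y|$ and $\|Y\|_1^2$ are integrable and $$\mathbb E\big(|Y|\otimes|\overline Y|\big)=\omega_N+\chi_{M,N}\,(I_{N^2}-\omega_N)$$ (for $N=1$ one has $I_{N^2}-\omega_N=0$, and the last term is read as $0$). 2. For all integers $M\ge N\ge 2$, $\chi_{M,N}\ge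 \frac1{N+1}>0$. 3. Let $c\ge 1$. For all sequences of nonnegative integers $(M_k)$, $(N_k)$ with $N_k\to\infty$ and $M_k/N_k\to c$, $$\lim_{k\to\infty}\chi_{M_k,N_k}=\chi_c:=c^{-1}\left[\int_a^b\frac{\sqrt{(x-a)(b-x)}}{2\pi\sqrt x}\,\mathrm dx\right]^2,\qquad a=(\sqrt c-1)^2,\quad b=(\sqrt c+1)^2,$$ where the integral is absolutely convergent (and $M_k\ge1$, $N_k\ge2$ for all large $k$). 4. The function $c\mapsto\chi_c$ is strictly increasing on $[1,\infty)$, $\chi_1=(8/(3\pi))^2$, and $\lim_{c\to\infty}\chi_c=1$. -/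

import Mathlib

open MeasureTheory ProbabilityTheory Filter Topology
open scoped NNReal Matrix MatrixOrder Kronecker

noncomputable section

namespace GinibreTensor

/-- The law of a centered (circularly symmetric) complex Gaussian variable of variance `v`:
real and imaginary parts are independent real centered Gaussians of variance `v / 2`,
so that the expectation of `|z|²` is `v`. -/
def complexGaussian (v : ℝ≥0) : Measure ℂ :=
  ((gaussianReal 0 (v / 2)).prod (gaussianReal 0 (v / 2))).map fun p ↦ (⟨p.1, p.2⟩ : ℂ)

/-- `Y` is an `M × N` Ginibre random matrix with parameters `(M, N; v)`: its entries are
independent centered complex Gaussian variables of variance `v`. -/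
structure IsGinibre {Ω : Type*} [MeasurableSpace Ω] {M N : ℕ} (v : ℝ≥0)
    (Y : Ω → Matrix (Fin M) (Fin N) ℂ) (P : Measure Ω) : Prop where
  hasLaw : ∀ i j, HasLaw (fun w ↦ Y w i j) (complexGaussian v) P
  indep : iIndepFun (fun (p : Fin M × Fin N) w ↦ Y w p.1 p.2) P

/-- The positive part `|A| = (A* A)^{1/2}` of a rectangular matrix. -/
def matAbs {M N : ℕ} (A : Matrix (Fin M) (Fin N) ℂ) : Matrix (Fin N) (Fin N) ℂ :=
  CFC.sqrt (Aᴴ * A)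

/-- The entrywise complex conjugate of a matrix. -/
def matConj {M N : ℕ} (A : Matrix (Fin M) (Fin N) ℂ) : Matrix (Fin M) (Fin N) ℂ :=
  A.map (starRingEnd ℂ)

/-- The Schatten 1-norm (trace norm) `Tr |A|`; the trace is a nonnegative real number. -/
def traceNorm {M N : ℕ} (A : Matrix (Fin M) (Fin N) ℂ) : ℝ :=
  (matAbs A).trace.re

/-- The maximally entangled unit vector `N^{-1/2} ∑ i, e_i ⊗ e_i`. -/
def maxEntangledVec (N : ℕ) : Fin N × Fin N → ℂ :=
  fun p ↦ if p.1 = p.2 then (((Real.sqrt N)⁻¹ : ℝ) : ℂ) else 0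

/-- The maximally entangled state `ω_N`, the rank-one projection on the vector above. -/
def maxEntangledState (N : ℕ) : Matrix (Fin N × Fin N) (Fin N × Fin N) ℂ :=
  Matrix.vecMulVec (maxEntangledVec N) (star (maxEntangledVec N))

/-- The random matrix `|Y| ⊗ |Ȳ|` at a sample `A` of `Y`. -/
def absTensor {M N : ℕ} (A : Matrix (Fin M) (Fin N) ℂ) :
    Matrix (Fin N × Fin N) (Fin N × Fin N) ℂ :=
  matAbs A ⊗ₖ matAbs (matConj A)

/-- The joint law of the entries of a Ginibre matrix with parameters `(M, N; v)`. -/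
def ginibreLaw (M N : ℕ) (v : ℝ≥0) : Measure (Fin M × Fin N → ℂ) :=
  Measure.pi fun _ ↦ complexGaussian v

/-- `χ_{M,N} = (𝔼 ‖Y‖₁² - 1) / (N² - 1)` for a Ginibre matrix `Y` with parameters `(M, N; 1/M)`;
meaningful for `M ≥ 1` and `N ≥ 2`. -/
def chi (M N : ℕ) : ℝ :=
  ((∫ y, traceNorm (Matrix.of fun i j ↦ y (i, j)) ^ 2 ∂(ginibreLaw M N (1 / (M : ℝ≥0)))) - 1) /
    ((N : ℝ) ^ 2 - 1)

/-- The lower edge `a = (√c - 1)²`. -/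
def edgeLow (c : ℝ) : ℝ := (Real.sqrt c - 1) ^ 2

/-- The upper edge `b = (√c + 1)²`. -/
def edgeHigh (c : ℝ) : ℝ := (Real.sqrt c + 1) ^ 2

/-- The integrand `√((x - a)(b - x)) / (2π √x)`. -/
def edgeIntegrand (c x : ℝ) : ℝ :=
  Real.sqrt ((x - edgeLow c) * (edgeHigh c - x)) / (2 * Real.pi * Real.sqrt x)

/-- The limiting constant `χ_c = c⁻¹ [∫_a^b √((x - a)(b - x)) / (2π √x) dx]²`. -/
def chiLim (c : ℝ) : ℝ :=
  c⁻¹ * (∫ x in (edgeLow c)..(edgeHigh c), edgeIntegrand c x) ^ 2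

end GinibreTensor

end

/-!
The expectation identity rests on unitary invariance. A Ginibre matrix `Y` has the same law as
`Y U` for every unitary `U` (`measurePreserving_mulRightCLM`, by comparing characteristic
functions), and `|Y U| = U* |Y| U`. Diagonal unitaries force `𝔼 |Y|ᵢⱼ conj |Y|ₖₗ` to vanish unless
`i = j, k = l` or `i = k, j = l`, and Hadamard rotations in coordinate planes relate the remaining
values (`entryCorr_self_eq`, `entryCorr_diag_eq`) until only two unknowns are left. These are
fixed by `𝔼 Tr |Y|² = N` and `𝔼 (Tr |Y|)²` (`entryCorr_eq`). The lower bound on `χ` is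
`(Tr |Y|)² ≥ Tr |Y|²` (`le_chi`).

For the limit, `√x = π⁻¹ ∫ x / (x + u²) du` writes `‖Y‖₁ / N` as `π⁻¹ ∫ h(u²) du`, where `h(t)` is
the normalized trace of `Y*Y (Y*Y + t)⁻¹` (`traceNorm_eq_integral`). With `l = N / M`, put
`φ(h) = (1 - h) (1 - l h) - t h`; its root `k(t)` in `(0, 1]` is `mpRoot`. Gaussian integration by
parts, applied to the functions `(Y (Y*Y + t)⁻¹)ᵢₐ φ(h)` and summed over all entries, yields
`𝔼 φ(h)² = O(1 / (N M))` in one stroke (`integral_mpPoly_gramTrace_sq_le`), since the leading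
terms combine to `φ(h)²`. As `t |h - k| ≤ |φ(h)|` (`abs_sub_mpRoot_le`), `h(t)` tends to `k(t)` in
`L²` for each `t > 0`. A bound of the form `|h - k| (1 + u²) ≤ 1 + Tr |Y|² / N` at `t = u²`
dominates, so that `‖Y‖₁ / N` converges in `L²` to the constant `π⁻¹ ∫ k(u²) du`
(`tendsto_integral_traceNorm_div_sq`).

The same representation of the square root, combined with the explicit Stieltjes transform of the
Marchenko–Pastur density (`integral_sqrt_mul_div`), shows that `χ_c` is the square of
`π⁻¹ ∫ k(u²) du` at `l = 1 / c` (`chiLim_eq`). Monotonicity and the limit `c → ∞` are then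
properties of the root of a quadratic equation; the value at `c = 1` is an elementary integral.
-/

namespace GinibreTensor

/-! ### The quadratic equation for the limiting resolvent -/

/-- The root in `(0, 1]` of the quadratic equation `(1 - k) (1 - l k) = t k`, rationalised so that
it is manifestly continuous at `l = 0`. -/
noncomputable def mpRoot (l t : ℝ) : ℝ := 2 / (1 + l + t + √((1 + l + t) ^ 2 - 4 * l))

section mpRoot

variable {l t : ℝ}

lemma mpRoot_disc_nonneg (ht : 0 ≤ t) (hl : 0 ≤ l) : 0 ≤ (1 + l + t) ^ 2 - 4 * l := by
  nlinarith [sq_nonneg (1 - l), mul_nonneg ht hl]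

lemma mpRoot_pos (ht : 0 ≤ t) (hl : 0 ≤ l) : 0 < mpRoot l t := by
  unfold mpRoot
  positivity

lemma mpRoot_eq (ht : 0 ≤ t) (hl : 0 ≤ l) :
    (1 - mpRoot l t) * (1 - l * mpRoot l t) = t * mpRoot l t := by
  have hs := Real.sq_sqrt (mpRoot_disc_nonneg ht hl)
  unfold mpRoot
  set s := √((1 + l + t) ^ 2 - 4 * l)
  have hD : 1 + l + t + s ≠ 0 := by positivity
  field_simp
  linear_combination hs

lemma mpRoot_le_one (ht : 0 ≤ t) (hl : 0 ≤ l) : mpRoot l t ≤ 1 := by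
  have h : |1 - l| ≤ √((1 + l + t) ^ 2 - 4 * l) := by
    apply Real.abs_le_sqrt
    nlinarith [mul_nonneg ht hl]
  unfold mpRoot
  rw [div_le_one (by positivity)]
  linarith [le_abs_self (1 - l)]

lemma mpRoot_mul_le (ht : 0 ≤ t) (hl : 0 ≤ l) : mpRoot l t * (1 + t) ≤ 1 := by
  have h := mpRoot_eq ht hl
  have h0 := (mpRoot_pos ht hl).le
  have h1 := mpRoot_le_one ht hl
  nlinarith [mul_nonneg (sub_nonneg.2 h1) (mul_nonneg hl h0)]

/-- The root decreases strictly in the aspect ratio `l`: the left side of the quadratic equation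
does so at each fixed `k`. -/
lemma mpRoot_lt (ht : 0 < t) (hl : 0 ≤ l) {l' : ℝ} (hll : l < l') (hl1 : l' ≤ 1) :
    mpRoot l' t < mpRoot l t := by
  have hl' : 0 ≤ l' := hl.trans hll.le
  have e := mpRoot_eq ht.le hl
  have e' := mpRoot_eq ht.le hl'
  have p := mpRoot_pos ht.le hl
  have p' := mpRoot_pos ht.le hl'
  have b := mpRoot_mul_le ht.le hl
  have b' := mpRoot_mul_le ht.le hl'
  set k := mpRoot l t
  set k' := mpRoot l' t
  have hk' : k' < 1 := by nlinarith
  have hk : k < 1 := by nlinarith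
  by_contra! hle
  have h1 : (1 - k') * (1 - l' * k') < (1 - k') * (1 - l * k') :=
    mul_lt_mul_of_pos_left (by nlinarith) (by linarith)
  have h2 : (1 - k') * (1 - l * k') ≤ (1 - k) * (1 - l * k) := by
    apply mul_le_mul (by linarith) (by nlinarith) (by nlinarith) (by linarith)
  nlinarith

lemma mpRoot_zero_left (ht : 0 ≤ t) : mpRoot 0 t = (1 + t)⁻¹ := by
  unfold mpRoot
  rw [add_zero, mul_zero, sub_zero, Real.sqrt_sq (by linarith)]
  field_simp
  norm_num

lemma continuousAt_mpRoot_left (ht : 0 ≤ t) : ContinuousAt (fun l ↦ mpRoot l t) 0 := by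
  unfold mpRoot
  apply ContinuousAt.div continuousAt_const (by fun_prop)
  positivity

lemma measurable_mpRoot_sq (l : ℝ) : Measurable fun u : ℝ ↦ mpRoot l (u ^ 2) := by
  unfold mpRoot
  fun_prop

lemma mpRoot_sq_le (hl : 0 ≤ l) (u : ℝ) : mpRoot l (u ^ 2) ≤ (1 + u ^ 2)⁻¹ := by
  rw [← one_div, le_div_iff₀ (by positivity)]
  exact mpRoot_mul_le (by positivity) hl

lemma integrable_mpRoot_sq (hl : 0 ≤ l) :
    Integrable fun u : ℝ ↦ mpRoot l (u ^ 2) := by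
  refine integrable_inv_one_add_sq.mono' (measurable_mpRoot_sq l).aestronglyMeasurable
    (ae_of_all _ fun u ↦ ?_)
  rw [Real.norm_of_nonneg (mpRoot_pos (by positivity) hl).le]
  exact mpRoot_sq_le hl u

/-- The quadratic polynomial defining `mpRoot` controls the distance to the root. -/
lemma abs_sub_mpRoot_le (ht : 0 ≤ t) (hl : 0 ≤ l) (hl1 : l ≤ 1) {h : ℝ} (h1 : h ≤ 1) :
    t * |h - mpRoot l t| ≤ |(1 - h) * (1 - l * h) - t * h| := by
  have e := mpRoot_eq ht hl
  have b := mpRoot_le_one ht hl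
  set k := mpRoot l t
  have : (1 - h) * (1 - l * h) - t * h = -((1 + l + t - l * (h + k)) * (h - k)) := by
    linear_combination e
  rw [this, abs_neg, abs_mul]
  apply mul_le_mul_of_nonneg_right _ (abs_nonneg _)
  refine le_trans ?_ (le_abs_self _)
  nlinarith

end mpRoot

/-! ### The limiting constant as an integral of the resolvent root -/

/-- The integral representation `√x = π⁻¹ ∫ x / (x + u²) du`. -/
lemma integral_div_add_sq {x : ℝ} (hx : 0 ≤ x) : ∫ u : ℝ, x / (x + u ^ 2) = Real.pi * √x := by
  rcases hx.eq_or_lt with rfl | hx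
  · simp
  have hs : 0 < √x := Real.sqrt_pos.2 hx
  have : ∀ u : ℝ, x / (x + u ^ 2) = (1 + (u / √x) ^ 2)⁻¹ := fun u ↦ by
    rw [div_pow, Real.sq_sqrt hx.le]
    field_simp
  simp_rw [this]
  rw [Measure.integral_comp_div (fun u : ℝ ↦ (1 + u ^ 2)⁻¹), integral_univ_inv_one_add_sq,
    abs_of_pos hs, smul_eq_mul, mul_comm]

lemma integrable_div_add_sq {x : ℝ} (hx : 0 ≤ x) : Integrable fun u : ℝ ↦ x / (x + u ^ 2) := by
  rcases hx.eq_or_lt with rfl | hx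
  · simp
  have hs : 0 < √x := Real.sqrt_pos.2 hx
  have : (fun u : ℝ ↦ x / (x + u ^ 2)) = fun u ↦ (1 + (u / √x) ^ 2)⁻¹ := by
    ext u
    rw [div_pow, Real.sq_sqrt hx.le]
    field_simp
  rw [this]
  exact integrable_inv_one_add_sq.comp_div hs.ne'

/-- The Stieltjes transform of the semicircle on `[α, β]`, evaluated at the origin. -/
lemma integral_sqrt_mul_div {α β : ℝ} (hα : 0 < α) (hαβ : α < β) :
    ∫ y in α..β, √((y - α) * (β - y)) / y = Real.pi * ((α + β) / 2 - √(α * β)) := by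
  have hd : 0 < β - α := sub_pos.2 hαβ
  have hβ : 0 < β := hα.trans hαβ
  -- an explicit primitive
  set F : ℝ → ℝ := fun y ↦ √((y - α) * (β - y)) +
    (α + β) / 2 * Real.arcsin ((2 * y - α - β) / (β - α)) -
    √(α * β) * Real.arcsin (((α + β) * y - 2 * (α * β)) / (y * (β - α))) with hF
  have hne : ∀ y ∈ Set.Icc α β, y ≠ 0 := fun y hy ↦ (hα.trans_le hy.1).ne'
  have hcont : ContinuousOn F (Set.Icc α β) := by
    apply ContinuousOn.sub
    · apply Continuous.continuousOn
      have := Real.continuous_arcsin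
      fun_prop
    · apply ContinuousOn.mul continuousOn_const
      apply Real.continuous_arcsin.comp_continuousOn
      apply ContinuousOn.div (by fun_prop) (by fun_prop)
      intro y hy
      exact mul_ne_zero (hne y hy) hd.ne'
  have hderiv : ∀ y ∈ Set.Ioo α β, HasDerivAt F (√((y - α) * (β - y)) / y) y := by
    intro y ⟨h1, h2⟩
    have hy : 0 < y := hα.trans h1
    have hR : 0 < (y - α) * (β - y) := mul_pos (sub_pos.2 h1) (sub_pos.2 h2)
    have hP : 0 < α * β := mul_pos hα hβ
    set R := (y - α) * (β - y) with hRdef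
    have hsR : 0 < √R := Real.sqrt_pos.2 hR
    have hsP : 0 < √(α * β) := Real.sqrt_pos.2 hP
    have hsR2 : √R ^ 2 = R := Real.sq_sqrt hR.le
    have hsP2 : √(α * β) ^ 2 = α * β := Real.sq_sqrt hP.le
    have d1 : HasDerivAt (fun y ↦ √((y - α) * (β - y))) ((α + β - 2 * y) / (2 * √R)) y := by
      have h : HasDerivAt (fun y ↦ (y - α) * (β - y)) (α + β - 2 * y) y :=
        (((hasDerivAt_id y).sub_const α).mul ((hasDerivAt_id y).const_sub β)).congr_deriv
          (by simp only [id]; ring)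
      exact h.sqrt hR.ne'
    set z := (2 * y - α - β) / (β - α) with hz
    set w := ((α + β) * y - 2 * (α * β)) / (y * (β - α)) with hw
    have z2 : 1 - z ^ 2 = (2 * √R / (β - α)) ^ 2 := by
      rw [div_pow (2 * √R), mul_pow 2 (√R), hsR2, hz, hRdef]
      field_simp
      ring
    have w2 : 1 - w ^ 2 = (2 * √(α * β) * √R / (y * (β - α))) ^ 2 := by
      rw [div_pow (2 * √(α * β) * √R), mul_pow _ (√R), mul_pow 2 √(α * β), hsR2, hsP2, hw, hRdef]
      field_simp
      ring
    have zs : √(1 - z ^ 2) = 2 * √R / (β - α) := by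
      rw [z2, Real.sqrt_sq (by positivity)]
    have ws : √(1 - w ^ 2) = 2 * √(α * β) * √R / (y * (β - α)) := by
      rw [w2, Real.sqrt_sq (by positivity)]
    have zlt : z ^ 2 < 1 := by
      have : 0 < (2 * √R / (β - α)) ^ 2 := by positivity
      linarith
    have wlt : w ^ 2 < 1 := by
      have : 0 < (2 * √(α * β) * √R / (y * (β - α))) ^ 2 := by positivity
      linarith
    have d2 : HasDerivAt (fun y ↦ Real.arcsin ((2 * y - α - β) / (β - α))) (1 / √R) y := by
      have hz' : HasDerivAt (fun y : ℝ ↦ (2 * y - α - β) / (β - α)) (2 / (β - α)) y := by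
        simpa using ((((hasDerivAt_id y).const_mul 2).sub_const α).sub_const β).div_const (β - α)
      have ha := abs_lt.1 ((sq_lt_one_iff_abs_lt_one z).1 zlt)
      refine ((Real.hasDerivAt_arcsin ha.1.ne' ha.2.ne).comp y hz').congr_deriv ?_
      rw [zs]
      field_simp
    have d3 : HasDerivAt (fun y ↦ Real.arcsin (((α + β) * y - 2 * (α * β)) / (y * (β - α))))
        (√(α * β) / (y * √R)) y := by
      have hw' : HasDerivAt (fun y : ℝ ↦ ((α + β) * y - 2 * (α * β)) / (y * (β - α)))
          (2 * (α * β) / (y ^ 2 * (β - α))) y := by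
        refine ((((hasDerivAt_id y).const_mul (α + β)).sub_const (2 * (α * β))).div
          ((hasDerivAt_id y).mul_const (β - α)) (mul_pos hy hd).ne').congr_deriv ?_
        simp only [id]
        field_simp
        ring
      have ha := abs_lt.1 ((sq_lt_one_iff_abs_lt_one w).1 wlt)
      refine ((Real.hasDerivAt_arcsin ha.1.ne' ha.2.ne).comp y hw').congr_deriv ?_
      rw [ws]
      field_simp
      rw [hsP2]
    refine ((d1.add (d2.const_mul ((α + β) / 2))).sub (d3.const_mul √(α * β))).congr_deriv ?_
    field_simp
    rw [hsR2, hsP2, hRdef]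
    ring
  have hint : IntervalIntegrable (fun y ↦ √((y - α) * (β - y)) / y) volume α β := by
    apply ContinuousOn.intervalIntegrable
    rw [Set.uIcc_of_le hαβ.le]
    exact ContinuousOn.div (by fun_prop) (by fun_prop) hne
  rw [intervalIntegral.integral_eq_sub_of_hasDerivAt_of_le hαβ.le hcont hderiv hint, hF]
  have e1 : (2 * β - α - β) / (β - α) = 1 := by field_simp; ring
  have e2 : (2 * α - α - β) / (β - α) = -1 := by field_simp; ring
  have e3 : ((α + β) * β - 2 * (α * β)) / (β * (β - α)) = 1 := by field_simp; ring
  have e4 : ((α + β) * α - 2 * (α * β)) / (α * (β - α)) = -1 := by field_simp; ring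
  simp only [e1, e2, e3, e4, Real.arcsin_one, Real.arcsin_neg_one, sub_self, mul_zero, zero_mul,
    Real.sqrt_zero]
  ring

lemma edgeLow_nonneg (c : ℝ) : 0 ≤ edgeLow c := sq_nonneg _

lemma edgeLow_lt_edgeHigh {c : ℝ} (hc : 1 ≤ c) : edgeLow c < edgeHigh c := by
  unfold edgeLow edgeHigh
  nlinarith [Real.sqrt_pos.2 (zero_lt_one.trans_le hc)]

lemma measurable_edgeIntegrand (c : ℝ) : Measurable (edgeIntegrand c) := by
  unfold edgeIntegrand
  fun_prop

lemma edgeIntegrand_nonneg (c x : ℝ) : 0 ≤ edgeIntegrand c x := by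
  unfold edgeIntegrand
  positivity

/-- The integrand is bounded, also when the lower edge `0` makes its denominator vanish (`c = 1`):
the factor `√(x - a)` compensates for `√x`. -/
lemma intervalIntegrable_edgeIntegrand {c : ℝ} (hc : 1 ≤ c) :
    IntervalIntegrable (edgeIntegrand c) volume (edgeLow c) (edgeHigh c) := by
  rw [intervalIntegrable_iff_integrableOn_Ioc_of_le (edgeLow_lt_edgeHigh hc).le]
  refine Measure.integrableOn_of_bounded (M := √(edgeHigh c)) measure_Ioc_lt_top.ne
    (measurable_edgeIntegrand c).aestronglyMeasurable ?_
  filter_upwards [ae_restrict_mem measurableSet_Ioc] with x hx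
  have ha := edgeLow_nonneg c
  have hx0 : 0 < x := ha.trans_lt hx.1
  rw [Real.norm_of_nonneg (edgeIntegrand_nonneg c x)]
  unfold edgeIntegrand
  rw [div_le_iff₀ (by positivity)]
  have h1 : √((x - edgeLow c) * (edgeHigh c - x)) ≤ √(edgeHigh c * x) := by
    apply Real.sqrt_le_sqrt
    nlinarith [hx.1, hx.2]
  rw [Real.sqrt_mul (hx0.le.trans hx.2)] at h1
  have h2 : √(edgeHigh c) * √x ≤ √(edgeHigh c) * (2 * Real.pi * √x) := by
    apply mul_le_mul_of_nonneg_left _ (Real.sqrt_nonneg _)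
    nlinarith [Real.pi_gt_three, Real.sqrt_nonneg x]
  linarith

/-- The Stieltjes transform of the Marchenko–Pastur density, in the scaling of `edgeIntegrand`. -/
lemma integral_edge_div_add {c t : ℝ} (hc : 1 ≤ c) (ht : 0 < t) :
    ∫ x in (edgeLow c)..(edgeHigh c),
      √((x - edgeLow c) * (edgeHigh c - x)) / (2 * Real.pi * (x + t)) = mpRoot c⁻¹ (t / c) := by
  have hc0 : 0 < c := zero_lt_one.trans_le hc
  have h := integral_sqrt_mul_div (α := edgeLow c + t) (β := edgeHigh c + t)
    (add_pos_of_nonneg_of_pos (edgeLow_nonneg c) ht) (by linarith [edgeLow_lt_edgeHigh hc])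
  rw [← intervalIntegral.integral_comp_add_right
    (fun y ↦ √((y - (edgeLow c + t)) * (edgeHigh c + t - y)) / y) t] at h
  have e : ∀ x, √((x - edgeLow c) * (edgeHigh c - x)) / (2 * Real.pi * (x + t)) =
      (2 * Real.pi)⁻¹ * (√((x + t - (edgeLow c + t)) * (edgeHigh c + t - (x + t))) / (x + t)) := by
    intro x
    rw [add_sub_add_right_eq_sub, add_sub_add_right_eq_sub, mul_comm _ (x + t), ← div_div,
      div_eq_mul_inv _ (2 * Real.pi), mul_comm]
  simp_rw [e]
  rw [intervalIntegral.integral_const_mul, h]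
  have hs := Real.sq_sqrt hc0.le
  have h1 : (edgeLow c + t + (edgeHigh c + t)) / 2 = c + 1 + t := by
    unfold edgeLow edgeHigh
    linear_combination hs
  have h2 : (edgeLow c + t) * (edgeHigh c + t) = (c + 1 + t) ^ 2 - 4 * c := by
    unfold edgeLow edgeHigh
    linear_combination (√c ^ 2 + c - 2 + 2 * t) * hs
  have h3 : (1 + c⁻¹ + t / c) ^ 2 - 4 * c⁻¹ = ((c + 1 + t) ^ 2 - 4 * c) / c ^ 2 := by
    field_simp
  have hd : 0 ≤ (c + 1 + t) ^ 2 - 4 * c := by nlinarith [sq_nonneg (c - 1), mul_pos hc0 ht]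
  rw [h1, h2]
  unfold mpRoot
  rw [h3, Real.sqrt_div hd, Real.sqrt_sq hc0.le]
  have hS := Real.sq_sqrt hd
  have hS0 := Real.sqrt_nonneg ((c + 1 + t) ^ 2 - 4 * c)
  set S := √((c + 1 + t) ^ 2 - 4 * c)
  have hD : 0 < c + 1 + t + S := by positivity
  have : 1 + c⁻¹ + t / c + S / c = (c + 1 + t + S) / c := by
    field_simp
  rw [this]
  field_simp
  linear_combination -hS

lemma integral_edgeIntegrand {c : ℝ} (hc : 1 ≤ c) :
    ∫ x in (edgeLow c)..(edgeHigh c), edgeIntegrand c x =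
      Real.pi⁻¹ * ∫ u : ℝ, mpRoot c⁻¹ (u ^ 2 / c) := by
  have hab := (edgeLow_lt_edgeHigh hc).le
  have ha := edgeLow_nonneg c
  set ν := volume.restrict (Set.Ioc (edgeLow c) (edgeHigh c)) with hν
  set f : ℝ → ℝ → ℝ := fun x u ↦
    √((x - edgeLow c) * (edgeHigh c - x)) / (2 * Real.pi * (x + u ^ 2)) with hf
  have hfe : ∀ x, 0 < x → ∀ u, f x u =
      √((x - edgeLow c) * (edgeHigh c - x)) / (2 * Real.pi * x) * (x / (x + u ^ 2)) := by
    intro x hx u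
    have : x + u ^ 2 ≠ 0 := by positivity
    simp only [hf]
    field_simp
  have hpos : ∀ᵐ x ∂ν, 0 < x := by
    filter_upwards [ae_restrict_mem measurableSet_Ioc] with x hx using ha.trans_lt hx.1
  have hin : ∀ x, 0 < x → ∫ u, f x u = Real.pi * edgeIntegrand c x := by
    intro x hx
    simp_rw [hfe x hx]
    rw [integral_const_mul, integral_div_add_sq hx.le, edgeIntegrand]
    have hs := Real.sq_sqrt hx.le
    have : √x ≠ 0 := (Real.sqrt_pos.2 hx).ne'
    field_simp
    rw [hs, mul_comm]
  have hmeas : Measurable (Function.uncurry f) := by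
    simp only [hf, Function.uncurry_def]
    fun_prop
  have hint : Integrable (Function.uncurry f) (ν.prod volume) := by
    rw [integrable_prod_iff hmeas.aestronglyMeasurable]
    constructor
    · filter_upwards [hpos] with x hx
      simp only [Function.uncurry_apply_pair]
      simp_rw [hfe x hx]
      exact (integrable_div_add_sq hx.le).const_mul _
    · have h1 : Integrable (fun x ↦ Real.pi * edgeIntegrand c x) ν :=
        ((intervalIntegrable_iff_integrableOn_Ioc_of_le hab).1
          (intervalIntegrable_edgeIntegrand hc)).const_mul _
      refine h1.congr ?_
      filter_upwards [hpos] with x hx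
      rw [← hin x hx]
      refine integral_congr_ae (ae_of_all _ fun u ↦ ?_)
      simp only [Function.uncurry_apply_pair]
      rw [Real.norm_of_nonneg]
      simp only [hf]
      positivity
  have hswap := integral_integral_swap hint
  have hL : ∫ x, (∫ u, f x u) ∂ν = Real.pi * ∫ x in (edgeLow c)..(edgeHigh c), edgeIntegrand c x := by
    rw [intervalIntegral.integral_of_le hab, ← integral_const_mul]
    refine integral_congr_ae ?_
    filter_upwards [hpos] with x hx using hin x hx
  have hR : ∫ u, (∫ x, f x u ∂ν) = ∫ u : ℝ, mpRoot c⁻¹ (u ^ 2 / c) := by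
    refine integral_congr_ae ?_
    have h0 : ∀ᵐ u : ℝ, u ≠ 0 := by simp [ae_iff]
    filter_upwards [h0] with u hu
    rw [← integral_edge_div_add hc (by positivity), intervalIntegral.integral_of_le hab]
  rw [← hR, ← hswap, hL]
  field_simp

/-- The limiting constant is the square of a Stieltjes-type integral which no longer involves a
spectral density; all properties of `chiLim` are read off from this formula. -/
lemma chiLim_eq {c : ℝ} (hc : 1 ≤ c) :
    chiLim c = (Real.pi⁻¹ * ∫ u : ℝ, mpRoot c⁻¹ (u ^ 2)) ^ 2 := by
  have hc0 : 0 < c := zero_lt_one.trans_le hc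
  have h : ∫ u : ℝ, mpRoot c⁻¹ (u ^ 2 / c) = √c * ∫ u : ℝ, mpRoot c⁻¹ (u ^ 2) := by
    have : ∀ u : ℝ, u ^ 2 / c = (u / √c) ^ 2 := fun u ↦ by
      rw [div_pow, Real.sq_sqrt hc0.le]
    simp_rw [this]
    rw [Measure.integral_comp_div (fun u : ℝ ↦ mpRoot c⁻¹ (u ^ 2)),
      abs_of_nonneg (Real.sqrt_nonneg c), smul_eq_mul]
  rw [chiLim, integral_edgeIntegrand hc, h, mul_left_comm, mul_pow, Real.sq_sqrt hc0.le]
  field_simp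

lemma integral_mpRoot_sq_nonneg {l : ℝ} (hl : 0 ≤ l) : 0 ≤ ∫ u : ℝ, mpRoot l (u ^ 2) :=
  integral_nonneg fun u ↦ (mpRoot_pos (by positivity) hl).le

lemma strictMonoOn_chiLim : StrictMonoOn chiLim (Set.Ici 1) := by
  intro c hc d hd hcd
  have hc : 1 ≤ c := hc
  have hd : 1 ≤ d := hd
  have hc0 : 0 < c := zero_lt_one.trans_le hc
  have hlt : d⁻¹ < c⁻¹ := inv_strictAnti₀ hc0 hcd
  have hc1 : c⁻¹ ≤ 1 := inv_le_one_of_one_le₀ hc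
  have hci : 0 ≤ c⁻¹ := by positivity
  have hdi : 0 ≤ d⁻¹ := inv_nonneg.2 (zero_le_one.trans hd)
  rw [chiLim_eq hc, chiLim_eq hd]
  have h : ∫ u : ℝ, mpRoot c⁻¹ (u ^ 2) < ∫ u : ℝ, mpRoot d⁻¹ (u ^ 2) := by
    rw [← sub_pos, ← integral_sub (integrable_mpRoot_sq hdi) (integrable_mpRoot_sq hci)]
    have hpos : ∀ u : ℝ, u ≠ 0 → 0 < mpRoot d⁻¹ (u ^ 2) - mpRoot c⁻¹ (u ^ 2) := fun u hu ↦
      sub_pos.2 (mpRoot_lt (by positivity) hdi hlt hc1)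
    have h0 : ∀ᵐ u : ℝ, u ≠ 0 := by simp [ae_iff]
    rw [integral_pos_iff_support_of_nonneg_ae]
    · have : Set.univ \ {0} ⊆ Function.support
          fun u : ℝ ↦ mpRoot d⁻¹ (u ^ 2) - mpRoot c⁻¹ (u ^ 2) :=
        fun u hu ↦ (hpos u hu.2).ne'
      refine lt_of_lt_of_le ?_ (measure_mono this)
      rw [measure_sdiff_null (by simp)]
      simp
    · filter_upwards [h0] with u hu using (hpos u hu).le
    · exact (integrable_mpRoot_sq hdi).sub (integrable_mpRoot_sq hci)
  apply pow_lt_pow_left₀ _ _ two_ne_zero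
  · exact mul_lt_mul_of_pos_left h (by positivity)
  · exact mul_nonneg (by positivity) (integral_mpRoot_sq_nonneg hci)

lemma chiLim_one : chiLim 1 = (8 / (3 * Real.pi)) ^ 2 := by
  have ha : edgeLow 1 = 0 := by simp [edgeLow]
  have hb : edgeHigh 1 = 4 := by norm_num [edgeHigh]
  have h : ∫ x in (0 : ℝ)..4, edgeIntegrand 1 x = 8 / (3 * Real.pi) := by
    have e : ∫ x in (0 : ℝ)..4, edgeIntegrand 1 x =
        ∫ x in (0 : ℝ)..4, (2 * Real.pi)⁻¹ * (4 - x) ^ (1 / 2 : ℝ) := by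
      refine intervalIntegral.integral_congr_ae (ae_of_all _ fun x hx ↦ ?_)
      rw [Set.uIoc_of_le (by norm_num)] at hx
      have : √x ≠ 0 := (Real.sqrt_pos.2 hx.1).ne'
      rw [edgeIntegrand, ha, hb, sub_zero, Real.sqrt_mul hx.1.le, ← Real.sqrt_eq_rpow]
      field_simp
    rw [e, intervalIntegral.integral_const_mul,
      intervalIntegral.integral_comp_sub_left (fun x : ℝ ↦ x ^ (1 / 2 : ℝ)) 4,
      integral_rpow (by norm_num)]
    have h4 : (4 : ℝ) ^ (3 / 2 : ℝ) = 8 := by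
      rw [show (4 : ℝ) = 2 ^ (2 : ℝ) by norm_num, ← Real.rpow_mul (by norm_num)]
      norm_num
    rw [show (1 / 2 + 1 : ℝ) = 3 / 2 by norm_num, sub_self, sub_zero, h4,
      Real.zero_rpow (by norm_num)]
    field_simp
    norm_num
  rw [chiLim, ha, hb, h, inv_one, one_mul]

lemma tendsto_chiLim_atTop : Tendsto chiLim atTop (𝓝 1) := by
  have h : Tendsto (fun c : ℝ ↦ ∫ u : ℝ, mpRoot c⁻¹ (u ^ 2)) atTop
      (𝓝 (∫ u : ℝ, (1 + u ^ 2)⁻¹)) := by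
    refine tendsto_integral_filter_of_dominated_convergence (fun u : ℝ ↦ (1 + u ^ 2)⁻¹) ?_ ?_
      integrable_inv_one_add_sq ?_
    · exact Eventually.of_forall fun c ↦ (measurable_mpRoot_sq _).aestronglyMeasurable
    · filter_upwards [eventually_ge_atTop 1] with c hc
      refine ae_of_all _ fun u ↦ ?_
      have hi : 0 ≤ c⁻¹ := inv_nonneg.2 (zero_le_one.trans hc)
      rw [Real.norm_of_nonneg (mpRoot_pos (by positivity) hi).le]
      exact mpRoot_sq_le hi u
    · refine ae_of_all _ fun u ↦ ?_
      rw [← mpRoot_zero_left (sq_nonneg u)]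
      exact (continuousAt_mpRoot_left (sq_nonneg u)).tendsto.comp tendsto_inv_atTop_zero
  rw [integral_univ_inv_one_add_sq] at h
  have h2 := (h.const_mul Real.pi⁻¹).pow 2
  rw [inv_mul_cancel₀ Real.pi_ne_zero, one_pow] at h2
  refine h2.congr' ?_
  filter_upwards [eventually_ge_atTop 1] with c hc
  rw [chiLim_eq hc]

variable {M N : ℕ}

section PositivePart

open scoped ComplexOrder

/-! ### The positive part of a matrix -/

lemma posSemidef_matAbs (A : Matrix (Fin M) (Fin N) ℂ) : (matAbs A).PosSemidef :=
  Matrix.nonneg_iff_posSemidef.1 (CFC.sqrt_nonneg _)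

lemma gram_nonneg (A : Matrix (Fin M) (Fin N) ℂ) : 0 ≤ Aᴴ * A :=
  Matrix.nonneg_iff_posSemidef.2 (Matrix.posSemidef_conjTranspose_mul_self A)

lemma matAbs_mul_self (A : Matrix (Fin M) (Fin N) ℂ) : matAbs A * matAbs A = Aᴴ * A :=
  CFC.sqrt_mul_sqrt_self _ (gram_nonneg A)

lemma matAbs_eq_of_mul_self {A : Matrix (Fin M) (Fin N) ℂ} {B : Matrix (Fin N) (Fin N) ℂ}
    (hB : B.PosSemidef) (h : B * B = Aᴴ * A) : matAbs A = B :=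
  CFC.sqrt_unique h (Matrix.nonneg_iff_posSemidef.2 hB)

lemma conj_matAbs_apply (A : Matrix (Fin M) (Fin N) ℂ) (i j : Fin N) :
    starRingEnd ℂ (matAbs A i j) = matAbs A j i :=
  (posSemidef_matAbs A).isHermitian.apply j i

lemma matAbs_mul_unitary (A : Matrix (Fin M) (Fin N) ℂ) {U : Matrix (Fin N) (Fin N) ℂ}
    (hU : U * Uᴴ = 1) : matAbs (A * U) = Uᴴ * matAbs A * U := by
  apply matAbs_eq_of_mul_self ((posSemidef_matAbs A).conjTranspose_mul_mul_same U)
  calc Uᴴ * matAbs A * U * (Uᴴ * matAbs A * U)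
      = Uᴴ * matAbs A * (U * Uᴴ) * matAbs A * U := by simp only [Matrix.mul_assoc]
    _ = Uᴴ * (matAbs A * matAbs A) * U := by rw [hU]; simp only [Matrix.mul_assoc, Matrix.one_mul]
    _ = (A * U)ᴴ * (A * U) := by
      rw [matAbs_mul_self, Matrix.conjTranspose_mul]
      simp only [Matrix.mul_assoc]

lemma matAbs_matConj (A : Matrix (Fin M) (Fin N) ℂ) :
    matAbs (matConj A) = (matAbs A).map (starRingEnd ℂ) := by
  have h : (matAbs A).map (starRingEnd ℂ) = (matAbs A)ᵀ := by
    ext i j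
    exact conj_matAbs_apply A i j
  rw [h]
  apply matAbs_eq_of_mul_self (posSemidef_matAbs A).transpose
  rw [← Matrix.transpose_mul, matAbs_mul_self]
  ext i j
  simp [Matrix.mul_apply, matConj, mul_comm]

lemma absTensor_apply (A : Matrix (Fin M) (Fin N) ℂ) (p q : Fin N × Fin N) :
    absTensor A p q = matAbs A p.1 q.1 * starRingEnd ℂ (matAbs A p.2 q.2) := by
  rw [absTensor, Matrix.kroneckerMap_apply, matAbs_matConj, Matrix.map_apply]

section Continuity

open scoped Matrix.Norms.L2Operator

lemma continuous_matAbs : Continuous (matAbs : Matrix (Fin M) (Fin N) ℂ → _) := by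
  have h : Continuous fun A : Matrix (Fin M) (Fin N) ℂ ↦ Aᴴ * A := by fun_prop
  exact CFC.continuousOn_sqrt.comp_continuous h gram_nonneg

end Continuity

/-- The squared Hilbert–Schmidt norm. -/
noncomputable def hsNormSq (A : Matrix (Fin M) (Fin N) ℂ) : ℝ := ∑ i, ∑ j, ‖A i j‖ ^ 2

lemma trace_gram (A : Matrix (Fin M) (Fin N) ℂ) : (Aᴴ * A).trace = (hsNormSq A : ℂ) := by
  unfold hsNormSq
  push_cast
  rw [Finset.sum_comm]
  simp only [Matrix.trace, Matrix.diag, Matrix.mul_apply, Matrix.conjTranspose_apply]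
  refine Finset.sum_congr rfl fun i _ ↦ Finset.sum_congr rfl fun j _ ↦ ?_
  rw [RCLike.star_def, mul_comm, Complex.mul_conj, Complex.normSq_eq_norm_sq]
  push_cast
  rfl

lemma hsNormSq_eq_sum_norm_matAbs (A : Matrix (Fin M) (Fin N) ℂ) :
    ∑ i, ∑ j, ‖matAbs A i j‖ ^ 2 = hsNormSq A := by
  have h := congrArg Matrix.trace (matAbs_mul_self A)
  have h1 : (matAbs A * matAbs A).trace = ((∑ i, ∑ j, ‖matAbs A i j‖ ^ 2 : ℝ) : ℂ) := by
    push_cast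
    simp only [Matrix.trace, Matrix.diag, Matrix.mul_apply]
    refine Finset.sum_congr rfl fun i _ ↦ Finset.sum_congr rfl fun j _ ↦ ?_
    rw [← conj_matAbs_apply A i j, Complex.mul_conj, Complex.normSq_eq_norm_sq]
    push_cast
    rfl
  rw [h1, trace_gram] at h
  exact_mod_cast h

lemma hsNormSq_nonneg (A : Matrix (Fin M) (Fin N) ℂ) : 0 ≤ hsNormSq A := by
  unfold hsNormSq
  positivity

lemma norm_matAbs_apply_sq_le (A : Matrix (Fin M) (Fin N) ℂ) (i j : Fin N) :
    ‖matAbs A i j‖ ^ 2 ≤ hsNormSq A := by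
  rw [← hsNormSq_eq_sum_norm_matAbs]
  calc ‖matAbs A i j‖ ^ 2 ≤ ∑ j, ‖matAbs A i j‖ ^ 2 :=
        Finset.single_le_sum (f := fun j ↦ ‖matAbs A i j‖ ^ 2) (fun _ _ ↦ by positivity)
          (Finset.mem_univ j)
    _ ≤ _ := Finset.single_le_sum (f := fun i ↦ ∑ j, ‖matAbs A i j‖ ^ 2)
          (fun _ _ ↦ by positivity) (Finset.mem_univ i)

lemma trace_matAbs (A : Matrix (Fin M) (Fin N) ℂ) : (matAbs A).trace = (traceNorm A : ℂ) := by
  rw [traceNorm, eq_comm, ← Complex.conj_eq_iff_re, Matrix.trace, map_sum]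
  exact Finset.sum_congr rfl fun i _ ↦ conj_matAbs_apply A i i

/-! ### Diagonalisation of the Gram matrix -/

/-- The resolvent `(A* A + t)⁻¹` of the Gram matrix. -/
noncomputable def gramResolvent (A : Matrix (Fin M) (Fin N) ℂ) (t : ℝ) : Matrix (Fin N) (Fin N) ℂ :=
  (Aᴴ * A + (t : ℂ) • 1)⁻¹

/-- The normalised trace of `A* A (A* A + t)⁻¹`; for `t > 0` it lies in `[0, 1]`. -/
noncomputable def gramTrace (A : Matrix (Fin M) (Fin N) ℂ) (t : ℝ) : ℝ :=
  (Aᴴ * A * gramResolvent A t).trace.re / N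

/-- Joint diagonalisation of the Gram matrix, the positive part and the resolvents. -/
lemma exists_diagonalization (A : Matrix (Fin M) (Fin N) ℂ) :
    ∃ (V : Matrix (Fin N) (Fin N) ℂ) (x : Fin N → ℝ), Vᴴ * V = 1 ∧ V * Vᴴ = 1 ∧ (∀ i, 0 ≤ x i) ∧
      Aᴴ * A = V * Matrix.diagonal (fun i ↦ (x i : ℂ)) * Vᴴ ∧
      matAbs A = V * Matrix.diagonal (fun i ↦ ((√(x i) : ℝ) : ℂ)) * Vᴴ ∧
      ∀ t : ℝ, 0 < t →
        gramResolvent A t = V * Matrix.diagonal (fun i ↦ (((x i + t)⁻¹ : ℝ) : ℂ)) * Vᴴ := by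
  have hH := Matrix.isHermitian_conjTranspose_mul_self A
  set V : Matrix (Fin N) (Fin N) ℂ := (hH.eigenvectorUnitary : Matrix (Fin N) (Fin N) ℂ) with hV
  have hV1 : Vᴴ * V = 1 := Unitary.coe_star_mul_self hH.eigenvectorUnitary
  have hV2 : V * Vᴴ = 1 := Unitary.coe_mul_star_self hH.eigenvectorUnitary
  have hx : ∀ i, 0 ≤ hH.eigenvalues i :=
    (Matrix.posSemidef_conjTranspose_mul_self A).eigenvalues_nonneg
  have hA : Aᴴ * A = V * Matrix.diagonal (fun i ↦ (hH.eigenvalues i : ℂ)) * Vᴴ := by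
    conv_lhs => rw [hH.spectral_theorem, Unitary.conjStarAlgAut_apply]
    rfl
  have hmul : ∀ d e : Fin N → ℂ, V * Matrix.diagonal d * Vᴴ * (V * Matrix.diagonal e * Vᴴ) =
      V * Matrix.diagonal (fun i ↦ d i * e i) * Vᴴ := by
    intro d e
    calc _ = V * Matrix.diagonal d * (Vᴴ * V) * Matrix.diagonal e * Vᴴ := by
          simp only [Matrix.mul_assoc]
      _ = V * (Matrix.diagonal d * Matrix.diagonal e) * Vᴴ := by
          rw [hV1]; simp only [Matrix.mul_assoc, Matrix.one_mul]
      _ = _ := by rw [Matrix.diagonal_mul_diagonal]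
  refine ⟨V, hH.eigenvalues, hV1, hV2, hx, hA, ?_, ?_⟩
  · apply matAbs_eq_of_mul_self
    · apply Matrix.PosSemidef.mul_mul_conjTranspose_same
      rw [Matrix.posSemidef_diagonal_iff]
      intro i
      exact_mod_cast Real.sqrt_nonneg _
    · rw [hmul]
      refine Eq.trans ?_ hA.symm
      congr 3
      ext i
      rw [← Complex.ofReal_mul, Real.mul_self_sqrt (hx i)]
  · intro t ht
    apply Matrix.inv_eq_right_inv
    have ht' : Aᴴ * A + (t : ℂ) • 1 =
        V * Matrix.diagonal (fun i ↦ (hH.eigenvalues i : ℂ) + t) * Vᴴ := by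
      have : Matrix.diagonal (fun i ↦ (hH.eigenvalues i : ℂ) + t) =
          Matrix.diagonal (fun i ↦ (hH.eigenvalues i : ℂ)) + (t : ℂ) • 1 := by
        rw [← Matrix.diagonal_one, ← Matrix.diagonal_smul, Matrix.diagonal_add]
        simp
      rw [this, Matrix.mul_add, Matrix.add_mul, ← hA, Matrix.mul_smul, Matrix.smul_mul,
        Matrix.mul_one, hV2]
    rw [ht', hmul]
    have : (fun i ↦ ((hH.eigenvalues i : ℂ) + t) * (((hH.eigenvalues i + t)⁻¹ : ℝ) : ℂ)) =
        fun _ ↦ 1 := by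
      ext i
      have : hH.eigenvalues i + t ≠ 0 := (add_pos_of_nonneg_of_pos (hx i) ht).ne'
      rw [← Complex.ofReal_add, ← Complex.ofReal_mul, mul_inv_cancel₀ this, Complex.ofReal_one]
    rw [this, Matrix.diagonal_one, Matrix.mul_one, hV2]

/-- The traces of the functions of the Gram matrix used below, in terms of its eigenvalues. -/
lemma exists_eigenvalues (A : Matrix (Fin M) (Fin N) ℂ) :
    ∃ x : Fin N → ℝ, (∀ i, 0 ≤ x i) ∧ hsNormSq A = ∑ i, x i ∧ traceNorm A = ∑ i, √(x i) ∧
      ∀ t : ℝ, 0 < t → (gramResolvent A t).trace = ((∑ i, (x i + t)⁻¹ : ℝ) : ℂ) ∧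
        (Aᴴ * A * gramResolvent A t).trace = ((∑ i, x i / (x i + t) : ℝ) : ℂ) ∧
        (Aᴴ * A * gramResolvent A t * gramResolvent A t * gramResolvent A t).trace =
          ((∑ i, x i / (x i + t) ^ 3 : ℝ) : ℂ) := by
  obtain ⟨V, x, hV, -, hx, hA, hS, hG⟩ := exists_diagonalization A
  have hmul : ∀ d e : Fin N → ℂ, V * Matrix.diagonal d * Vᴴ * (V * Matrix.diagonal e * Vᴴ) =
      V * Matrix.diagonal (fun i ↦ d i * e i) * Vᴴ := by
    intro d e
    calc _ = V * Matrix.diagonal d * (Vᴴ * V) * Matrix.diagonal e * Vᴴ := by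
          simp only [Matrix.mul_assoc]
      _ = V * (Matrix.diagonal d * Matrix.diagonal e) * Vᴴ := by
          rw [hV]; simp only [Matrix.mul_assoc, Matrix.one_mul]
      _ = _ := by rw [Matrix.diagonal_mul_diagonal]
  have htr : ∀ d : Fin N → ℂ, (V * Matrix.diagonal d * Vᴴ).trace = ∑ i, d i := by
    intro d
    rw [Matrix.trace_mul_comm, ← Matrix.mul_assoc, hV, Matrix.one_mul, Matrix.trace_diagonal]
  refine ⟨x, hx, ?_, ?_, fun t ht ↦ ⟨?_, ?_, ?_⟩⟩
  · have h := trace_gram A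
    rw [hA, htr] at h
    exact_mod_cast h.symm
  · have h := trace_matAbs A
    rw [hS, htr] at h
    exact_mod_cast h.symm
  · rw [hG t ht, htr]
    push_cast
    rfl
  · rw [hG t ht, hA, hmul, htr]
    push_cast
    rfl
  · rw [hG t ht, hA, hmul, hmul, hmul, htr]
    push_cast
    refine Finset.sum_congr rfl fun i _ ↦ ?_
    rw [div_eq_mul_inv, ← inv_pow]
    ring

lemma hsNormSq_le_traceNorm_sq (A : Matrix (Fin M) (Fin N) ℂ) :
    hsNormSq A ≤ traceNorm A ^ 2 := by
  obtain ⟨x, hx, h1, h2, -⟩ := exists_eigenvalues A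
  rw [h1, h2]
  calc ∑ i, x i = ∑ i, √(x i) ^ 2 := by simp_rw [Real.sq_sqrt (hx _)]
    _ ≤ _ := Finset.sum_sq_le_sq_sum_of_nonneg fun i _ ↦ Real.sqrt_nonneg _

lemma traceNorm_sq_le (A : Matrix (Fin M) (Fin N) ℂ) :
    traceNorm A ^ 2 ≤ N * hsNormSq A := by
  obtain ⟨x, hx, h1, h2, -⟩ := exists_eigenvalues A
  rw [h1, h2]
  refine (sq_sum_le_card_mul_sum_sq (s := Finset.univ) (f := fun i ↦ √(x i))).trans ?_
  simp_rw [Real.sq_sqrt (hx _), Finset.card_univ, Fintype.card_fin]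
  rfl

section Traces

variable {t : ℝ} (A : Matrix (Fin M) (Fin N) ℂ)

lemma gramTrace_nonneg (ht : 0 < t) : 0 ≤ gramTrace A t := by
  obtain ⟨x, hx, -, -, h⟩ := exists_eigenvalues A
  rw [gramTrace, (h t ht).2.1, Complex.ofReal_re]
  exact div_nonneg (Finset.sum_nonneg fun i _ ↦ div_nonneg (hx i) (add_nonneg (hx i) ht.le))
    (Nat.cast_nonneg _)

lemma gramTrace_le_one (ht : 0 < t) : gramTrace A t ≤ 1 := by
  obtain ⟨x, hx, -, -, h⟩ := exists_eigenvalues A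
  rw [gramTrace, (h t ht).2.1, Complex.ofReal_re]
  apply div_le_one_of_le₀ _ (Nat.cast_nonneg _)
  calc ∑ i, x i / (x i + t) ≤ ∑ i : Fin N, (1 : ℝ) := by
        refine Finset.sum_le_sum fun i _ ↦ ?_
        exact div_le_one_of_le₀ (by linarith) (add_nonneg (hx i) ht.le)
    _ = N := by simp

lemma gramTrace_mul_le (ht : 0 < t) : gramTrace A t * t ≤ hsNormSq A / N := by
  obtain ⟨x, hx, h1, -, h⟩ := exists_eigenvalues A
  rw [gramTrace, (h t ht).2.1, Complex.ofReal_re, h1, div_mul_eq_mul_div, Finset.sum_mul]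
  gcongr with i
  have := hx i
  rw [div_mul_eq_mul_div, div_le_iff₀ (by positivity)]
  nlinarith

lemma trace_gram_mul_gramResolvent (hN : 0 < N) (ht : 0 < t) :
    (Aᴴ * A * gramResolvent A t).trace = ((N * gramTrace A t : ℝ) : ℂ) := by
  obtain ⟨x, hx, -, -, h⟩ := exists_eigenvalues A
  rw [gramTrace, (h t ht).2.1, Complex.ofReal_re, mul_div_cancel₀]
  positivity

lemma trace_gramResolvent (hN : 0 < N) (ht : 0 < t) :
    (gramResolvent A t).trace = ((N * (1 - gramTrace A t) / t : ℝ) : ℂ) := by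
  obtain ⟨x, hx, -, -, h⟩ := exists_eigenvalues A
  rw [gramTrace, (h t ht).2.1, Complex.ofReal_re, (h t ht).1]
  congr 1
  have hN' : (N : ℝ) ≠ 0 := by positivity
  have : ∑ i, x i / (x i + t) = N - t * ∑ i, (x i + t)⁻¹ := by
    rw [Finset.mul_sum, eq_sub_iff_add_eq, ← Finset.sum_add_distrib]
    trans ∑ i : Fin N, (1 : ℝ)
    · refine Finset.sum_congr rfl fun i _ ↦ ?_
      have : x i + t ≠ 0 := (add_pos_of_nonneg_of_pos (hx i) ht).ne'
      field_simp
    · simp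
  rw [this]
  field_simp
  ring

/-- The size of the term produced when the derivative hits the spectral statistic itself. -/
lemma trace_gram_mul_gramResolvent_cube (ht : 0 < t) : ∃ r : ℝ, 0 ≤ r ∧ r ≤ N / t ^ 2 ∧
    (Aᴴ * A * gramResolvent A t * gramResolvent A t * gramResolvent A t).trace = (r : ℂ) := by
  obtain ⟨x, hx, -, -, h⟩ := exists_eigenvalues A
  refine ⟨_, Finset.sum_nonneg fun i _ ↦ ?_, ?_, (h t ht).2.2⟩
  · have := hx i
    positivity
  · calc ∑ i, x i / (x i + t) ^ 3 ≤ ∑ i : Fin N, 1 / t ^ 2 := by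
          refine Finset.sum_le_sum fun i _ ↦ ?_
          have := hx i
          rw [div_le_div_iff₀ (by positivity) (by positivity)]
          nlinarith [mul_nonneg this ht.le, mul_nonneg this (sq_nonneg t), pow_nonneg this 3,
            mul_nonneg (sq_nonneg (x i)) ht.le, pow_pos ht 3]
      _ = N / t ^ 2 := by simp [div_eq_mul_inv]

/-- The representation `√x = π⁻¹ ∫ x / (x + u²) du`, summed over the spectrum, turns the trace norm
into an average of resolvent traces. -/
lemma traceNorm_eq_integral : traceNorm A = Real.pi⁻¹ * ∫ u : ℝ, N * gramTrace A (u ^ 2) := by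
  obtain ⟨x, hx, -, h2, h⟩ := exists_eigenvalues A
  have h0 : ∀ᵐ u : ℝ, u ≠ 0 := by simp [ae_iff]
  have : ∫ u : ℝ, N * gramTrace A (u ^ 2) = ∫ u : ℝ, ∑ i, x i / (x i + u ^ 2) := by
    refine integral_congr_ae ?_
    filter_upwards [h0] with u hu
    rw [gramTrace, (h (u ^ 2) (by positivity)).2.1, Complex.ofReal_re]
    rcases N.eq_zero_or_pos with rfl | hN
    · simp
    · rw [mul_div_cancel₀]
      positivity
  rw [this, integral_finsetSum _ fun i _ ↦ integrable_div_add_sq (hx i), h2]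
  simp_rw [integral_div_add_sq (hx _)]
  rw [← Finset.mul_sum, inv_mul_cancel_left₀ Real.pi_ne_zero]

end Traces

/-! ### The resolvent: algebra and entrywise bounds -/

section Resolvent

variable {t : ℝ} (A : Matrix (Fin M) (Fin N) ℂ)

lemma isUnit_gram_add (ht : 0 < t) : IsUnit (Aᴴ * A + (t : ℂ) • 1) := by
  have h : (Aᴴ * A + (t : ℂ) • 1).PosDef := by
    apply Matrix.PosDef.posSemidef_add (Matrix.posSemidef_conjTranspose_mul_self A)
    exact Matrix.PosDef.one.smul (by exact_mod_cast ht)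
  exact h.isUnit

lemma gram_add_mul_gramResolvent (ht : 0 < t) :
    (Aᴴ * A + (t : ℂ) • 1) * gramResolvent A t = 1 :=
  Matrix.mul_nonsing_inv _ ((Matrix.isUnit_iff_isUnit_det _).1 (isUnit_gram_add A ht))

lemma isHermitian_gramResolvent : (gramResolvent A t).IsHermitian := by
  apply Matrix.IsHermitian.inv
  apply (Matrix.isHermitian_conjTranspose_mul_self A).add
  rw [Matrix.IsHermitian, Matrix.conjTranspose_smul, Matrix.conjTranspose_one]
  simp

lemma gram_mul_gramResolvent (ht : 0 < t) :
    Aᴴ * A * gramResolvent A t = 1 - (t : ℂ) • gramResolvent A t := by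
  have h := gram_add_mul_gramResolvent A ht
  rw [Matrix.add_mul, Matrix.smul_mul, Matrix.one_mul] at h
  exact eq_sub_of_add_eq h

lemma norm_sq_le_sum {ι : Type*} [Fintype ι] (f : ι → ℂ) (i : ι) :
    ‖f i‖ ^ 2 ≤ ∑ j, ‖f j‖ ^ 2 :=
  Finset.single_le_sum (f := fun j ↦ ‖f j‖ ^ 2) (fun _ _ ↦ by positivity) (Finset.mem_univ i)

lemma conjTranspose_mul_self_apply {m n : Type*} [Fintype m] (B : Matrix m n ℂ) (a : n) :
    (Bᴴ * B) a a = ((∑ i, ‖B i a‖ ^ 2 : ℝ) : ℂ) := by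
  rw [Matrix.mul_apply]
  push_cast
  refine Finset.sum_congr rfl fun i _ ↦ ?_
  rw [Matrix.conjTranspose_apply, RCLike.star_def, mul_comm, Complex.mul_conj,
    Complex.normSq_eq_norm_sq]
  push_cast
  rfl

lemma gramResolvent_diag (ht : 0 < t) (a : Fin N) :
    gramResolvent A t a a = ((∑ i, ‖(A * gramResolvent A t) i a‖ ^ 2 +
      t * ∑ b, ‖gramResolvent A t b a‖ ^ 2 : ℝ) : ℂ) := by
  have hG := (isHermitian_gramResolvent (t := t) A).eq
  set G := gramResolvent A t with hGdef
  have h : G = (A * G)ᴴ * (A * G) + (t : ℂ) • (Gᴴ * G) := by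
    rw [Matrix.conjTranspose_mul, hG, Matrix.mul_assoc, ← Matrix.mul_assoc Aᴴ, hGdef,
      gram_mul_gramResolvent A ht, Matrix.mul_sub, Matrix.mul_one, Matrix.mul_smul, sub_add_cancel]
  conv_lhs => rw [h, Matrix.add_apply, Matrix.smul_apply, conjTranspose_mul_self_apply,
    conjTranspose_mul_self_apply]
  push_cast
  rfl

lemma norm_gramResolvent_diag (ht : 0 < t) (a : Fin N) :
    ‖gramResolvent A t a a‖ = ∑ i, ‖(A * gramResolvent A t) i a‖ ^ 2 +
      t * ∑ b, ‖gramResolvent A t b a‖ ^ 2 := by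
  rw [gramResolvent_diag A ht a, Complex.norm_real]
  exact Real.norm_of_nonneg (by positivity)

lemma norm_gramResolvent_diag_le (ht : 0 < t) (a : Fin N) : ‖gramResolvent A t a a‖ ≤ t⁻¹ := by
  have h := norm_gramResolvent_diag A ht a
  have h1 : ‖gramResolvent A t a a‖ ^ 2 ≤ ∑ b, ‖gramResolvent A t b a‖ ^ 2 :=
    norm_sq_le_sum (fun b ↦ gramResolvent A t b a) a
  have h2 : 0 ≤ ∑ i, ‖(A * gramResolvent A t) i a‖ ^ 2 := by positivity
  rw [← one_div, le_div_iff₀ ht]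
  by_contra! hlt
  have hg : 0 < ‖gramResolvent A t a a‖ := pos_of_mul_pos_left (zero_lt_one.trans hlt) ht.le
  nlinarith [mul_pos hg (sub_pos.2 hlt), mul_le_mul_of_nonneg_left h1 ht.le]

lemma norm_gramResolvent_le (ht : 0 < t) (b a : Fin N) : ‖gramResolvent A t b a‖ ≤ t⁻¹ := by
  have h := norm_gramResolvent_diag A ht a
  have h0 := norm_gramResolvent_diag_le A ht a
  have h1 : ‖gramResolvent A t b a‖ ^ 2 ≤ ∑ b, ‖gramResolvent A t b a‖ ^ 2 :=
    norm_sq_le_sum (fun b ↦ gramResolvent A t b a) b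
  have h2 : 0 ≤ ∑ i, ‖(A * gramResolvent A t) i a‖ ^ 2 := by positivity
  apply (pow_le_pow_iff_left₀ (norm_nonneg _) (inv_pos.2 ht).le two_ne_zero).1
  have h3 : t * ‖gramResolvent A t b a‖ ^ 2 ≤ t⁻¹ := by nlinarith
  calc ‖gramResolvent A t b a‖ ^ 2 = t⁻¹ * (t * ‖gramResolvent A t b a‖ ^ 2) := by field_simp
    _ ≤ t⁻¹ * t⁻¹ := by gcongr
    _ = t⁻¹ ^ 2 := (sq _).symm

lemma norm_mul_gramResolvent_sq_le (ht : 0 < t) (i : Fin M) (a : Fin N) :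
    ‖(A * gramResolvent A t) i a‖ ^ 2 ≤ t⁻¹ := by
  have h := norm_gramResolvent_diag A ht a
  have h0 := norm_gramResolvent_diag_le A ht a
  have h1 : ‖(A * gramResolvent A t) i a‖ ^ 2 ≤ ∑ i, ‖(A * gramResolvent A t) i a‖ ^ 2 :=
    norm_sq_le_sum (fun i ↦ (A * gramResolvent A t) i a) i
  have h2 : 0 ≤ t * ∑ b, ‖gramResolvent A t b a‖ ^ 2 :=
    mul_nonneg ht.le (Finset.sum_nonneg fun _ _ ↦ sq_nonneg _)
  generalize A * gramResolvent A t = B at h h1 ⊢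
  linarith

lemma norm_mul_gramResolvent_mul_diag_le (ht : 0 < t) (i : Fin M) :
    ‖(A * gramResolvent A t * Aᴴ) i i‖ ≤ 1 := by
  have hG := (isHermitian_gramResolvent (t := t) A).eq
  set G := gramResolvent A t with hGdef
  set P := A * G * Aᴴ with hP
  have hPH : Pᴴ = P := by
    rw [hP, Matrix.conjTranspose_mul, Matrix.conjTranspose_mul, hG,
      Matrix.conjTranspose_conjTranspose, Matrix.mul_assoc]
  have h : P = Pᴴ * P + (t : ℂ) • (((A * G)ᴴ)ᴴ * (A * G)ᴴ) := by
    have e : P * P = A * G * (Aᴴ * A * G) * Aᴴ := by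
      rw [hP]
      simp only [Matrix.mul_assoc]
    rw [hPH, e, hGdef, gram_mul_gramResolvent A ht, Matrix.mul_sub, Matrix.mul_one,
      Matrix.mul_smul, Matrix.sub_mul, Matrix.smul_mul, Matrix.conjTranspose_conjTranspose,
      Matrix.conjTranspose_mul, ← hGdef, hG, ← Matrix.mul_assoc, sub_add_cancel]
  have h' : P i i = ((∑ j, ‖P j i‖ ^ 2 + t * ∑ a, ‖(A * G)ᴴ a i‖ ^ 2 : ℝ) : ℂ) := by
    conv_lhs => rw [h, Matrix.add_apply, Matrix.smul_apply, conjTranspose_mul_self_apply,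
      conjTranspose_mul_self_apply]
    push_cast
    rfl
  have h2 : ‖P i i‖ = ∑ j, ‖P j i‖ ^ 2 + t * ∑ a, ‖(A * G)ᴴ a i‖ ^ 2 := by
    rw [h', Complex.norm_real]
    exact Real.norm_of_nonneg (by positivity)
  have h3 : ‖P i i‖ ^ 2 ≤ ∑ j, ‖P j i‖ ^ 2 :=
    norm_sq_le_sum (fun j ↦ P j i) i
  have h4 : 0 ≤ t * ∑ a, ‖(A * G)ᴴ a i‖ ^ 2 := by positivity
  by_contra! hlt
  nlinarith

end Resolvent

end PositivePart

/-! ### Directional derivatives of the resolvent -/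

section Deriv

variable {t : ℝ} (A D : Matrix (Fin M) (Fin N) ℂ)

/-- The derivative of the resolvent at `A` in the real direction `D`. -/
noncomputable def gramResolventDeriv (A D : Matrix (Fin M) (Fin N) ℂ) (t : ℝ) :
    Matrix (Fin N) (Fin N) ℂ :=
  -(gramResolvent A t * (Dᴴ * A + Aᴴ * D) * gramResolvent A t)

section

open scoped Matrix.Norms.L2Operator

lemma hasDerivAt_gramResolvent_apply (ht : 0 < t) (b a : Fin N) :
    HasDerivAt (fun s : ℝ ↦ gramResolvent (A + s • D) t b a) (gramResolventDeriv A D t b a) 0 := by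
  have hW : HasDerivAt (fun s : ℝ ↦ (A + s • D)ᴴ * (A + s • D) + (t : ℂ) • 1)
      (Dᴴ * A + Aᴴ * D) 0 := by
    have e : (fun s : ℝ ↦ (A + s • D)ᴴ * (A + s • D) + (t : ℂ) • (1 : Matrix (Fin N) (Fin N) ℂ)) =
        fun s : ℝ ↦ (Aᴴ * A + (t : ℂ) • 1) + s • (Dᴴ * A + Aᴴ * D) + s ^ 2 • (Dᴴ * D) := by
      ext1 s
      rw [Matrix.conjTranspose_add, Matrix.conjTranspose_smul, star_trivial]
      simp only [Matrix.add_mul, Matrix.mul_add, Matrix.smul_mul, Matrix.mul_smul, smul_add,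
        smul_smul, sq]
      abel
    rw [e]
    have h1 := ((hasDerivAt_id (0 : ℝ)).smul_const (Dᴴ * A + Aᴴ * D)).const_add
      (Aᴴ * A + (t : ℂ) • 1)
    have h2 := ((hasDerivAt_id (0 : ℝ)).pow 2).smul_const (Dᴴ * D)
    refine (h1.add h2).congr_deriv ?_
    simp
  obtain ⟨u, hu⟩ := isUnit_gram_add A ht
  have hu' : (A + (0 : ℝ) • D)ᴴ * (A + (0 : ℝ) • D) + (t : ℂ) • 1 = (u : Matrix _ _ ℂ) := by
    rw [zero_smul, add_zero, hu]
  have hinv := hasFDerivAt_ringInverse (𝕜 := ℝ) u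
  rw [← hu'] at hinv
  have h := hinv.comp_hasDerivAt (0 : ℝ) hW
  have hGu : gramResolvent A t = ((u⁻¹ : (Matrix (Fin N) (Fin N) ℂ)ˣ) : Matrix _ _ ℂ) := by
    rw [gramResolvent, ← hu, Matrix.coe_units_inv]
  let L : Matrix (Fin N) (Fin N) ℂ →L[ℝ] ℂ :=
    LinearMap.toContinuousLinearMap (Matrix.entryLinearMap ℝ ℂ b a)
  have hL := L.hasFDerivAt.comp_hasDerivAt (0 : ℝ) h
  refine (hL.congr_of_eventuallyEq (Eventually.of_forall fun s ↦ ?_)).congr_deriv ?_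
  · simp only [Function.comp_apply, gramResolvent, Matrix.nonsing_inv_eq_ringInverse]
    rfl
  · rw [gramResolventDeriv, hGu]
    simp [L]

end

lemma hasDerivAt_mul_gramResolvent_apply (ht : 0 < t) (i : Fin M) (a : Fin N) :
    HasDerivAt (fun s : ℝ ↦ ((A + s • D) * gramResolvent (A + s • D) t) i a)
      ((D * gramResolvent A t + A * gramResolventDeriv A D t) i a) 0 := by
  have h : ∀ b, HasDerivAt (fun s : ℝ ↦ (A + s • D) i b * gramResolvent (A + s • D) t b a)
      (D i b * gramResolvent A t b a + A i b * gramResolventDeriv A D t b a) 0 := by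
    intro b
    have h1 : HasDerivAt (fun s : ℝ ↦ (A + s • D) i b) (D i b) 0 := by
      have := ((hasDerivAt_id (0 : ℝ)).smul_const (D i b)).const_add (A i b)
      rw [one_smul] at this
      exact this
    have := h1.mul (hasDerivAt_gramResolvent_apply A D ht b a)
    simpa only [zero_smul, add_zero] using! this
  have hs := HasDerivAt.fun_sum fun b (_ : b ∈ Finset.univ) ↦ h b
  simp only [Matrix.mul_apply, Finset.sum_add_distrib] at hs ⊢
  exact hs

lemma hasDerivAt_gramTrace (hN : 0 < N) (ht : 0 < t) :
    HasDerivAt (fun s : ℝ ↦ gramTrace (A + s • D) t)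
      (2 * t / N * (gramResolvent A t * gramResolvent A t * Aᴴ * D).trace.re) 0 := by
  have hN' : (N : ℝ) ≠ 0 := by positivity
  have e : ∀ B : Matrix (Fin M) (Fin N) ℂ,
      gramTrace B t = 1 - t / N * (gramResolvent B t).trace.re := by
    intro B
    rw [trace_gramResolvent B hN ht, Complex.ofReal_re]
    field_simp
    ring
  simp_rw [e]
  have h1 : HasDerivAt (fun s : ℝ ↦ (gramResolvent (A + s • D) t).trace)
      (gramResolventDeriv A D t).trace 0 :=
    HasDerivAt.fun_sum fun b (_ : b ∈ Finset.univ) ↦ hasDerivAt_gramResolvent_apply A D ht b b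
  have h2 : HasDerivAt (fun s : ℝ ↦ (gramResolvent (A + s • D) t).trace.re)
      (gramResolventDeriv A D t).trace.re 0 :=
    Complex.reCLM.hasFDerivAt.comp_hasDerivAt (0 : ℝ) h1
  refine ((h2.const_mul (t / N)).const_sub 1).congr_deriv ?_
  have hG := (isHermitian_gramResolvent (t := t) A).eq
  set G := gramResolvent A t with hGdef
  have t1 : (G * Aᴴ * D * G).trace = (G * G * Aᴴ * D).trace := by
    rw [Matrix.trace_mul_comm]
    simp only [Matrix.mul_assoc]
  have t2 : (G * Dᴴ * A * G).trace.re = (G * Aᴴ * D * G).trace.re := by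
    have : G * Dᴴ * A * G = (G * Aᴴ * D * G)ᴴ := by
      simp only [Matrix.conjTranspose_mul, hG, Matrix.conjTranspose_conjTranspose, Matrix.mul_assoc]
    rw [this, Matrix.trace_conjTranspose, RCLike.star_def, Complex.conj_re]
  have t3 : (gramResolventDeriv A D t).trace =
      -((G * Dᴴ * A * G).trace + (G * Aᴴ * D * G).trace) := by
    rw [gramResolventDeriv, ← hGdef, Matrix.trace_neg, ← Matrix.trace_add, Matrix.mul_add,
      Matrix.add_mul]
    simp only [Matrix.mul_assoc]
  rw [t3, Complex.neg_re, Complex.add_re, t2, t1]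
  ring

end Deriv

/-! ### Measurability -/

/-- The matrix with a given family of entries. -/
def toMat (y : Fin M × Fin N → ℂ) : Matrix (Fin M) (Fin N) ℂ := Matrix.of fun i j ↦ y (i, j)

lemma continuous_toMat : Continuous (toMat : (Fin M × Fin N → ℂ) → _) :=
  continuous_matrix fun i j ↦ continuous_apply (i, j)

lemma measurable_gramResolvent_apply (b a : Fin N) :
    Measurable fun p : (Fin M × Fin N → ℂ) × ℝ ↦ gramResolvent (toMat p.1) p.2 b a := by
  have hc : Continuous fun p : (Fin M × Fin N → ℂ) × ℝ ↦
      (toMat p.1)ᴴ * toMat p.1 + (p.2 : ℂ) • (1 : Matrix (Fin N) (Fin N) ℂ) := by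
    have := (continuous_toMat (M := M) (N := N)).comp
      (continuous_fst : Continuous fun p : (Fin M × Fin N → ℂ) × ℝ ↦ p.1)
    have h2 : Continuous fun p : (Fin M × Fin N → ℂ) × ℝ ↦ (p.2 : ℂ) := by fun_prop
    exact (this.matrix_conjTranspose.matrix_mul this).add (h2.smul continuous_const)
  simp only [gramResolvent, Matrix.inv_def, Matrix.smul_apply, Ring.inverse_eq_inv', smul_eq_mul]
  exact hc.matrix_det.measurable.inv.mul (hc.matrix_adjugate.matrix_elem b a).measurable

lemma measurable_gramTrace :
    Measurable fun p : (Fin M × Fin N → ℂ) × ℝ ↦ gramTrace (toMat p.1) p.2 := by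
  simp only [gramTrace, Matrix.trace, Matrix.diag, Matrix.mul_apply, Matrix.conjTranspose_apply,
    toMat, Matrix.of_apply]
  have h := measurable_gramResolvent_apply (M := M) (N := N)
  simp only [toMat] at h
  have hx : ∀ i : Fin M × Fin N, Measurable fun p : (Fin M × Fin N → ℂ) × ℝ ↦ p.1 i :=
    fun i ↦ (measurable_pi_apply i).comp measurable_fst
  refine (Complex.measurable_re.comp (Finset.measurable_fun_sum _ fun i _ ↦
    Finset.measurable_fun_sum _ fun j _ ↦ Measurable.mul ?_ (h j i))).div_const _
  exact Finset.measurable_fun_sum _ fun k _ ↦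
    (continuous_star.measurable.comp (hx (k, i))).mul (hx (k, j))

lemma measurable_traceNorm : Measurable fun y : Fin M × Fin N → ℂ ↦ traceNorm (toMat y) := by
  have h := ((continuous_matAbs (M := M) (N := N)).comp continuous_toMat).matrix_trace
  exact (Complex.continuous_re.comp h).measurable

lemma measurable_matAbs_apply (i j : Fin N) :
    Measurable fun y : Fin M × Fin N → ℂ ↦ matAbs (toMat y) i j :=
  (((continuous_matAbs (M := M) (N := N)).comp continuous_toMat).matrix_elem i j).measurable

lemma measurable_hsNormSq : Measurable fun y : Fin M × Fin N → ℂ ↦ hsNormSq (toMat y) := by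
  unfold hsNormSq toMat
  simp only [Matrix.of_apply]
  fun_prop

/-! ### Gaussian integration by parts and moments -/

lemma hasDerivAt_gaussianPDFReal {v : ℝ≥0} (hv : v ≠ 0) (x : ℝ) :
    HasDerivAt (gaussianPDFReal 0 v) (-(x / v) * gaussianPDFReal 0 v x) x := by
  have hv' : (v : ℝ) ≠ 0 := by exact_mod_cast hv
  have h : HasDerivAt (fun x : ℝ ↦ -(x - 0) ^ 2 / (2 * v)) (-(x / v)) x := by
    have := (((hasDerivAt_id x).sub_const 0).pow 2).neg.div_const (2 * (v : ℝ))
    refine this.congr_deriv ?_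
    simp only [id]
    field_simp
    ring
  rw [gaussianPDFReal_def]
  refine (h.exp.const_mul (√(2 * Real.pi * v))⁻¹).congr_deriv ?_
  ring

lemma integrable_gaussianReal_iff {v : ℝ≥0} (hv : v ≠ 0) {f : ℝ → ℂ} :
    Integrable f (gaussianReal 0 v) ↔ Integrable fun x ↦ (gaussianPDFReal 0 v x : ℂ) * f x := by
  rw [gaussianReal_of_var_ne_zero _ hv, integrable_withDensity_iff_integrable_smul'
    (measurable_gaussianPDF _ _) (ae_of_all _ fun _ ↦ gaussianPDF_lt_top)]
  simp [toReal_gaussianPDF]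

/-- **Stein's lemma** for a real Gaussian variable. -/
lemma integral_mul_gaussianReal {v : ℝ≥0} (hv : v ≠ 0) {f f' : ℝ → ℂ}
    (hf : ∀ x, HasDerivAt f (f' x) x) (h0 : Integrable f (gaussianReal 0 v))
    (h1 : Integrable f' (gaussianReal 0 v))
    (h2 : Integrable (fun x : ℝ ↦ (x : ℂ) * f x) (gaussianReal 0 v)) :
    ∫ x, (x : ℂ) * f x ∂(gaussianReal 0 v) = v * ∫ x, f' x ∂(gaussianReal 0 v) := by
  have hv' : (v : ℂ) ≠ 0 := by exact_mod_cast hv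
  rw [integrable_gaussianReal_iff hv] at h0 h1 h2
  have hu : ∀ x : ℝ, HasDerivAt (fun x ↦ (gaussianPDFReal 0 v x : ℂ))
      (-((x : ℂ) / (v : ℂ)) * (gaussianPDFReal 0 v x : ℂ)) x := by
    intro x
    refine (hasDerivAt_gaussianPDFReal hv x).ofReal_comp.congr_deriv ?_
    push_cast
    rfl
  have h3 : (fun x : ℝ ↦ -((x : ℂ) / (v : ℂ)) * (gaussianPDFReal 0 v x : ℂ) * f x) =
      fun x : ℝ ↦ -(v : ℂ)⁻¹ * ((gaussianPDFReal 0 v x : ℂ) * (x * f x)) := by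
    ext x
    field_simp
  have key := integral_mul_deriv_eq_deriv_mul_of_integrable (fun x _ ↦ hu x) (fun x _ ↦ hf x)
    h1 (by
      change Integrable fun x : ℝ ↦ -((x : ℂ) / (v : ℂ)) * (gaussianPDFReal 0 v x : ℂ) * f x
      rw [h3]
      exact h2.const_mul _) h0
  rw [integral_gaussianReal_eq_integral_smul hv, integral_gaussianReal_eq_integral_smul hv]
  simp only [Complex.real_smul]
  rw [key, h3, integral_const_mul]
  field_simp

lemma integrable_pow_gaussianReal (v : ℝ≥0) (n : ℕ) :
    Integrable (fun x : ℝ ↦ x ^ n) (gaussianReal 0 v) := by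
  have h := (memLp_id_gaussianReal (μ := 0) (v := v) (n : ℝ≥0)).integrable_norm_pow'
  refine h.mono' (by fun_prop) (ae_of_all _ fun x ↦ ?_)
  simp

lemma integrable_ofReal_pow_gaussianReal (v : ℝ≥0) (n : ℕ) :
    Integrable (fun x : ℝ ↦ (x : ℂ) ^ n) (gaussianReal 0 v) := by
  have := (integrable_pow_gaussianReal v n).ofReal (𝕜 := ℂ)
  simpa using! this

lemma integral_pow_gaussianReal_add_two {v : ℝ≥0} (hv : v ≠ 0) (n : ℕ) :
    ∫ x, x ^ (n + 2) ∂(gaussianReal 0 v) = v * ((n + 1) * ∫ x, x ^ n ∂(gaussianReal 0 v)) := by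
  have hd : ∀ x : ℝ, HasDerivAt (fun x : ℝ ↦ (x : ℂ) ^ (n + 1)) (((n + 1 : ℕ) : ℂ) * x ^ n) x := by
    intro x
    simpa using! (hasDerivAt_pow (n + 1) (x : ℂ)).comp_ofReal
  have h := integral_mul_gaussianReal hv hd (integrable_ofReal_pow_gaussianReal v _)
    ((integrable_ofReal_pow_gaussianReal v _).const_mul _)
    (by simpa only [← pow_succ'] using integrable_ofReal_pow_gaussianReal v (n + 1 + 1))
  simp only [← pow_succ'] at h
  rw [integral_const_mul] at h
  have e : ∀ m : ℕ, ∫ x : ℝ, (x : ℂ) ^ m ∂(gaussianReal 0 v) =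
      ((∫ x, x ^ m ∂(gaussianReal 0 v) : ℝ) : ℂ) := by
    intro m
    rw [← integral_complex_ofReal]
    simp
  rw [e, e] at h
  exact_mod_cast h

instance (v : ℝ≥0) : IsProbabilityMeasure (complexGaussian v) := by
  unfold complexGaussian
  exact Measure.isProbabilityMeasure_map Complex.measurableEquivRealProd.symm.measurable.aemeasurable

lemma measurePreserving_complexGaussian (v : ℝ≥0) :
    MeasurePreserving Complex.measurableEquivRealProd.symm
      ((gaussianReal 0 (v / 2)).prod (gaussianReal 0 (v / 2))) (complexGaussian v) :=
  ⟨Complex.measurableEquivRealProd.symm.measurable, rfl⟩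

lemma integral_complexGaussian {E : Type*} [NormedAddCommGroup E] [NormedSpace ℝ E] (v : ℝ≥0)
    (f : ℂ → E) : ∫ z, f z ∂(complexGaussian v) =
      ∫ p : ℝ × ℝ, f ⟨p.1, p.2⟩ ∂((gaussianReal 0 (v / 2)).prod (gaussianReal 0 (v / 2))) :=
  ((measurePreserving_complexGaussian v).integral_comp
    Complex.measurableEquivRealProd.symm.measurableEmbedding f).symm

lemma integrable_complexGaussian_iff {E : Type*} [NormedAddCommGroup E] (v : ℝ≥0)
    (f : ℂ → E) : Integrable f (complexGaussian v) ↔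
      Integrable (fun p : ℝ × ℝ ↦ f ⟨p.1, p.2⟩)
        ((gaussianReal 0 (v / 2)).prod (gaussianReal 0 (v / 2))) :=
  ((measurePreserving_complexGaussian v).integrable_comp_emb
    Complex.measurableEquivRealProd.symm.measurableEmbedding).symm

lemma norm_sq_mk (x y : ℝ) : ‖(⟨x, y⟩ : ℂ)‖ ^ 2 = x ^ 2 + y ^ 2 := by
  rw [← Complex.normSq_eq_norm_sq, Complex.normSq_mk]
  ring

lemma integrable_norm_sq_complexGaussian (v : ℝ≥0) :
    Integrable (fun z : ℂ ↦ ‖z‖ ^ 2) (complexGaussian v) := by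
  rw [integrable_complexGaussian_iff]
  simp only [norm_sq_mk]
  exact ((integrable_pow_gaussianReal _ 2).comp_fst _).add
    ((integrable_pow_gaussianReal _ 2).comp_snd _)

lemma integral_norm_sq_complexGaussian {v : ℝ≥0} (hv : v ≠ 0) :
    ∫ z, ‖z‖ ^ 2 ∂(complexGaussian v) = v := by
  have h2 := integral_pow_gaussianReal_add_two (v := v / 2) (by simpa using hv) 0
  simp only [zero_add, pow_zero, integral_const, probReal_univ, smul_eq_mul] at h2
  rw [integral_complexGaussian]
  simp only [norm_sq_mk]
  rw [integral_add ((integrable_pow_gaussianReal _ 2).comp_fst _)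
    ((integrable_pow_gaussianReal _ 2).comp_snd _),
    integral_fun_fst (fun x : ℝ ↦ x ^ 2), integral_fun_snd (fun x : ℝ ↦ x ^ 2), h2]
  simp

lemma norm_pow_four_mk (x y : ℝ) :
    ‖(⟨x, y⟩ : ℂ)‖ ^ 4 = x ^ 4 + 2 * (x ^ 2 * y ^ 2) + y ^ 4 := by
  rw [show 4 = 2 * 2 by norm_num, pow_mul, norm_sq_mk]
  ring

lemma integrable_norm_pow_four_complexGaussian (v : ℝ≥0) :
    Integrable (fun z : ℂ ↦ ‖z‖ ^ 4) (complexGaussian v) := by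
  rw [integrable_complexGaussian_iff]
  simp only [norm_pow_four_mk]
  exact (((integrable_pow_gaussianReal _ 4).comp_fst _).add
    (((integrable_pow_gaussianReal _ 2).mul_prod (integrable_pow_gaussianReal _ 2)).const_mul 2)).add
    ((integrable_pow_gaussianReal _ 4).comp_snd _)

lemma integral_norm_pow_four_complexGaussian {v : ℝ≥0} (hv : v ≠ 0) :
    ∫ z, ‖z‖ ^ 4 ∂(complexGaussian v) = 2 * v ^ 2 := by
  have hv2 : v / 2 ≠ 0 := by simpa using hv
  have h2 := integral_pow_gaussianReal_add_two hv2 0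
  have h4 := integral_pow_gaussianReal_add_two hv2 2
  simp only [zero_add, pow_zero, integral_const, probReal_univ, smul_eq_mul] at h2
  norm_num at h2 h4
  rw [h2] at h4
  rw [integral_complexGaussian]
  simp only [norm_pow_four_mk]
  rw [integral_add, integral_add, integral_const_mul, integral_prod_mul (fun x : ℝ ↦ x ^ 2)
    (fun x : ℝ ↦ x ^ 2), integral_fun_fst (fun x : ℝ ↦ x ^ 4), integral_fun_snd (fun x : ℝ ↦ x ^ 4),
    h2, h4]
  · simp
    ring
  · exact (integrable_pow_gaussianReal _ 4).comp_fst _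
  · exact ((integrable_pow_gaussianReal _ 2).mul_prod (integrable_pow_gaussianReal _ 2)).const_mul 2
  · exact ((integrable_pow_gaussianReal _ 4).comp_fst _).add
      (((integrable_pow_gaussianReal _ 2).mul_prod (integrable_pow_gaussianReal _ 2)).const_mul 2)
  · exact (integrable_pow_gaussianReal _ 4).comp_snd _

lemma integrable_id_complexGaussian (v : ℝ≥0) :
    Integrable (fun z : ℂ ↦ z) (complexGaussian v) := by
  refine ((integrable_const (1 : ℝ)).add (integrable_norm_sq_complexGaussian v)).mono'
    (by fun_prop) (ae_of_all _ fun z ↦ ?_)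
  simp only [Pi.add_apply]
  nlinarith [sq_nonneg (‖z‖ - 1)]

lemma HasDerivAt.of_translate {g : ℝ → ℂ} {g' : ℂ} {x : ℝ}
    (h : HasDerivAt (fun s ↦ g (x + s)) g' 0) : HasDerivAt g g' x := by
  rw [← sub_self x] at h
  simpa using h.comp_sub_const x x

/-- Stein's lemma for a complex Gaussian variable. The functions `fx` and `fy` are the
derivatives of `f` along the real and the imaginary axis. -/
lemma integral_conj_mul_complexGaussian {v : ℝ≥0} (hv : v ≠ 0) {f fx fy : ℂ → ℂ}
    (hfx : ∀ z, HasDerivAt (fun s : ℝ ↦ f (z + s)) (fx z) 0)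
    (hfy : ∀ z, HasDerivAt (fun s : ℝ ↦ f (z + s * Complex.I)) (fy z) 0)
    (hf : Measurable f) (hmx : Measurable fx) (hmy : Measurable fy)
    {C : ℝ} (hC : ∀ z, ‖f z‖ ≤ C) (hCx : ∀ z, ‖fx z‖ ≤ C) (hCy : ∀ z, ‖fy z‖ ≤ C) :
    ∫ z, starRingEnd ℂ z * f z ∂(complexGaussian v) =
      v / 2 * ∫ z, (fx z - Complex.I * fy z) ∂(complexGaussian v) := by
  set w := v / 2 with hw
  have hw0 : w ≠ 0 := by simpa [hw] using hv
  have hwv : (v : ℂ) / 2 = w := by simp [hw]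
  have hmk : Measurable fun p : ℝ × ℝ ↦ (⟨p.1, p.2⟩ : ℂ) :=
    Complex.measurableEquivRealProd.symm.measurable
  have hmk1 : ∀ y : ℝ, Measurable fun x : ℝ ↦ (⟨x, y⟩ : ℂ) := fun y ↦
    hmk.comp (measurable_id.prodMk measurable_const)
  have hmk2 : ∀ x : ℝ, Measurable fun y : ℝ ↦ (⟨x, y⟩ : ℂ) := fun x ↦
    hmk.comp (measurable_const.prodMk measurable_id)
  have hid : Integrable (fun x : ℝ ↦ (x : ℂ)) (gaussianReal 0 w) := by
    simpa using integrable_ofReal_pow_gaussianReal w 1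
  have bdd : ∀ {α : Type} [MeasurableSpace α] (μ : Measure α) [IsFiniteMeasure μ] (g : α → ℂ),
      Measurable g → (∀ a, ‖g a‖ ≤ C) → Integrable g μ := fun μ _ g hg hb ↦
    Integrable.of_bound hg.aestronglyMeasurable C (ae_of_all _ hb)
  have stein1 : ∀ y : ℝ, ∫ x : ℝ, (x : ℂ) * f ⟨x, y⟩ ∂(gaussianReal 0 w) =
      w * ∫ x : ℝ, fx ⟨x, y⟩ ∂(gaussianReal 0 w) := by
    intro y
    refine integral_mul_gaussianReal hw0 (fun x ↦ HasDerivAt.of_translate ?_)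
      (bdd _ _ (hf.comp (hmk1 y)) fun _ ↦ hC _) (bdd _ _ (hmx.comp (hmk1 y)) fun _ ↦ hCx _) ?_
    · convert hfx ⟨x, y⟩ using 2 with s
      congr 1
      apply Complex.ext <;> simp
    · exact hid.mul_bdd (c := C) (hf.comp (hmk1 y)).aestronglyMeasurable (ae_of_all _ fun _ ↦ hC _)
  have stein2 : ∀ x : ℝ, ∫ y : ℝ, (y : ℂ) * f ⟨x, y⟩ ∂(gaussianReal 0 w) =
      w * ∫ y : ℝ, fy ⟨x, y⟩ ∂(gaussianReal 0 w) := by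
    intro x
    refine integral_mul_gaussianReal hw0 (fun y ↦ HasDerivAt.of_translate ?_)
      (bdd _ _ (hf.comp (hmk2 x)) fun _ ↦ hC _) (bdd _ _ (hmy.comp (hmk2 x)) fun _ ↦ hCy _) ?_
    · convert hfy ⟨x, y⟩ using 2 with s
      congr 1
      apply Complex.ext <;> simp
    · exact hid.mul_bdd (c := C) (hf.comp (hmk2 x)).aestronglyMeasurable (ae_of_all _ fun _ ↦ hC _)
  set γ := gaussianReal 0 w with hγ
  have i1 : Integrable (fun p : ℝ × ℝ ↦ (p.1 : ℂ) * f ⟨p.1, p.2⟩) (γ.prod γ) :=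
    (hid.comp_fst _).mul_bdd (c := C) (hf.comp hmk).aestronglyMeasurable (ae_of_all _ fun _ ↦ hC _)
  have i2 : Integrable (fun p : ℝ × ℝ ↦ (p.2 : ℂ) * f ⟨p.1, p.2⟩) (γ.prod γ) :=
    (hid.comp_snd _).mul_bdd (c := C) (hf.comp hmk).aestronglyMeasurable (ae_of_all _ fun _ ↦ hC _)
  have i3 : Integrable (fun p : ℝ × ℝ ↦ fx ⟨p.1, p.2⟩) (γ.prod γ) :=
    bdd _ _ (hmx.comp hmk) fun _ ↦ hCx _
  have i4 : Integrable (fun p : ℝ × ℝ ↦ fy ⟨p.1, p.2⟩) (γ.prod γ) :=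
    bdd _ _ (hmy.comp hmk) fun _ ↦ hCy _
  have e1 : ∫ p : ℝ × ℝ, (p.1 : ℂ) * f ⟨p.1, p.2⟩ ∂(γ.prod γ) =
      w * ∫ p : ℝ × ℝ, fx ⟨p.1, p.2⟩ ∂(γ.prod γ) := by
    rw [integral_prod_symm _ i1, integral_prod_symm _ i3]
    simp_rw [stein1]
    rw [integral_const_mul]
  have e2 : ∫ p : ℝ × ℝ, (p.2 : ℂ) * f ⟨p.1, p.2⟩ ∂(γ.prod γ) =
      w * ∫ p : ℝ × ℝ, fy ⟨p.1, p.2⟩ ∂(γ.prod γ) := by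
    rw [integral_prod _ i2, integral_prod _ i4]
    simp_rw [stein2]
    rw [integral_const_mul]
  have e3 : ∀ p : ℝ × ℝ, starRingEnd ℂ (⟨p.1, p.2⟩ : ℂ) * f ⟨p.1, p.2⟩ =
      (p.1 : ℂ) * f ⟨p.1, p.2⟩ - Complex.I * ((p.2 : ℂ) * f ⟨p.1, p.2⟩) := by
    intro p
    have : starRingEnd ℂ (⟨p.1, p.2⟩ : ℂ) = (p.1 : ℂ) - Complex.I * p.2 := by
      apply Complex.ext <;> simp
    rw [this]
    ring
  rw [integral_complexGaussian, integral_complexGaussian, ← hw, ← hγ, hwv]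
  simp_rw [e3]
  rw [integral_sub i1 (i2.const_mul _), integral_const_mul, e1, e2,
    integral_sub i3 (i4.const_mul _), integral_const_mul]
  ring

section Pi

variable {ι : Type*} [Fintype ι] [DecidableEq ι] {X : ι → Type*} [∀ i, MeasurableSpace (X i)]

/-- Resampling one coordinate of a product probability measure does not change the law. -/
lemma measurePreserving_update (μ : ∀ i, Measure (X i)) [∀ i, IsProbabilityMeasure (μ i)] (p : ι) :
    MeasurePreserving (fun q : (∀ i, X i) × X p ↦ Function.update q.1 p q.2)
      ((Measure.pi μ).prod (μ p)) (Measure.pi μ) := by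
  have hm : Measurable fun q : (∀ i, X i) × X p ↦ Function.update q.1 p q.2 := by
    rw [measurable_pi_iff]
    intro i
    rcases eq_or_ne i p with rfl | h
    · simpa using measurable_snd
    · simpa [h] using! (measurable_pi_apply i).comp measurable_fst
  refine ⟨hm, ?_⟩
  symm
  apply Measure.pi_eq
  intro s hs
  rw [Measure.map_apply hm (MeasurableSet.univ_pi hs)]
  have : (fun q : (∀ i, X i) × X p ↦ Function.update q.1 p q.2) ⁻¹' Set.univ.pi s =
      (Set.univ.pi (Function.update s p Set.univ)) ×ˢ s p := by
    ext ⟨y, z⟩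
    simp only [Set.mem_preimage, Set.mem_pi, Set.mem_univ, true_imp_iff, Set.mem_prod]
    constructor
    · intro h
      refine ⟨fun i ↦ ?_, by simpa using h p⟩
      rcases eq_or_ne i p with rfl | hi
      · simp
      · simpa [hi] using h i
    · rintro ⟨h1, h2⟩ i
      rcases eq_or_ne i p with rfl | hi
      · simpa using h2
      · simpa [hi] using h1 i
  rw [this, Measure.prod_prod, Measure.pi_pi, ← Finset.mul_prod_erase _ _ (Finset.mem_univ p),
    ← Finset.mul_prod_erase Finset.univ (fun i ↦ μ i (s i)) (Finset.mem_univ p)]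
  simp only [Function.update_self, measure_univ, one_mul]
  rw [mul_comm]
  congr 1
  refine Finset.prod_congr rfl fun i hi ↦ ?_
  rw [Function.update_of_ne (Finset.ne_of_mem_erase hi)]

end Pi

/-- Gaussian integration by parts with respect to one coordinate of an i.i.d. complex Gaussian
family. -/
lemma integral_conj_mul_pi {ι : Type*} [Fintype ι] [DecidableEq ι] {v : ℝ≥0} (hv : v ≠ 0) (p : ι)
    {F Fx Fy : (ι → ℂ) → ℂ}
    (hFx : ∀ y, HasDerivAt (fun s : ℝ ↦ F (y + s • (Pi.single p 1 : ι → ℂ))) (Fx y) 0)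
    (hFy : ∀ y, HasDerivAt (fun s : ℝ ↦ F (y + s • (Pi.single p Complex.I : ι → ℂ))) (Fy y) 0)
    (hF : Measurable F) (hmx : Measurable Fx) (hmy : Measurable Fy)
    {C : ℝ} (hC : ∀ y, ‖F y‖ ≤ C) (hCx : ∀ y, ‖Fx y‖ ≤ C) (hCy : ∀ y, ‖Fy y‖ ≤ C) :
    ∫ y, starRingEnd ℂ (y p) * F y ∂(Measure.pi fun _ : ι ↦ complexGaussian v) =
      v / 2 * ∫ y, (Fx y - Complex.I * Fy y) ∂(Measure.pi fun _ : ι ↦ complexGaussian v) := by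
  set μ := Measure.pi fun _ : ι ↦ complexGaussian v with hμ
  have hup : MeasurePreserving (fun q : (ι → ℂ) × ℂ ↦ Function.update q.1 p q.2)
      (μ.prod (complexGaussian v)) μ := measurePreserving_update (fun _ : ι ↦ complexGaussian v) p
  have hmu : ∀ y : ι → ℂ, Measurable fun z : ℂ ↦ Function.update y p z := fun y ↦
    measurable_update y
  have int1 : Integrable (fun y ↦ starRingEnd ℂ (y p) * F y) μ := by
    refine Integrable.mul_bdd (c := C) ?_ hF.aestronglyMeasurable (ae_of_all _ hC)
    have : Integrable (fun z ↦ starRingEnd ℂ z) (complexGaussian v) :=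
      (Complex.conjCLE : ℂ →L[ℝ] ℂ).integrable_comp (integrable_id_complexGaussian v)
    exact integrable_comp_eval (μ := fun _ : ι ↦ complexGaussian v) (i := p)
      (f := fun z ↦ starRingEnd ℂ z) this
  have int2 : Integrable (fun y ↦ Fx y - Complex.I * Fy y) μ :=
    (Integrable.of_bound hmx.aestronglyMeasurable C (ae_of_all _ hCx)).sub
      ((Integrable.of_bound hmy.aestronglyMeasurable C (ae_of_all _ hCy)).const_mul _)
  have tr : ∀ g : (ι → ℂ) → ℂ, Integrable g μ → ∫ y, g y ∂μ =
      ∫ y, ∫ z, g (Function.update y p z) ∂(complexGaussian v) ∂μ := by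
    intro g hg
    rw [← integral_prod (fun q : (ι → ℂ) × ℂ ↦ g (Function.update q.1 p q.2))
      (hup.integrable_comp_of_integrable hg)]
    conv_lhs => rw [← hup.map_eq]
    rw [integral_map hup.measurable.aemeasurable]
    rw [hup.map_eq]
    exact hg.aestronglyMeasurable
  have hupd : ∀ (y : ι → ℂ) (z c : ℂ) (s : ℝ), Function.update y p (z + s * c) =
      Function.update y p z + s • (Pi.single p c : ι → ℂ) := by
    intro y z c s
    ext i
    rcases eq_or_ne i p with rfl | hi
    · simp
    · simp [hi]
  rw [tr _ int1, tr _ int2, ← integral_const_mul]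
  refine integral_congr_ae (ae_of_all _ fun y ↦ ?_)
  simp only [Function.update_self]
  refine integral_conj_mul_complexGaussian hv (f := fun z ↦ F (Function.update y p z))
    (fx := fun z ↦ Fx (Function.update y p z)) (fy := fun z ↦ Fy (Function.update y p z))
    (fun z ↦ ?_) (fun z ↦ ?_) (hF.comp (hmu y)) (hmx.comp (hmu y)) (hmy.comp (hmu y))
    (fun _ ↦ hC _) (fun _ ↦ hCx _) (fun _ ↦ hCy _)
  · have := hFx (Function.update y p z)
    simpa only [← hupd, mul_one] using this
  · have := hFy (Function.update y p z)
    simpa only [← hupd] using this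

/-! ### The Ginibre law: moments and unitary invariance -/

instance (v : ℝ≥0) : IsProbabilityMeasure (ginibreLaw M N v) := by
  unfold ginibreLaw
  infer_instance

lemma integrable_eval_ginibreLaw {v : ℝ≥0} {f : ℂ → ℝ} (hf : Integrable f (complexGaussian v))
    (p : Fin M × Fin N) : Integrable (fun y ↦ f (y p)) (ginibreLaw M N v) :=
  integrable_comp_eval (μ := fun _ : Fin M × Fin N ↦ complexGaussian v) (i := p) hf

lemma integral_eval_ginibreLaw {v : ℝ≥0} {f : ℂ → ℝ} (hf : Integrable f (complexGaussian v))
    (p : Fin M × Fin N) :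
    ∫ y, f (y p) ∂(ginibreLaw M N v) = ∫ z, f z ∂(complexGaussian v) :=
  integral_comp_eval (μ := fun _ : Fin M × Fin N ↦ complexGaussian v) (i := p)
    hf.aestronglyMeasurable

lemma hsNormSq_toMat (y : Fin M × Fin N → ℂ) : hsNormSq (toMat y) = ∑ p, ‖y p‖ ^ 2 := by
  rw [Fintype.sum_prod_type]
  rfl

lemma integrable_hsNormSq (v : ℝ≥0) :
    Integrable (fun y ↦ hsNormSq (toMat y)) (ginibreLaw M N v) := by
  simp only [hsNormSq_toMat]
  exact integrable_finsetSum _ fun p _ ↦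
    integrable_eval_ginibreLaw (integrable_norm_sq_complexGaussian v) p

lemma integral_hsNormSq {v : ℝ≥0} (hv : v ≠ 0) :
    ∫ y, hsNormSq (toMat y) ∂(ginibreLaw M N v) = M * N * v := by
  simp only [hsNormSq_toMat]
  have h := integrable_norm_sq_complexGaussian v
  rw [integral_finsetSum _ fun p _ ↦ integrable_eval_ginibreLaw h p]
  simp_rw [integral_eval_ginibreLaw h, integral_norm_sq_complexGaussian hv]
  simp

lemma hsNormSq_sq_le (y : Fin M × Fin N → ℂ) :
    hsNormSq (toMat y) ^ 2 ≤ (M * N) * ∑ p, ‖y p‖ ^ 4 := by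
  rw [hsNormSq_toMat]
  refine (sq_sum_le_card_mul_sum_sq (s := Finset.univ)).trans (le_of_eq ?_)
  simp [← pow_mul]

lemma integrable_sum_norm_pow_four (v : ℝ≥0) :
    Integrable (fun y : Fin M × Fin N → ℂ ↦ (M * N : ℝ) * ∑ p, ‖y p‖ ^ 4) (ginibreLaw M N v) :=
  (integrable_finsetSum _ fun p _ ↦
    integrable_eval_ginibreLaw (integrable_norm_pow_four_complexGaussian v) p).const_mul _

lemma integrable_hsNormSq_sq (v : ℝ≥0) :
    Integrable (fun y ↦ hsNormSq (toMat y) ^ 2) (ginibreLaw M N v) := by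
  refine (integrable_sum_norm_pow_four v).mono'
    (measurable_hsNormSq.pow_const 2).aestronglyMeasurable (ae_of_all _ fun y ↦ ?_)
  rw [Real.norm_of_nonneg (sq_nonneg _)]
  exact hsNormSq_sq_le y

lemma integral_hsNormSq_sq_le {v : ℝ≥0} (hv : v ≠ 0) :
    ∫ y, hsNormSq (toMat y) ^ 2 ∂(ginibreLaw M N v) ≤ 2 * (M * N * v) ^ 2 := by
  refine (integral_mono (integrable_hsNormSq_sq v) (integrable_sum_norm_pow_four v)
    hsNormSq_sq_le).trans (le_of_eq ?_)
  have h := integrable_norm_pow_four_complexGaussian v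
  rw [integral_const_mul, integral_finsetSum _ fun p _ ↦ integrable_eval_ginibreLaw h p]
  simp_rw [integral_eval_ginibreLaw h, integral_norm_pow_four_complexGaussian hv]
  simp
  ring

lemma charFunDual_gaussianReal_zero (w : ℝ≥0) (ℓ : StrongDual ℝ ℝ) :
    charFunDual (gaussianReal 0 w) ℓ = Complex.exp (-(w * ℓ 1 ^ 2 / 2)) := by
  rw [charFunDual_eq_charFun_map_one, gaussianReal_map_continuousLinearMap, charFun_gaussianReal]
  congr 1
  have : max (ℓ 1 ^ 2) 0 = ℓ 1 ^ 2 := max_eq_left (sq_nonneg _)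
  simp [this]
  ring

lemma charFunDual_complexGaussian (v : ℝ≥0) (ℓ : StrongDual ℝ ℂ) :
    charFunDual (complexGaussian v) ℓ =
      Complex.exp (-(v / 4 * (ℓ 1 ^ 2 + ℓ Complex.I ^ 2) : ℝ)) := by
  have h : complexGaussian v = ((gaussianReal 0 (v / 2)).prod (gaussianReal 0 (v / 2))).map
      (Complex.equivRealProdCLM.symm : ℝ × ℝ →L[ℝ] ℂ) := rfl
  rw [h, charFunDual_map, charFunDual_prod, charFunDual_gaussianReal_zero,
    charFunDual_gaussianReal_zero, ← Complex.exp_add]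
  have h1 : Complex.equivRealProdCLM.symm (1, 0) = 1 := by apply Complex.ext <;> simp
  have h2 : Complex.equivRealProdCLM.symm (0, 1) = Complex.I := by apply Complex.ext <;> simp
  simp [h1, h2]
  congr 1
  ring

lemma charFunDual_ginibreLaw (v : ℝ≥0) (ℓ : StrongDual ℝ (Fin M × Fin N → ℂ)) :
    charFunDual (ginibreLaw M N v) ℓ = Complex.exp (-(v / 4 * ∑ p,
      (ℓ (Pi.single p 1) ^ 2 + ℓ (Pi.single p Complex.I) ^ 2) : ℝ)) := by
  rw [ginibreLaw, charFunDual_pi]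
  simp only [charFunDual_complexGaussian]
  rw [← Complex.exp_sum, Finset.mul_sum]
  congr 1
  push_cast
  rw [← Finset.sum_neg_distrib]
  rfl

/-- Right multiplication of a matrix, given by its family of entries, by a square matrix. -/
noncomputable def mulRightCLM (U : Matrix (Fin N) (Fin N) ℂ) :
    (Fin M × Fin N → ℂ) →L[ℝ] (Fin M × Fin N → ℂ) :=
  LinearMap.toContinuousLinearMap
    { toFun := fun y p ↦ (toMat y * U) p.1 p.2
      map_add' := fun x y ↦ by
        ext p
        simp [toMat, Matrix.mul_apply, add_mul, Finset.sum_add_distrib]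
      map_smul' := fun c y ↦ by
        ext p
        simp [toMat, Matrix.mul_apply, Finset.mul_sum, mul_assoc] }

lemma mulRightCLM_apply (U : Matrix (Fin N) (Fin N) ℂ) (y : Fin M × Fin N → ℂ) (p : Fin M × Fin N) :
    mulRightCLM U y p = (toMat y * U) p.1 p.2 := rfl

lemma toMat_mulRightCLM (U : Matrix (Fin N) (Fin N) ℂ) (y : Fin M × Fin N → ℂ) :
    toMat (mulRightCLM U y) = toMat y * U := rfl

/-- A real functional `ℓ` on complex tuples is the real part of pairing with the tuple `w`. -/
lemma strongDual_apply_eq {ι : Type*} [Fintype ι] [DecidableEq ι] (ℓ : StrongDual ℝ (ι → ℂ))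
    (z : ι → ℂ) : ℓ z = (∑ p, ((ℓ (Pi.single p 1) : ℂ) -
      Complex.I * (ℓ (Pi.single p Complex.I) : ℂ)) * z p).re := by
  have hz : z = ∑ p, ((z p).re • (Pi.single p 1 : ι → ℂ) +
      (z p).im • (Pi.single p Complex.I : ι → ℂ)) := by
    ext q
    simp [Finset.sum_apply, Pi.single_apply, Finset.sum_add_distrib]
  conv_lhs => rw [hz]
  simp only [map_sum, map_add, map_smul, smul_eq_mul, Complex.re_sum]
  refine Finset.sum_congr rfl fun p _ ↦ ?_
  simp
  ring

/-- The law of a Ginibre matrix is invariant under right multiplication by a unitary matrix. -/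
lemma measurePreserving_mulRightCLM (v : ℝ≥0) {U : Matrix (Fin N) (Fin N) ℂ} (hU : Uᴴ * U = 1) :
    MeasurePreserving (mulRightCLM (M := M) U) (ginibreLaw M N v) (ginibreLaw M N v) := by
  refine ⟨(mulRightCLM U).continuous.measurable, ?_⟩
  have : IsFiniteMeasure (Measure.map (mulRightCLM (M := M) U) (ginibreLaw M N v)) := by
    infer_instance
  apply Measure.ext_of_charFunDual
  ext ℓ
  rw [charFunDual_map, charFunDual_ginibreLaw, charFunDual_ginibreLaw]
  congr 4
  set w : Fin M → Fin N → ℂ := fun i a ↦ (ℓ (Pi.single (i, a) 1) : ℂ) -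
    Complex.I * (ℓ (Pi.single (i, a) Complex.I) : ℂ) with hw
  -- the image of a matrix unit is supported on a single row
  have hrow : ∀ (i : Fin M) (a : Fin N) (c : ℂ),
      ℓ (mulRightCLM U (Pi.single (i, a) c)) = (c * ∑ b, w i b * U a b).re := by
    intro i a c
    rw [strongDual_apply_eq, Fintype.sum_prod_type, Finset.sum_eq_single i]
    · congr 1
      rw [Finset.mul_sum]
      refine Finset.sum_congr rfl fun b _ ↦ ?_
      rw [mulRightCLM_apply, Matrix.mul_apply, Finset.sum_eq_single a]
      · simp [toMat, hw]
        ring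
      · intro x _ hx
        simp [toMat, Pi.single_apply, hx]
      · simp
    · intro j _ hj
      refine Finset.sum_eq_zero fun b _ ↦ ?_
      rw [mulRightCLM_apply, Matrix.mul_apply, Finset.sum_eq_zero, mul_zero]
      intro x _
      simp [toMat, Pi.single_apply, hj]
    · simp
  have hn : ∀ z : ℂ, z.re ^ 2 + (Complex.I * z).re ^ 2 = ‖z‖ ^ 2 := by
    intro z
    rw [← Complex.normSq_eq_norm_sq, Complex.normSq_apply]
    simp
    ring
  rw [Fintype.sum_prod_type, Fintype.sum_prod_type]
  refine Finset.sum_congr rfl fun i _ ↦ ?_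
  simp only [ContinuousLinearMap.comp_apply, hrow, one_mul, hn]
  have hR : ∀ b, ℓ (Pi.single (i, b) 1) ^ 2 + ℓ (Pi.single (i, b) Complex.I) ^ 2 = ‖w i b‖ ^ 2 := by
    intro b
    rw [← hn]
    simp [hw]
  simp only [hR]
  have h1 : ((∑ a, ‖∑ b, w i b * U a b‖ ^ 2 : ℝ) : ℂ) =
      ∑ b, ∑ c, w i b * starRingEnd ℂ (w i c) * ∑ a, starRingEnd ℂ (U a c) * U a b := by
    have e : ∀ a, ((‖∑ b, w i b * U a b‖ ^ 2 : ℝ) : ℂ) =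
        ∑ b, ∑ c, w i b * U a b * starRingEnd ℂ (w i c * U a c) := by
      intro a
      rw [← Complex.normSq_eq_norm_sq, ← Complex.mul_conj, map_sum, Finset.sum_mul_sum]
    rw [Complex.ofReal_sum]
    simp only [e]
    rw [Finset.sum_comm]
    refine Finset.sum_congr rfl fun b _ ↦ ?_
    rw [Finset.sum_comm]
    refine Finset.sum_congr rfl fun c _ ↦ ?_
    rw [Finset.mul_sum]
    refine Finset.sum_congr rfl fun a _ ↦ ?_
    rw [map_mul]
    ring
  have h2 : ∀ b c, ∑ a, starRingEnd ℂ (U a c) * U a b = if c = b then 1 else 0 := by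
    intro b c
    have := congrFun (congrFun hU c) b
    rw [Matrix.mul_apply, Matrix.one_apply] at this
    exact this
  simp only [h2] at h1
  have h3 : ((∑ a, ‖∑ b, w i b * U a b‖ ^ 2 : ℝ) : ℂ) = ((∑ b, ‖w i b‖ ^ 2 : ℝ) : ℂ) := by
    rw [h1]
    push_cast
    refine Finset.sum_congr rfl fun b _ ↦ ?_
    simp [← Complex.ofReal_pow, ← Complex.normSq_eq_norm_sq, ← Complex.mul_conj]
  exact_mod_cast h3

/-- The entries of a Ginibre matrix follow the product law. -/
lemma IsGinibre.hasLaw_ginibreLaw {Ω : Type*} [MeasurableSpace Ω] {P : Measure Ω}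
    [IsProbabilityMeasure P] {v : ℝ≥0} {Y : Ω → Matrix (Fin M) (Fin N) ℂ} (h : IsGinibre v Y P) :
    HasLaw (fun w (p : Fin M × Fin N) ↦ Y w p.1 p.2) (ginibreLaw M N v) P := by
  have hm : ∀ p : Fin M × Fin N, AEMeasurable (fun w ↦ Y w p.1 p.2) P := fun p ↦
    (h.hasLaw p.1 p.2).aemeasurable
  refine ⟨aemeasurable_pi_lambda _ hm, ?_⟩
  rw [(iIndepFun_iff_map_fun_eq_pi_map hm).1 h.indep, ginibreLaw]
  congr 1
  ext1 p
  exact (h.hasLaw p.1 p.2).map_eq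

/-! ### The correlations of the entries of the positive part -/

lemma norm_matAbs_mul_conj_le (A : Matrix (Fin M) (Fin N) ℂ) (i j k l : Fin N) :
    ‖matAbs A i j * starRingEnd ℂ (matAbs A k l)‖ ≤ hsNormSq A := by
  rw [norm_mul, RCLike.norm_conj]
  nlinarith [norm_matAbs_apply_sq_le A i j, norm_matAbs_apply_sq_le A k l,
    sq_nonneg (‖matAbs A i j‖ - ‖matAbs A k l‖)]

lemma integrable_matAbs_mul_conj (v : ℝ≥0) (i j k l : Fin N) :
    Integrable (fun y ↦ matAbs (toMat y) i j * starRingEnd ℂ (matAbs (toMat y) k l))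
      (ginibreLaw M N v) :=
  (integrable_hsNormSq v).mono'
    ((measurable_matAbs_apply i j).mul
      (continuous_star.measurable.comp (measurable_matAbs_apply k l))).aestronglyMeasurable
    (ae_of_all _ fun _ ↦ norm_matAbs_mul_conj_le _ i j k l)

lemma integrable_traceNorm_sq (v : ℝ≥0) :
    Integrable (fun y ↦ traceNorm (toMat y) ^ 2) (ginibreLaw M N v) := by
  refine ((integrable_hsNormSq v).const_mul (N : ℝ)).mono'
    (measurable_traceNorm.pow_const 2).aestronglyMeasurable (ae_of_all _ fun y ↦ ?_)
  rw [Real.norm_of_nonneg (sq_nonneg _)]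
  exact traceNorm_sq_le _

/-- The correlation `𝔼 |Y|ᵢⱼ conj |Y|ₖₗ` for a Ginibre matrix `Y`. -/
noncomputable def entryCorr (M N : ℕ) (v : ℝ≥0) (i j k l : Fin N) : ℂ :=
  ∫ y, matAbs (toMat y) i j * starRingEnd ℂ (matAbs (toMat y) k l) ∂(ginibreLaw M N v)

lemma sum_entryCorr_same {v : ℝ≥0} (hv : v ≠ 0) :
    ∑ i, ∑ j, entryCorr M N v i j i j = (M * N * v : ℝ) := by
  simp only [entryCorr]
  rw [← integral_hsNormSq hv, ← integral_complex_ofReal]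
  simp only [← integral_finsetSum _ fun j _ ↦ integrable_matAbs_mul_conj v _ _ _ _]
  rw [← integral_finsetSum _ fun i _ ↦ integrable_finsetSum _ fun j _ ↦
    integrable_matAbs_mul_conj v _ _ _ _]
  congr 1
  ext y
  rw [← hsNormSq_eq_sum_norm_matAbs]
  simp [Complex.mul_conj, Complex.normSq_eq_norm_sq]

lemma sum_entryCorr_diag (v : ℝ≥0) :
    ∑ i, ∑ j, entryCorr M N v i i j j =
      (∫ y, traceNorm (toMat y) ^ 2 ∂(ginibreLaw M N v) : ℝ) := by
  simp only [entryCorr]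
  rw [← integral_complex_ofReal]
  simp only [← integral_finsetSum _ fun j _ ↦ integrable_matAbs_mul_conj v _ _ _ _]
  rw [← integral_finsetSum _ fun i _ ↦ integrable_finsetSum _ fun j _ ↦
    integrable_matAbs_mul_conj v _ _ _ _]
  congr 1
  ext y
  rw [← Finset.sum_mul_sum, Complex.ofReal_pow, ← trace_matAbs, sq]
  simp only [conj_matAbs_apply]
  rfl

lemma entryCorr_diag_comm (v : ℝ≥0) (i k : Fin N) :
    entryCorr M N v i i k k = entryCorr M N v k k i i := by
  simp only [entryCorr, conj_matAbs_apply]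
  congr 1
  ext y
  ring

lemma entryCorr_same_comm (v : ℝ≥0) (i j : Fin N) :
    entryCorr M N v i j i j = entryCorr M N v j i j i := by
  simp only [entryCorr, conj_matAbs_apply]
  congr 1
  ext y
  ring

/-- Unitary invariance of the correlations. -/
lemma entryCorr_eq_of_unitary (v : ℝ≥0) {U : Matrix (Fin N) (Fin N) ℂ} (hU : Uᴴ * U = 1)
    (i j k l : Fin N) : entryCorr M N v i j k l =
      ∫ y, (Uᴴ * matAbs (toMat y) * U) i j * starRingEnd ℂ ((Uᴴ * matAbs (toMat y) * U) k l)
        ∂(ginibreLaw M N v) := by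
  have hU' : U * Uᴴ = 1 := mul_eq_one_comm.1 hU
  have hp := measurePreserving_mulRightCLM (M := M) v hU
  rw [entryCorr]
  conv_lhs => rw [← hp.map_eq]
  rw [integral_map hp.measurable.aemeasurable]
  · simp only [toMat_mulRightCLM, matAbs_mul_unitary _ hU']
  · rw [hp.map_eq]
    exact (integrable_matAbs_mul_conj v i j k l).aestronglyMeasurable

/-- Invariance under diagonal unitaries kills all correlations except those of two diagonal
entries and those of an entry with itself. -/
lemma entryCorr_eq_zero (v : ℝ≥0) {i j k l : Fin N} (h : ¬ (i = j ∧ k = l))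
    (h' : ¬ (i = k ∧ j = l)) : entryCorr M N v i j k l = 0 := by
  have main : ∀ u : Fin N → ℂ, (∀ x, starRingEnd ℂ (u x) * u x = 1) →
      starRingEnd ℂ (u i) * u j * (u k * starRingEnd ℂ (u l)) ≠ 1 →
      entryCorr M N v i j k l = 0 := by
    intro u hu hne
    have hU : (Matrix.diagonal u)ᴴ * Matrix.diagonal u = 1 := by
      rw [Matrix.diagonal_conjTranspose, Matrix.diagonal_mul_diagonal, ← Matrix.diagonal_one]
      congr 1
      ext x
      exact hu x
    have h := entryCorr_eq_of_unitary (M := M) v hU i j k l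
    have e : ∀ y : Fin M × Fin N → ℂ, ((Matrix.diagonal u)ᴴ * matAbs (toMat y) * Matrix.diagonal u)
        i j * starRingEnd ℂ (((Matrix.diagonal u)ᴴ * matAbs (toMat y) * Matrix.diagonal u) k l) =
        starRingEnd ℂ (u i) * u j * (u k * starRingEnd ℂ (u l)) *
          (matAbs (toMat y) i j * starRingEnd ℂ (matAbs (toMat y) k l)) := by
      intro y
      simp only [Matrix.diagonal_conjTranspose, Matrix.mul_diagonal, Matrix.diagonal_mul, map_mul,
        Pi.star_apply, RCLike.star_def, Complex.conj_conj]
      ring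
    simp_rw [e] at h
    rw [integral_const_mul, ← entryCorr] at h
    by_contra h0
    exact hne (mul_right_cancel₀ h0 (h.symm.trans (one_mul _).symm))
  have hI : ∀ a x : Fin N, starRingEnd ℂ (if x = a then Complex.I else 1) *
      (if x = a then Complex.I else 1) = 1 := by
    intro a x
    split_ifs <;> simp
  have I1 : -Complex.I ≠ 1 := fun h ↦ by simpa using congrArg Complex.re h
  have I2 : Complex.I ≠ 1 := fun h ↦ by simpa using congrArg Complex.re h
  by_cases hij : i = j
  · subst hij
    have hkl : l ≠ k := fun e ↦ h ⟨rfl, e.symm⟩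
    refine main (fun x ↦ if x = k then Complex.I else 1) (hI k) ?_
    by_cases hik : i = k <;> simp [hik, hkl, I2]
  · by_cases hik : i = k
    · subst hik
      have hjl : l ≠ j := fun e ↦ h' ⟨rfl, e.symm⟩
      refine main (fun x ↦ if x = j then Complex.I else 1) (hI j) ?_
      simp [hij, hjl, I2]
    · refine main (fun x ↦ if x = i then Complex.I else 1) (hI i) ?_
      have hji : j ≠ i := Ne.symm hij
      have hki : k ≠ i := Ne.symm hik
      by_cases hl : l = i
      · simp [hji, hki, hl]
        norm_num
      · simp [hji, hki, hl, I1]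

/-- The Hadamard rotation in the plane of the `i`-th and `j`-th coordinate vectors. -/
noncomputable def hadamard (i j : Fin N) : Matrix (Fin N) (Fin N) ℂ := Matrix.of fun x b ↦
  if b = i then ((√2)⁻¹ : ℝ) * ((if x = i then 1 else 0) + (if x = j then 1 else 0))
  else if b = j then ((√2)⁻¹ : ℝ) * ((if x = i then 1 else 0) - (if x = j then 1 else 0))
  else if x = b then 1 else 0

lemma inv_sqrt_two_mul_self : (((√2)⁻¹ : ℝ) : ℂ) * (((√2)⁻¹ : ℝ) : ℂ) = 1 / 2 := by
  rw [← Complex.ofReal_mul, ← mul_inv, Real.mul_self_sqrt (by norm_num)]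
  norm_num

lemma hadamard_unitary {i j : Fin N} (hij : i ≠ j) : (hadamard i j)ᴴ * hadamard i j = 1 := by
  have hc := inv_sqrt_two_mul_self
  have hji := hij.symm
  have h2 : ∀ a : Fin N, a = i ∨ a = j ∨ (a ≠ i ∧ a ≠ j) := fun a ↦ by tauto
  ext a b
  simp only [Matrix.mul_apply, Matrix.conjTranspose_apply, hadamard, Matrix.of_apply,
    RCLike.star_def]
  generalize (√2)⁻¹ = c at hc
  rcases h2 a with rfl | rfl | ⟨ha, ha'⟩ <;> rcases h2 b with rfl | rfl | ⟨hb, hb'⟩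
  all_goals
    simp only [if_true, map_add, map_sub, Complex.conj_ofReal, apply_ite (starRingEnd ℂ),
      map_one, map_zero, mul_add, add_mul, mul_sub, sub_mul, mul_ite, ite_mul, mul_one, one_mul,
      mul_zero, zero_mul, Finset.sum_add_distrib, Finset.sum_ite_eq',
      Finset.mem_univ, Matrix.one_apply, *]
    simp [*, Ne.symm]
  -- what remains is `1 / 2 + 1 / 2 = 1` twice and the symmetry of the Kronecker delta
  · norm_num
  · norm_num
  · simp only [eq_comm]

/-- The diagonal entries of the conjugate of a matrix by the Hadamard rotation. -/
lemma hadamard_conj_apply_self (i j : Fin N) (H : Matrix (Fin N) (Fin N) ℂ) :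
    ((hadamard i j)ᴴ * H * hadamard i j) i i = 1 / 2 * (H i i + H i j + H j i + H j j) := by
  simp only [← inv_sqrt_two_mul_self, Matrix.mul_apply, hadamard, Matrix.conjTranspose_apply,
    Matrix.of_apply, RCLike.star_def]
  generalize (√2)⁻¹ = c
  simp only [if_true, map_add, Complex.conj_ofReal, apply_ite (starRingEnd ℂ), map_zero, mul_add,
    add_mul, mul_ite, ite_mul, mul_one, mul_zero, zero_mul, Finset.sum_add_distrib,
    Finset.sum_ite_eq', Finset.mem_univ]
  ring

lemma hadamard_conj_apply_of_ne {i j k : Fin N} (hki : k ≠ i) (hkj : k ≠ j)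
    (H : Matrix (Fin N) (Fin N) ℂ) : ((hadamard i j)ᴴ * H * hadamard i j) k k = H k k := by
  simp [Matrix.mul_apply, hadamard, hki, hkj, apply_ite (starRingEnd ℂ)]

lemma integral_matAbs_mul_conj (v : ℝ≥0) (i j k l : Fin N) :
    ∫ y, matAbs (toMat y) i j * starRingEnd ℂ (matAbs (toMat y) k l) ∂(ginibreLaw M N v) =
      entryCorr M N v i j k l := rfl

/-- Invariance under the Hadamard rotation of the `(i, j)` plane, tested on the `i`-th diagonal
entry. -/
lemma entryCorr_self_eq (v : ℝ≥0) {i j : Fin N} (hij : i ≠ j) :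
    4 * entryCorr M N v i i i i = entryCorr M N v i i i i + entryCorr M N v j j j j +
      2 * entryCorr M N v i i j j + 2 * entryCorr M N v i j i j := by
  have h := entryCorr_eq_of_unitary (M := M) v (hadamard_unitary hij) i i i i
  have hji := hij.symm
  simp only [hadamard_conj_apply_self] at h
  let x : Fin 4 → Fin N × Fin N := ![(i, i), (i, j), (j, i), (j, j)]
  have e : ∀ H : Matrix (Fin N) (Fin N) ℂ, 1 / 2 * (H i i + H i j + H j i + H j j) *
      starRingEnd ℂ (1 / 2 * (H i i + H i j + H j i + H j j)) =
      1 / 4 * ∑ a, ∑ b, H (x a).1 (x a).2 * starRingEnd ℂ (H (x b).1 (x b).2) := by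
    intro H
    rw [← Finset.sum_mul_sum, ← map_sum]
    simp only [Fin.sum_univ_four, x, map_mul, map_div₀, map_one, map_ofNat]
    simp
    ring
  simp_rw [e] at h
  rw [integral_const_mul, integral_finsetSum _ fun a _ ↦ integrable_finsetSum _ fun b _ ↦
    integrable_matAbs_mul_conj v _ _ _ _] at h
  simp only [integral_finsetSum _ fun b _ ↦ integrable_matAbs_mul_conj v _ _ _ _] at h
  simp only [integral_matAbs_mul_conj, Fin.sum_univ_four, x] at h
  simp [entryCorr_eq_zero, hij, hji] at h
  rw [entryCorr_same_comm v j i, entryCorr_diag_comm v j i] at h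
  linear_combination 4 * h

/-- Invariance under the Hadamard rotation of the `(i, j)` plane, tested on the `i`-th and a third
diagonal entry. -/
lemma entryCorr_diag_eq (v : ℝ≥0) {i j k : Fin N} (hij : i ≠ j) (hki : k ≠ i) (hkj : k ≠ j) :
    entryCorr M N v i i k k = entryCorr M N v j j k k := by
  have h := entryCorr_eq_of_unitary (M := M) v (hadamard_unitary hij) i i k k
  simp only [hadamard_conj_apply_self, hadamard_conj_apply_of_ne hki hkj] at h
  let x : Fin 4 → Fin N × Fin N := ![(i, i), (i, j), (j, i), (j, j)]
  have e : ∀ H : Matrix (Fin N) (Fin N) ℂ, 1 / 2 * (H i i + H i j + H j i + H j j) *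
      starRingEnd ℂ (H k k) = 1 / 2 * ∑ a, H (x a).1 (x a).2 * starRingEnd ℂ (H k k) := by
    intro H
    rw [← Finset.sum_mul]
    simp only [Fin.sum_univ_four, x]
    simp
    ring
  simp_rw [e] at h
  rw [integral_const_mul, integral_finsetSum _ fun a _ ↦ integrable_matAbs_mul_conj v _ _ _ _] at h
  simp only [integral_matAbs_mul_conj, Fin.sum_univ_four, x] at h
  simp [entryCorr_eq_zero, hij, hij.symm, hki.symm, hkj.symm] at h
  linear_combination 2 * h

lemma chi_eq (M N : ℕ) : chi M N =
    ((∫ y, traceNorm (toMat y) ^ 2 ∂(ginibreLaw M N (1 / (M : ℝ≥0)))) - 1) /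
      ((N : ℝ) ^ 2 - 1) := rfl

lemma one_div_natCast_ne_zero (hM : 0 < M) : (1 / (M : ℝ≥0)) ≠ 0 := by
  simpa using hM.ne'

lemma natCast_mul_one_div (hM : 0 < M) : (M * N * ((1 / (M : ℝ≥0) : ℝ≥0) : ℝ) : ℝ) = N := by
  have : (M : ℝ) ≠ 0 := by exact_mod_cast hM.ne'
  push_cast
  field_simp

section Identity

variable (v : ℝ≥0)

lemma entryCorr_self_const (i j : Fin N) : entryCorr M N v i i i i = entryCorr M N v j j j j := by
  rcases eq_or_ne i j with rfl | hij
  · rfl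
  have h1 := entryCorr_self_eq (M := M) v hij
  have h2 := entryCorr_self_eq (M := M) v hij.symm
  rw [entryCorr_diag_comm v j i, entryCorr_same_comm v j i] at h2
  linear_combination (h1 - h2) / 4

lemma entryCorr_self_eq_add {i j : Fin N} (hij : i ≠ j) : entryCorr M N v i i i i =
    entryCorr M N v i i j j + entryCorr M N v i j i j := by
  have h1 := entryCorr_self_eq (M := M) v hij
  have h2 := entryCorr_self_const (M := M) v i j
  linear_combination (h1 - h2) / 2

lemma entryCorr_diag_const {i j k l : Fin N} (hij : i ≠ j) (hkl : k ≠ l) :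
    entryCorr M N v i i j j = entryCorr M N v k k l l := by
  have step : ∀ {a b c : Fin N}, a ≠ c → b ≠ c →
      entryCorr M N v a a c c = entryCorr M N v b b c c := by
    intro a b c hac hbc
    rcases eq_or_ne a b with rfl | hab
    · rfl
    · exact entryCorr_diag_eq v hab hac.symm hbc.symm
  rcases eq_or_ne k j with rfl | hkj
  · rw [step hij hkl.symm, entryCorr_diag_comm]
  · rw [step hij hkj, entryCorr_diag_comm, step hkj.symm hkl.symm, entryCorr_diag_comm]

end Identity

/-- The values of the correlations. The three unknown values (of a squared diagonal entry, of two
different diagonal entries and of a squared off-diagonal entry) are determined by one linear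
relation and the two sums `𝔼 Tr |Y|² = N` and `𝔼 (Tr |Y|)²`. -/
lemma entryCorr_eq (hN : 0 < N) (hM : 0 < M) (i j k l : Fin N) :
    entryCorr M N (1 / (M : ℝ≥0)) i j k l = (if i = k ∧ j = l then (N : ℂ)⁻¹ else 0) +
      chi M N * ((if i = j ∧ k = l then 1 else 0) - if i = k ∧ j = l then (N : ℂ)⁻¹ else 0) := by
  set v := 1 / (M : ℝ≥0) with hv
  have hv0 : v ≠ 0 := one_div_natCast_ne_zero hM
  set E : ℝ := ∫ y, traceNorm (toMat y) ^ 2 ∂(ginibreLaw M N v) with hE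
  have hchi : chi M N = (E - 1) / ((N : ℝ) ^ 2 - 1) := rfl
  have hNC : (N : ℂ) ≠ 0 := by exact_mod_cast hN.ne'
  have S1 := sum_entryCorr_same (M := M) (N := N) hv0
  have S2 := sum_entryCorr_diag (M := M) (N := N) v
  rw [hv, natCast_mul_one_div hM, ← hv] at S1
  rw [← hE] at S2
  by_cases hne : (i = j ∧ k = l) ∨ (i = k ∧ j = l)
  swap
  · rw [entryCorr_eq_zero v (fun h ↦ hne (Or.inl h)) (fun h ↦ hne (Or.inr h))]
    simp [show ¬ (i = j ∧ k = l) from fun h ↦ hne (Or.inl h),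
      show ¬ (i = k ∧ j = l) from fun h ↦ hne (Or.inr h)]
  obtain ⟨q, hq⟩ : ∃ q, ∀ a, entryCorr M N v a a a a = q := ⟨_, fun a ↦ entryCorr_self_const v a i⟩
  rcases Nat.lt_or_ge 1 N with h1 | h1
  · -- at least two columns
    obtain ⟨p, hp⟩ : ∃ p, ∀ a b, a ≠ b → entryCorr M N v a a b b = p :=
      ⟨_, fun a b hab ↦ entryCorr_diag_const v hab
        (show (⟨0, hN⟩ : Fin N) ≠ ⟨1, h1⟩ by simp)⟩
    have hr : ∀ a b, a ≠ b → entryCorr M N v a b a b = q - p := by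
      intro a b hab
      have := entryCorr_self_eq_add (M := M) v hab
      rw [hq, hp a b hab] at this
      linear_combination -this
    have cnt : ∀ (f : Fin N → Fin N → ℂ) (s : ℂ), (∀ a, f a a = q) → (∀ a b, a ≠ b → f a b = s) →
        ∑ a, ∑ b, f a b = N * q + N * (N - 1) * s := by
      intro f s hf hs
      have : ∀ a, ∑ b, f a b = q + (N - 1) * s := by
        intro a
        rw [← Finset.add_sum_erase _ _ (Finset.mem_univ a), hf,
          Finset.sum_congr rfl fun b hb ↦ hs a b (Finset.ne_of_mem_erase hb).symm]
        simp [Finset.card_erase_of_mem, Nat.cast_sub hN]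
      simp [this]
      ring
    rw [cnt (fun a b ↦ entryCorr M N v a b a b) (q - p) hq hr] at S1
    rw [cnt (fun a b ↦ entryCorr M N v a a b b) p hq hp] at S2
    have hN2 : (N : ℂ) ^ 2 - 1 ≠ 0 := by
      have : (1 : ℝ) < N := by exact_mod_cast h1
      have h2 : (N : ℝ) ^ 2 - 1 ≠ 0 := by nlinarith
      exact_mod_cast h2
    have T1 : q + (N - 1) * (q - p) = 1 := by
      apply mul_left_cancel₀ hNC
      linear_combination S1
    have hpc : (chi M N : ℂ) = p := by
      rw [hchi]
      push_cast
      rw [div_eq_iff hN2]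
      linear_combination T1 - S2
    have hqv : q = (N : ℂ)⁻¹ + p * (1 - (N : ℂ)⁻¹) := by
      field_simp
      linear_combination T1
    rw [hpc]
    rcases hne with ⟨rfl, rfl⟩ | ⟨rfl, rfl⟩
    · rcases eq_or_ne i k with rfl | hik
      · rw [hq, hqv]
        simp
      · rw [hp i k hik]
        simp [hik]
    · rcases eq_or_ne i j with rfl | hij
      · rw [hq, hqv]
        simp
      · rw [hr i j hij, hqv]
        simp [hij]
        ring
  · -- a single column: `χ` does not enter
    obtain rfl : N = 1 := by omega
    have hq1 : q = 1 := by simpa [hq] using S1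
    have hi := Subsingleton.elim i 0
    have hj := Subsingleton.elim j 0
    have hk := Subsingleton.elim k 0
    have hl := Subsingleton.elim l 0
    subst hi hj hk hl
    rw [hq, hq1]
    simp

lemma maxEntangledState_apply (p q : Fin N × Fin N) :
    maxEntangledState N p q = if p.1 = p.2 ∧ q.1 = q.2 then (N : ℂ)⁻¹ else 0 := by
  have h : (((√(N : ℝ))⁻¹ : ℝ) : ℂ) * (((√(N : ℝ))⁻¹ : ℝ) : ℂ) = (N : ℂ)⁻¹ := by
    rw [← Complex.ofReal_mul, ← mul_inv, Real.mul_self_sqrt (Nat.cast_nonneg _)]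
    simp
  rw [maxEntangledState, Matrix.vecMulVec_apply, Pi.star_apply, maxEntangledVec, maxEntangledVec]
  by_cases h1 : p.1 = p.2 <;> by_cases h2 : q.1 = q.2 <;> simp only [h1, h2, if_true, if_false,
    true_and, false_and, RCLike.star_def, Complex.conj_ofReal, map_zero, mul_zero, zero_mul, h]

lemma integral_absTensor_apply (hN : 0 < N) (hM : 0 < M) (p q : Fin N × Fin N) :
    ∫ y, absTensor (toMat y) p q ∂(ginibreLaw M N (1 / (M : ℝ≥0))) =
      (maxEntangledState N + (chi M N : ℂ) • (1 - maxEntangledState N)) p q := by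
  simp only [absTensor_apply]
  rw [integral_matAbs_mul_conj, entryCorr_eq hN hM, Matrix.add_apply, Matrix.smul_apply,
    Matrix.sub_apply, maxEntangledState_apply, Matrix.one_apply, smul_eq_mul]
  simp only [Prod.ext_iff]

/-- The lower bound on `χ` comes from `(Tr |Y|)² ≥ Tr |Y|²`. -/
lemma le_chi (hN : 2 ≤ N) (hM : 0 < M) : 1 / ((N : ℝ) + 1) ≤ chi M N := by
  have hv0 : (1 / (M : ℝ≥0)) ≠ 0 := one_div_natCast_ne_zero hM
  have h : (N : ℝ) ≤ ∫ y, traceNorm (toMat y) ^ 2 ∂(ginibreLaw M N (1 / (M : ℝ≥0))) := by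
    rw [← natCast_mul_one_div (N := N) hM, ← integral_hsNormSq hv0]
    exact integral_mono (integrable_hsNormSq _) (integrable_traceNorm_sq _)
      fun y ↦ hsNormSq_le_traceNorm_sq _
  have hN' : (2 : ℝ) ≤ N := by exact_mod_cast hN
  rw [chi_eq, div_le_div_iff₀ (by positivity) (by nlinarith)]
  nlinarith

lemma expectation_absTensor {Ω : Type*} [MeasurableSpace Ω] (P : Measure Ω)
    [IsProbabilityMeasure P] (hN : 0 < N) (hM : 0 < M) (Y : Ω → Matrix (Fin M) (Fin N) ℂ)
    (hY : IsGinibre (1 / (M : ℝ≥0)) Y P) :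
    (∀ p q, Integrable (fun w ↦ absTensor (Y w) p q) P) ∧
      Integrable (fun w ↦ traceNorm (Y w) ^ 2) P ∧
      chi M N = ((∫ w, traceNorm (Y w) ^ 2 ∂P) - 1) / ((N : ℝ) ^ 2 - 1) ∧
      (Matrix.of fun p q ↦ ∫ w, absTensor (Y w) p q ∂P) =
        maxEntangledState N + (chi M N : ℂ) • (1 - maxEntangledState N) := by
  have hlaw := hY.hasLaw_ginibreLaw
  have i1 : ∀ p q, Integrable (fun y ↦ absTensor (toMat y) p q)
      (ginibreLaw M N (1 / (M : ℝ≥0))) := by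
    intro p q
    simp only [absTensor_apply]
    exact integrable_matAbs_mul_conj _ _ _ _ _
  have i2 := integrable_traceNorm_sq (M := M) (N := N) (1 / (M : ℝ≥0))
  refine ⟨fun p q ↦ ?_, ?_, ?_, ?_⟩
  · have := i1 p q
    rw [← hlaw.map_eq] at this
    exact this.comp_aemeasurable hlaw.aemeasurable
  · rw [← hlaw.map_eq] at i2
    exact i2.comp_aemeasurable hlaw.aemeasurable
  · rw [chi_eq, ← hlaw.integral_comp i2.aestronglyMeasurable]
    rfl
  · ext p q
    rw [← integral_absTensor_apply hN hM, ← hlaw.integral_comp (i1 p q).aestronglyMeasurable]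
    rfl

/-! ### The loop equation for the resolvent -/

lemma continuous_gramResolvent {t : ℝ} (ht : 0 < t) :
    Continuous fun y : Fin M × Fin N → ℂ ↦ gramResolvent (toMat y) t := by
  have hA := continuous_toMat (M := M) (N := N)
  have hc : Continuous fun y : Fin M × Fin N → ℂ ↦
      (toMat y)ᴴ * toMat y + (t : ℂ) • (1 : Matrix (Fin N) (Fin N) ℂ) :=
    (hA.matrix_conjTranspose.matrix_mul hA).add continuous_const
  simp only [gramResolvent, Matrix.inv_def, Ring.inverse_eq_inv']
  refine (hc.matrix_det.inv₀ fun y ↦ ?_).smul hc.matrix_adjugate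
  exact ((Matrix.isUnit_iff_isUnit_det _).1 (isUnit_gram_add (toMat y) ht)).ne_zero

lemma continuous_gramTrace {t : ℝ} (ht : 0 < t) :
    Continuous fun y : Fin M × Fin N → ℂ ↦ gramTrace (toMat y) t := by
  have hA := continuous_toMat (M := M) (N := N)
  have h := ((hA.matrix_conjTranspose.matrix_mul hA).matrix_mul
    (continuous_gramResolvent ht)).matrix_trace
  exact (Complex.continuous_re.comp h).div_const _

/-- The quadratic polynomial with root `mpRoot l t`. -/
def mpPoly (l t h : ℝ) : ℝ := (1 - h) * (1 - l * h) - t * h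

lemma abs_mpPoly_le {l t h : ℝ} (hl : 0 ≤ l) (ht : 0 ≤ t) (h0 : 0 ≤ h) (h1 : h ≤ 1) :
    |mpPoly l t h| ≤ 1 + l + t := by
  have a : 0 ≤ l * h := mul_nonneg hl h0
  have b : l * h ≤ l := mul_le_of_le_one_right hl h1
  have c : 0 ≤ t * h := mul_nonneg ht h0
  have d : t * h ≤ t := mul_le_of_le_one_right ht h1
  have e : |(1 - h) * (1 - l * h)| ≤ 1 * (1 + l) := by
    rw [abs_mul]
    apply mul_le_mul _ _ (abs_nonneg _) zero_le_one
    · rw [abs_le]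
      constructor <;> linarith
    · rw [abs_le]
      constructor <;> linarith
  rw [abs_le] at e ⊢
  unfold mpPoly
  constructor <;> linarith [e.1, e.2]

lemma hasDerivAt_mpPoly (l t h : ℝ) : HasDerivAt (mpPoly l t) (2 * l * h - (1 + l + t)) h := by
  have h1 : HasDerivAt (fun h : ℝ ↦ 1 - h) (-1) h := (hasDerivAt_id h).const_sub 1
  have h2 : HasDerivAt (fun h : ℝ ↦ 1 - l * h) (-(l * 1)) h :=
    ((hasDerivAt_id h).const_mul l).const_sub 1
  have h3 : HasDerivAt (fun h : ℝ ↦ t * h) (t * 1) h := (hasDerivAt_id h).const_mul t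
  refine ((h1.mul h2).sub h3).congr_deriv ?_
  ring

lemma mul_single_mul_apply {m n o q : Type*} [Fintype m] [Fintype n] [DecidableEq m]
    [DecidableEq n] (X : Matrix o m ℂ) (Z : Matrix n q ℂ) (i : m) (a : n) (c : ℂ) (x : o) (y : q) :
    (X * Matrix.single i a c * Z) x y = X x i * c * Z a y := by
  rw [Matrix.mul_assoc, Matrix.mul_apply, Finset.sum_eq_single i]
  · rw [Matrix.single_mul_apply_same, mul_assoc]
  · intro j _ hj
    rw [Matrix.single_mul_apply_of_ne _ _ _ _ _ hj, mul_zero]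
  · simp

lemma toMat_add_smul_single (y : Fin M × Fin N → ℂ) (s : ℝ) (i : Fin M) (a : Fin N) (c : ℂ) :
    toMat (y + s • (Pi.single (i, a) c : Fin M × Fin N → ℂ)) =
      toMat y + s • Matrix.single i a c := by
  ext j b
  simp only [toMat, Matrix.of_apply, Pi.add_apply, Pi.smul_apply, Matrix.add_apply,
    Matrix.smul_apply, Pi.single_apply, Matrix.single_apply, Prod.mk.injEq]
  congr 2
  simp only [eq_comm]

section LoopEquation

variable {t : ℝ}

/-- The test function of the loop equation is `(A G)ᵢₐ * φ(h)`, with `G` the resolvent, `h` its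
normalized trace and `φ = mpPoly l t`. This is its derivative when the `(i, a)` entry of `A` moves
in the direction `c`. -/
noncomputable def loopDeriv (l t : ℝ) (A : Matrix (Fin M) (Fin N) ℂ) (i : Fin M) (a : Fin N)
    (c : ℂ) : ℂ :=
  (c * gramResolvent A t a a - starRingEnd ℂ c * (A * gramResolvent A t) i a ^ 2 -
      c * (A * gramResolvent A t * Aᴴ) i i * gramResolvent A t a a) * mpPoly l t (gramTrace A t) +
    (A * gramResolvent A t) i a * (((2 * l * gramTrace A t - (1 + l + t)) *
      (2 * t / N * (c * (gramResolvent A t * gramResolvent A t * Aᴴ) a i).re) : ℝ) : ℂ)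

lemma hasDerivAt_loop (hN : 0 < N) (ht : 0 < t) (l : ℝ) (A : Matrix (Fin M) (Fin N) ℂ)
    (i : Fin M) (a : Fin N) (c : ℂ) :
    HasDerivAt (fun s : ℝ ↦ ((A + s • Matrix.single i a c) *
        gramResolvent (A + s • Matrix.single i a c) t) i a *
          (mpPoly l t (gramTrace (A + s • Matrix.single i a c) t) : ℂ))
      (loopDeriv l t A i a c) 0 := by
  have h1 := hasDerivAt_mul_gramResolvent_apply A (Matrix.single i a c) ht i a
  have h2 := hasDerivAt_gramTrace A (Matrix.single i a c) hN ht
  have e0 : A + (0 : ℝ) • Matrix.single i a c = A := by rw [zero_smul, add_zero]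
  have h3 := (hasDerivAt_mpPoly l t (gramTrace (A + (0 : ℝ) • Matrix.single i a c) t)).comp 0 h2
  have h4 := h1.mul h3.ofReal_comp
  refine h4.congr_deriv ?_
  simp only [Function.comp_apply, e0]
  rw [loopDeriv]
  congr 2
  · rw [Matrix.add_apply, Matrix.single_mul_apply_same, gramResolventDeriv, Matrix.mul_neg,
      Matrix.neg_apply]
    have : A * (gramResolvent A t * ((Matrix.single i a c)ᴴ * A + Aᴴ * Matrix.single i a c) *
        gramResolvent A t) =
        A * gramResolvent A t * Matrix.single a i (starRingEnd ℂ c) * (A * gramResolvent A t) +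
        A * gramResolvent A t * Aᴴ * Matrix.single i a c * gramResolvent A t := by
      rw [Matrix.conjTranspose_single]
      simp only [Matrix.mul_add, Matrix.add_mul, Matrix.mul_assoc]
      rfl
    rw [this, Matrix.add_apply, mul_single_mul_apply, mul_single_mul_apply]
    ring
  · congr 4
    rw [Matrix.trace_mul_single]
    simp [mul_comm]

/-- The two directional derivatives combine into a complex derivative. -/
lemma loopDeriv_one_sub (l : ℝ) (A : Matrix (Fin M) (Fin N) ℂ) (i : Fin M) (a : Fin N) :
    loopDeriv l t A i a 1 - Complex.I * loopDeriv l t A i a Complex.I =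
      2 * (gramResolvent A t a a * (1 - (A * gramResolvent A t * Aᴴ) i i) *
        mpPoly l t (gramTrace A t) + (((2 * l * gramTrace A t - (1 + l + t)) * (t / N) : ℝ) : ℂ) *
          ((A * gramResolvent A t) i a * (gramResolvent A t * gramResolvent A t * Aᴴ) a i)) := by
  unfold loopDeriv
  generalize (gramResolvent A t * gramResolvent A t * Aᴴ) a i = z
  have hz : z = (z.re : ℂ) + (z.im : ℂ) * Complex.I := (Complex.re_add_im z).symm
  simp only [one_mul, Complex.I_mul_re, map_one, Complex.conj_I]
  conv_rhs => rw [hz]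
  push_cast
  have hI := Complex.I_sq
  linear_combination (-(gramResolvent A t a a) + (A * gramResolvent A t * Aᴴ) i i *
    gramResolvent A t a a - (A * gramResolvent A t) i a ^ 2) * mpPoly l t (gramTrace A t) * hI

/-- Uniform bounds, which make Gaussian integration by parts applicable to the test functions. -/
lemma exists_bound_loop (hN : 0 < N) (ht : 0 < t) {l : ℝ} (hl : 0 ≤ l) :
    ∃ C : ℝ, ∀ (A : Matrix (Fin M) (Fin N) ℂ) (i : Fin M) (a : Fin N),
      ‖(A * gramResolvent A t) i a * (mpPoly l t (gramTrace A t) : ℂ)‖ ≤ C ∧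
      ∀ c : ℂ, ‖c‖ = 1 → ‖loopDeriv l t A i a c‖ ≤ C := by
  set K := 1 + t⁻¹ with hK
  set L := 1 + l + t with hL
  have hK0 : 0 ≤ K := by positivity
  have hL0 : 0 ≤ L := by positivity
  refine ⟨(2 * K + K ^ 2) * L + K * (3 * L * (2 * t * K ^ 2)), fun A i a ↦ ?_⟩
  have hf : ∀ i a, ‖(A * gramResolvent A t) i a‖ ≤ K := by
    intro i a
    have := norm_mul_gramResolvent_sq_le A ht i a
    nlinarith [sq_nonneg (‖(A * gramResolvent A t) i a‖ - 1)]
  have hG : ∀ a b, ‖gramResolvent A t a b‖ ≤ K := fun a b ↦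
    (norm_gramResolvent_le A ht a b).trans (by linarith)
  have hP := norm_mul_gramResolvent_mul_diag_le A ht i
  have h0 := gramTrace_nonneg A ht
  have h1 := gramTrace_le_one A ht
  have hφ : ‖(mpPoly l t (gramTrace A t) : ℂ)‖ ≤ L := by
    rw [Complex.norm_real]
    exact abs_mpPoly_le hl ht.le h0 h1
  have hφ' : |2 * l * gramTrace A t - (1 + l + t)| ≤ 3 * L := by
    have a1 : 0 ≤ l * gramTrace A t := mul_nonneg hl h0
    have a2 : l * gramTrace A t ≤ l := mul_le_of_le_one_right hl h1
    rw [abs_le]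
    constructor <;> linarith
  have hz : ‖(gramResolvent A t * gramResolvent A t * Aᴴ) a i‖ ≤ N * K ^ 2 := by
    have e : gramResolvent A t * gramResolvent A t * Aᴴ =
        gramResolvent A t * (A * gramResolvent A t)ᴴ := by
      rw [Matrix.conjTranspose_mul, (isHermitian_gramResolvent A).eq, Matrix.mul_assoc]
    rw [e, Matrix.mul_apply]
    calc _ ≤ ∑ b, ‖gramResolvent A t a b * (A * gramResolvent A t)ᴴ b i‖ := norm_sum_le _ _
      _ ≤ ∑ b : Fin N, K ^ 2 := by
        refine Finset.sum_le_sum fun b _ ↦ ?_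
        rw [norm_mul, Matrix.conjTranspose_apply, norm_star, sq]
        exact mul_le_mul (hG a b) (hf i b) (norm_nonneg _) hK0
      _ = N * K ^ 2 := by simp
  have hN' : (N : ℝ) ≠ 0 := by positivity
  constructor
  · rw [norm_mul]
    calc _ ≤ K * L := mul_le_mul (hf i a) hφ (norm_nonneg _) hK0
      _ ≤ _ := by
        have : 0 ≤ K * (3 * L * (2 * t * K ^ 2)) := by positivity
        nlinarith [mul_nonneg hK0 hL0, mul_nonneg (sq_nonneg K) hL0]
  · intro c hc
    have hb1 : ‖c * gramResolvent A t a a - starRingEnd ℂ c * (A * gramResolvent A t) i a ^ 2 -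
        c * (A * gramResolvent A t * Aᴴ) i i * gramResolvent A t a a‖ ≤ 2 * K + K ^ 2 := by
      refine (norm_sub_le _ _).trans ?_
      refine (add_le_add_left (norm_sub_le _ _) _).trans ?_
      rw [norm_mul, norm_mul, norm_mul, norm_mul, RCLike.norm_conj, hc, norm_pow, one_mul, one_mul,
        one_mul]
      have b1 : ‖(A * gramResolvent A t) i a‖ ^ 2 ≤ K ^ 2 :=
        pow_le_pow_left₀ (norm_nonneg _) (hf i a) 2
      have b2 : ‖(A * gramResolvent A t * Aᴴ) i i‖ * ‖gramResolvent A t a a‖ ≤ 1 * K :=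
        mul_le_mul hP (hG a a) (norm_nonneg _) zero_le_one
      linarith [hG a a]
    have hb2 : |2 * t / N * (c * (gramResolvent A t * gramResolvent A t * Aᴴ) a i).re| ≤
        2 * t * K ^ 2 := by
      rw [abs_mul, abs_of_nonneg (by positivity)]
      have : |(c * (gramResolvent A t * gramResolvent A t * Aᴴ) a i).re| ≤ N * K ^ 2 := by
        refine (Complex.abs_re_le_norm _).trans ?_
        rw [norm_mul, hc, one_mul]
        exact hz
      calc _ ≤ 2 * t / N * (N * K ^ 2) := by gcongr
        _ = 2 * t * K ^ 2 := by field_simp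
    rw [loopDeriv]
    refine (norm_add_le _ _).trans ?_
    have hb3 : ‖(((2 * l * gramTrace A t - (1 + l + t)) *
        (2 * t / N * (c * (gramResolvent A t * gramResolvent A t * Aᴴ) a i).re) : ℝ) : ℂ)‖ ≤
        3 * L * (2 * t * K ^ 2) := by
      rw [Complex.norm_real, Real.norm_eq_abs, abs_mul]
      exact mul_le_mul hφ' hb2 (abs_nonneg _) (by positivity)
    refine add_le_add ?_ ?_
    · rw [norm_mul]
      exact mul_le_mul hb1 hφ (norm_nonneg _) (by positivity)
    · rw [norm_mul]
      exact mul_le_mul (hf i a) hb3 (norm_nonneg _) hK0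

end LoopEquation

lemma continuous_loopDeriv (l : ℝ) {t : ℝ} (ht : 0 < t) (i : Fin M) (a : Fin N) (c : ℂ) :
    Continuous fun y : Fin M × Fin N → ℂ ↦ loopDeriv l t (toMat y) i a c := by
  have hA := continuous_toMat (M := M) (N := N)
  have hG := continuous_gramResolvent (M := M) (N := N) ht
  have hh := continuous_gramTrace (M := M) (N := N) ht
  have h1 := hG.matrix_elem a a
  have h2 := (hA.matrix_mul hG).matrix_elem i a
  have h3 := ((hA.matrix_mul hG).matrix_mul hA.matrix_conjTranspose).matrix_elem i i
  have h4 := ((hG.matrix_mul hG).matrix_mul hA.matrix_conjTranspose).matrix_elem a i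
  unfold loopDeriv mpPoly
  fun_prop

lemma continuous_loop (l : ℝ) {t : ℝ} (ht : 0 < t) (i : Fin M) (a : Fin N) :
    Continuous fun y : Fin M × Fin N → ℂ ↦
      (toMat y * gramResolvent (toMat y) t) i a * (mpPoly l t (gramTrace (toMat y) t) : ℂ) := by
  have hA := continuous_toMat (M := M) (N := N)
  have hG := continuous_gramResolvent (M := M) (N := N) ht
  have hh := continuous_gramTrace (M := M) (N := N) ht
  have h2 := (hA.matrix_mul hG).matrix_elem i a
  unfold mpPoly
  fun_prop

lemma sum_conj_mul_loop (hN : 0 < N) {t : ℝ} (ht : 0 < t) (l : ℝ)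
    (A : Matrix (Fin M) (Fin N) ℂ) :
    ∑ i, ∑ a, starRingEnd ℂ (A i a) *
      ((A * gramResolvent A t) i a * (mpPoly l t (gramTrace A t) : ℂ)) =
      ((N * gramTrace A t * mpPoly l t (gramTrace A t) : ℝ) : ℂ) := by
  have h := trace_gram_mul_gramResolvent A hN ht
  rw [Complex.ofReal_mul, ← h, Matrix.mul_assoc, Matrix.trace, Finset.sum_comm, Finset.sum_mul]
  refine Finset.sum_congr rfl fun a _ ↦ ?_
  rw [Matrix.diag_apply, Matrix.mul_apply, Finset.sum_mul]
  refine Finset.sum_congr rfl fun i _ ↦ ?_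
  rw [Matrix.conjTranspose_apply, RCLike.star_def, mul_assoc]

/-- Summed over all entries, the derivatives give the quadratic polynomial of the limiting equation
and a remainder which carries an additional factor `1 / N`. -/
lemma sum_loopDeriv (hN : 0 < N) {t : ℝ} (ht : 0 < t) (l : ℝ)
    (A : Matrix (Fin M) (Fin N) ℂ) : ∃ r : ℝ, 0 ≤ r ∧ r ≤ N / t ^ 2 ∧
    ∑ i, ∑ a, (loopDeriv l t A i a 1 - Complex.I * loopDeriv l t A i a Complex.I) =
      ((2 * (N * (1 - gramTrace A t) / t * (M - N * gramTrace A t) * mpPoly l t (gramTrace A t) +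
        (2 * l * gramTrace A t - (1 + l + t)) * (t / N) * r) : ℝ) : ℂ) := by
  obtain ⟨r, h0, h1, hr⟩ := trace_gram_mul_gramResolvent_cube A ht
  refine ⟨r, h0, h1, ?_⟩
  simp_rw [loopDeriv_one_sub]
  have e1 : ∑ i, ∑ a, gramResolvent A t a a * (1 - (A * gramResolvent A t * Aᴴ) i i) =
      ((N * (1 - gramTrace A t) / t * (M - N * gramTrace A t) : ℝ) : ℂ) := by
    have hP : ∑ i, (A * gramResolvent A t * Aᴴ) i i = ((N * gramTrace A t : ℝ) : ℂ) := by
      rw [← trace_gram_mul_gramResolvent A hN ht]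
      change (A * gramResolvent A t * Aᴴ).trace = _
      rw [Matrix.trace_mul_comm, Matrix.mul_assoc]
    have hT : ∑ a, gramResolvent A t a a = ((N * (1 - gramTrace A t) / t : ℝ) : ℂ) :=
      trace_gramResolvent A hN ht
    rw [Complex.ofReal_mul, ← hT, Complex.ofReal_sub, ← hP, Finset.sum_comm, Finset.sum_mul]
    refine Finset.sum_congr rfl fun a _ ↦ ?_
    rw [← Finset.mul_sum, Finset.sum_sub_distrib]
    simp
  have e2 : ∑ i, ∑ a, (A * gramResolvent A t) i a *
      (gramResolvent A t * gramResolvent A t * Aᴴ) a i = (r : ℂ) := by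
    calc _ = (A * gramResolvent A t * (gramResolvent A t * gramResolvent A t * Aᴴ)).trace :=
        Finset.sum_congr rfl fun i _ ↦ Matrix.mul_apply.symm
      _ = _ := by
        rw [← hr, ← Matrix.mul_assoc, Matrix.trace_mul_comm]
        simp only [Matrix.mul_assoc]
  have e3 : ∀ x₁ x₂ x₃ x₄ : ℝ, ((2 * (x₁ * x₂ + x₃ * x₄) : ℝ) : ℂ) = 2 * (x₁ * x₂ + x₃ * x₄) := by
    intros
    push_cast
    rfl
  rw [e3, ← e1, ← e2]
  simp only [Finset.mul_sum, Finset.sum_mul, ← Finset.sum_add_distrib, mul_add]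

/-- The loop equation. Testing the integration by parts with a multiple of the defect `φ` of the
Marchenko–Pastur equation itself makes the leading terms combine to `φ²`, so that no separate
variance bound is needed: the mean square of `φ` at the normalized resolvent trace of a Ginibre
matrix is of order `1 / (N M)`. -/
lemma integral_mpPoly_gramTrace_sq_le (hN : 0 < N) (hM : 0 < M) {t : ℝ} (ht : 0 < t) :
    ∫ y, mpPoly (N / M) t (gramTrace (toMat y) t) ^ 2 ∂(ginibreLaw M N (1 / (M : ℝ≥0))) ≤
      3 * (1 + N / M + t) / (N * M) := by
  have hv0 : (1 / (M : ℝ≥0)) ≠ 0 := one_div_natCast_ne_zero hM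
  set l : ℝ := N / M with hl
  have hl0 : 0 ≤ l := by positivity
  obtain ⟨C, hC⟩ := exists_bound_loop (M := M) hN ht hl0
  have hv : ((1 / (M : ℝ≥0) : ℝ≥0) : ℂ) = (1 / M : ℝ) := by push_cast; rfl
  set v := 1 / (M : ℝ≥0) with hvd
  choose r hr0 hr1 hr using fun y : Fin M × Fin N → ℂ ↦ sum_loopDeriv hN ht l (toMat y)
  have hN' : (N : ℝ) ≠ 0 := by positivity
  have hM' : (M : ℝ) ≠ 0 := by positivity
  set μ := ginibreLaw M N v with hμ
  have stein : ∀ i a, ∫ y, starRingEnd ℂ (y (i, a)) * ((toMat y * gramResolvent (toMat y) t) i a *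
      (mpPoly l t (gramTrace (toMat y) t) : ℂ)) ∂μ = v / 2 * ∫ y, (loopDeriv l t (toMat y) i a 1 -
        Complex.I * loopDeriv l t (toMat y) i a Complex.I) ∂μ := by
    intro i a
    refine integral_conj_mul_pi hv0 (i, a) (fun y ↦ ?_) (fun y ↦ ?_)
      (continuous_loop l ht i a).measurable (continuous_loopDeriv l ht i a _).measurable
      (continuous_loopDeriv l ht i a _).measurable (fun y ↦ (hC (toMat y) i a).1)
      (fun y ↦ (hC (toMat y) i a).2 1 (by simp)) (fun y ↦ (hC (toMat y) i a).2 _ (by simp))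
    · simp only [toMat_add_smul_single]
      exact hasDerivAt_loop hN ht l (toMat y) i a 1
    · simp only [toMat_add_smul_single]
      exact hasDerivAt_loop hN ht l (toMat y) i a Complex.I
  have i1 : ∀ i a, Integrable (fun y : Fin M × Fin N → ℂ ↦ starRingEnd ℂ (y (i, a)) *
      ((toMat y * gramResolvent (toMat y) t) i a *
        (mpPoly l t (gramTrace (toMat y) t) : ℂ))) μ := by
    intro i a
    refine Integrable.mul_bdd (c := C) ?_
      (continuous_loop l ht i a).measurable.aestronglyMeasurable
      (ae_of_all _ fun y ↦ (hC (toMat y) i a).1)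
    have := integrable_comp_eval (μ := fun _ : Fin M × Fin N ↦ complexGaussian v) (i := (i, a))
      (integrable_id_complexGaussian v)
    exact Complex.conjCLE.toContinuousLinearMap.integrable_comp this
  have i2 : ∀ i a, Integrable (fun y : Fin M × Fin N → ℂ ↦ loopDeriv l t (toMat y) i a 1 -
        Complex.I * loopDeriv l t (toMat y) i a Complex.I) μ := by
    intro i a
    have : ∀ c : ℂ, ‖c‖ = 1 → Integrable (fun y : Fin M × Fin N → ℂ ↦
        loopDeriv l t (toMat y) i a c) μ := fun c hc ↦
      Integrable.of_bound (continuous_loopDeriv l ht i a c).measurable.aestronglyMeasurable C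
        (ae_of_all _ fun y ↦ (hC (toMat y) i a).2 c hc)
    exact (this 1 (by simp)).sub ((this Complex.I (by simp)).const_mul _)
  have key := Finset.sum_congr (rfl : (Finset.univ : Finset (Fin M)) = _) fun i _ ↦
    Finset.sum_congr (rfl : (Finset.univ : Finset (Fin N)) = _) fun a _ ↦ stein i a
  simp_rw [← Finset.mul_sum] at key
  simp only [← integral_finsetSum _ fun a _ ↦ i1 _ a, ← integral_finsetSum _ fun a _ ↦ i2 _ a]
    at key
  rw [← integral_finsetSum _ fun i _ ↦ integrable_finsetSum _ fun a _ ↦ i1 i a,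
    ← integral_finsetSum _ fun i _ ↦ integrable_finsetSum _ fun a _ ↦ i2 i a] at key
  have e1 : ∀ y : Fin M × Fin N → ℂ, ∑ i, ∑ a, starRingEnd ℂ (y (i, a)) *
      ((toMat y * gramResolvent (toMat y) t) i a * (mpPoly l t (gramTrace (toMat y) t) : ℂ)) = _ :=
    fun y ↦ sum_conj_mul_loop hN ht l (toMat y)
  simp_rw [e1, hr, integral_complex_ofReal] at key
  rw [hv] at key
  have key' : ∫ y, N * gramTrace (toMat y) t * mpPoly l t (gramTrace (toMat y) t) ∂μ =
      1 / M / 2 * ∫ y, 2 * (N * (1 - gramTrace (toMat y) t) / t * (M - N * gramTrace (toMat y) t) *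
        mpPoly l t (gramTrace (toMat y) t) +
        (2 * l * gramTrace (toMat y) t - (1 + l + t)) * (t / N) * r y) ∂μ := by
    exact_mod_cast key
  have hh0 := fun y : Fin M × Fin N → ℂ ↦ gramTrace_nonneg (toMat y) ht
  have hh1 := fun y : Fin M × Fin N → ℂ ↦ gramTrace_le_one (toMat y) ht
  have hhc := continuous_gramTrace (M := M) (N := N) ht
  have hφc : Continuous fun y : Fin M × Fin N → ℂ ↦ mpPoly l t (gramTrace (toMat y) t) := by
    unfold mpPoly
    fun_prop
  have hφb := fun y : Fin M × Fin N → ℂ ↦ abs_mpPoly_le hl0 ht.le (hh0 y) (hh1 y)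
  have hint : ∀ f : (Fin M × Fin N → ℂ) → ℝ, Continuous f → ∀ K, (∀ y, |f y| ≤ K) →
      Integrable f μ := fun f hf K hK ↦
    Integrable.of_bound hf.measurable.aestronglyMeasurable K (ae_of_all _ hK)
  have j1 : Integrable (fun y : Fin M × Fin N → ℂ ↦
      N * gramTrace (toMat y) t * mpPoly l t (gramTrace (toMat y) t)) μ := by
    refine hint _ (by fun_prop) (N * 1 * (1 + l + t)) fun y ↦ ?_
    rw [abs_mul, abs_of_nonneg (mul_nonneg (Nat.cast_nonneg _) (hh0 y))]
    have := hh0 y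
    have := hh1 y
    have := hφb y
    gcongr
  have j2 : Integrable (fun y : Fin M × Fin N → ℂ ↦
      mpPoly l t (gramTrace (toMat y) t) ^ 2) μ := by
    refine hint _ (by fun_prop) ((1 + l + t) ^ 2) fun y ↦ ?_
    rw [abs_pow]
    exact pow_le_pow_left₀ (abs_nonneg _) (hφb y) 2
  have hres : Integrable (fun y ↦ 2 * (N * (1 - gramTrace (toMat y) t) / t *
      (M - N * gramTrace (toMat y) t) * mpPoly l t (gramTrace (toMat y) t) +
        (2 * l * gramTrace (toMat y) t - (1 + l + t)) * (t / N) * r y)) μ := by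
    have := integrable_finsetSum (Finset.univ : Finset (Fin M)) fun i _ ↦
      integrable_finsetSum (Finset.univ : Finset (Fin N)) fun a _ ↦ i2 i a
    simp_rw [hr] at this
    simpa using this.re
  -- by `key'` the bracket multiplied by `t / N` has integral zero
  have hle : ∀ y : Fin M × Fin N → ℂ, mpPoly l t (gramTrace (toMat y) t) ^ 2 ≤
      t / N * (1 / M / 2 * (2 * (N * (1 - gramTrace (toMat y) t) / t *
      (M - N * gramTrace (toMat y) t) * mpPoly l t (gramTrace (toMat y) t) +
        (2 * l * gramTrace (toMat y) t - (1 + l + t)) * (t / N) * r y)) -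
        N * gramTrace (toMat y) t * mpPoly l t (gramTrace (toMat y) t)) +
      3 * (1 + l + t) / (N * M) := by
    intro y
    have h0 := hh0 y
    have h1 := hh1 y
    have b0 := hr0 y
    have b1 := hr1 y
    generalize r y = ρ at *
    generalize gramTrace (toMat y) t = h at *
    have e : t / N * (1 / M / 2 * (2 * (N * (1 - h) / t * (M - N * h) * mpPoly l t h +
        (2 * l * h - (1 + l + t)) * (t / N) * ρ)) - N * h * mpPoly l t h) =
        mpPoly l t h ^ 2 + (2 * l * h - (1 + l + t)) * (t ^ 2 / (N ^ 2 * M)) * ρ := by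
      simp only [mpPoly, hl]
      field_simp
      ring
    rw [e]
    have a1 : 0 ≤ l * h := mul_nonneg hl0 h0
    have a2 : (1 + l + t) * (t ^ 2 / (N ^ 2 * M)) * ρ ≤
        (1 + l + t) * (t ^ 2 / (N ^ 2 * M)) * (N / t ^ 2) := by gcongr
    have a3 : (1 + l + t) * (t ^ 2 / (N ^ 2 * M)) * (N / t ^ 2) = (1 + l + t) / (N * M) := by
      field_simp
    have a4 : 0 ≤ 2 * (l * h) * (t ^ 2 / (N ^ 2 * M)) * ρ := by positivity
    have a5 : 0 ≤ (1 + l + t) / (N * M) := by positivity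
    have a6 : 3 * (1 + l + t) / (N * M) = 3 * ((1 + l + t) / (N * M)) := by ring
    linarith
  refine (integral_mono j2 ((((hres.const_mul _).sub j1).const_mul _).add
    (integrable_const _)) hle).trans ?_
  rw [integral_add' (((hres.const_mul _).sub j1).const_mul _) (integrable_const _),
    integral_const_mul, integral_sub' (hres.const_mul _) j1, integral_const_mul, ← key', sub_self]
  simp

/-! ### Convergence of the normalized trace norm -/

/-- The Cauchy–Schwarz inequality with the weight `1 + u²`, whose inverse has integral `π`. -/
lemma sq_integral_le_pi_mul {g : ℝ → ℝ} (hg : Integrable g)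
    (hg2 : Integrable fun u ↦ (1 + u ^ 2) * g u ^ 2) :
    (∫ u, g u) ^ 2 ≤ Real.pi * ∫ u, (1 + u ^ 2) * g u ^ 2 := by
  set I := ∫ u, g u with hI
  set a := I / Real.pi with ha
  have hpi := Real.pi_pos
  have hi := integrable_inv_one_add_sq
  have h : 0 ≤ ∫ u, (((1 + u ^ 2) * g u ^ 2 - 2 * a * g u) + a ^ 2 * (1 + u ^ 2)⁻¹) := by
    refine integral_nonneg fun u ↦ ?_
    have h0 : (0 : ℝ) < 1 + u ^ 2 := by positivity
    have : (1 + u ^ 2) * g u ^ 2 - 2 * a * g u + a ^ 2 * (1 + u ^ 2)⁻¹ =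
        (1 + u ^ 2) * (g u - a * (1 + u ^ 2)⁻¹) ^ 2 := by
      field_simp
      ring
    simp only [Pi.zero_apply, this]
    positivity
  have hsub : Integrable fun u ↦ (1 + u ^ 2) * g u ^ 2 - 2 * a * g u := hg2.sub (hg.const_mul _)
  rw [integral_add hsub (hi.const_mul _),
    integral_sub hg2 (hg.const_mul _), integral_const_mul, integral_const_mul,
    integral_univ_inv_one_add_sq, ← hI] at h
  have e : a * Real.pi = I := by
    rw [ha]
    field_simp
  nlinarith [mul_nonneg hpi.le h]

lemma sq_integral_le {Ω : Type*} [MeasurableSpace Ω] {P : Measure Ω} [IsProbabilityMeasure P]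
    {f : Ω → ℝ} (hf : Integrable f P) (hf2 : Integrable (fun w ↦ f w ^ 2) P) :
    (∫ w, f w ∂P) ^ 2 ≤ ∫ w, f w ^ 2 ∂P := by
  have h : ∫ w, 2 * (∫ w, f w ∂P) * f w - (∫ w, f w ∂P) ^ 2 ∂P ≤ ∫ w, f w ^ 2 ∂P :=
    integral_mono ((hf.const_mul _).sub (integrable_const _)) hf2 fun w ↦ by
      nlinarith [sq_nonneg (f w - ∫ w, f w ∂P)]
  rw [integral_sub (hf.const_mul _) (integrable_const _), integral_const_mul] at h
  simp only [integral_const, probReal_univ, one_smul] at h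
  nlinarith

/-- The defect between the normalized resolvent trace and its limit, on the scale `t = u²`. -/
noncomputable def resolventDefect (l : ℝ) (A : Matrix (Fin M) (Fin N) ℂ) (u : ℝ) : ℝ :=
  gramTrace A (u ^ 2) - mpRoot l (u ^ 2)

lemma measurable_resolventDefect (l : ℝ) :
    Measurable fun p : (Fin M × Fin N → ℂ) × ℝ ↦ resolventDefect l (toMat p.1) p.2 := by
  have h1 : Measurable fun p : (Fin M × Fin N → ℂ) × ℝ ↦ (p.1, p.2 ^ 2) := by fun_prop
  exact (measurable_gramTrace.comp h1).sub ((measurable_mpRoot_sq l).comp measurable_snd)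

lemma measurable_resolventDefect_right (l : ℝ) (A : Matrix (Fin M) (Fin N) ℂ) :
    Measurable (resolventDefect l A) := by
  have hm : Measurable fun u : ℝ ↦ ((fun p : Fin M × Fin N ↦ A p.1 p.2), u) := by fun_prop
  have e : toMat (fun p : Fin M × Fin N ↦ A p.1 p.2) = A := rfl
  have h := (measurable_resolventDefect (M := M) (N := N) l).comp hm
  simp only [Function.comp_def, e] at h
  exact h

lemma abs_resolventDefect_mul_le {l : ℝ} (hl : 0 ≤ l) (A : Matrix (Fin M) (Fin N) ℂ) {u : ℝ}
    (hu : u ≠ 0) : |resolventDefect l A u| * (1 + u ^ 2) ≤ 1 + hsNormSq A / N := by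
  have ht : 0 < u ^ 2 := by positivity
  have h0 := gramTrace_nonneg A ht
  have h1 := gramTrace_le_one A ht
  have h2 := gramTrace_mul_le A ht
  have h3 := mpRoot_pos ht.le hl
  have h4 := mpRoot_mul_le ht.le hl
  have h5 : 0 ≤ hsNormSq A / N := div_nonneg (hsNormSq_nonneg A) (Nat.cast_nonneg _)
  rw [← abs_of_pos (show 0 < 1 + u ^ 2 by positivity), ← abs_mul, resolventDefect, abs_le]
  constructor <;> nlinarith

lemma integrable_resolventDefect {l : ℝ} (hl : 0 ≤ l) (A : Matrix (Fin M) (Fin N) ℂ) :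
    Integrable (resolventDefect l A) := by
  refine (integrable_inv_one_add_sq.const_mul (1 + hsNormSq A / N)).mono'
    (measurable_resolventDefect_right l A).aestronglyMeasurable ?_
  filter_upwards [Measure.ae_ne volume 0] with u hu
  rw [Real.norm_eq_abs, ← div_eq_mul_inv, le_div_iff₀ (by positivity)]
  exact abs_resolventDefect_mul_le hl A hu

lemma weighted_resolventDefect_sq_le {l : ℝ} (hl : 0 ≤ l) (A : Matrix (Fin M) (Fin N) ℂ) {u : ℝ}
    (hu : u ≠ 0) :
    (1 + u ^ 2) * resolventDefect l A u ^ 2 ≤ (1 + hsNormSq A / N) ^ 2 * (1 + u ^ 2)⁻¹ := by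
  have h0 : 0 < 1 + u ^ 2 := by positivity
  have h := pow_le_pow_left₀ (by positivity) (abs_resolventDefect_mul_le hl A hu) 2
  rw [mul_pow, sq_abs] at h
  rw [← div_eq_mul_inv, le_div_iff₀ h0]
  linarith

lemma integrable_weighted_resolventDefect_sq {l : ℝ} (hl : 0 ≤ l)
    (A : Matrix (Fin M) (Fin N) ℂ) :
    Integrable fun u ↦ (1 + u ^ 2) * resolventDefect l A u ^ 2 := by
  have := measurable_resolventDefect_right l A
  refine (integrable_inv_one_add_sq.const_mul ((1 + hsNormSq A / N) ^ 2)).mono'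
    (by fun_prop : Measurable _).aestronglyMeasurable ?_
  filter_upwards [Measure.ae_ne volume 0] with u hu
  rw [Real.norm_of_nonneg (by positivity)]
  exact weighted_resolventDefect_sq_le hl A hu

lemma sq_traceNorm_div_sub_le (hN : 0 < N) {l : ℝ} (hl : 0 ≤ l) (A : Matrix (Fin M) (Fin N) ℂ) :
    (traceNorm A / N - Real.pi⁻¹ * ∫ u, mpRoot l (u ^ 2)) ^ 2 ≤
      Real.pi⁻¹ * ∫ u, (1 + u ^ 2) * resolventDefect l A u ^ 2 := by
  have hN' : (N : ℝ) ≠ 0 := by positivity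
  have hpi := Real.pi_pos
  have i1 := integrable_mpRoot_sq hl
  have i2 := integrable_resolventDefect hl A
  have e : traceNorm A / N - Real.pi⁻¹ * ∫ u, mpRoot l (u ^ 2) =
      Real.pi⁻¹ * ∫ u, resolventDefect l A u := by
    have : ∫ u, gramTrace A (u ^ 2) = (∫ u, resolventDefect l A u) + ∫ u, mpRoot l (u ^ 2) := by
      rw [← integral_add i2 i1]
      simp only [resolventDefect, sub_add_cancel]
    rw [traceNorm_eq_integral, integral_const_mul, this]
    field_simp
    ring
  rw [e, mul_pow]
  have h := sq_integral_le_pi_mul i2 (integrable_weighted_resolventDefect_sq hl A)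
  calc _ ≤ Real.pi⁻¹ ^ 2 * (Real.pi * ∫ u, (1 + u ^ 2) * resolventDefect l A u ^ 2) := by gcongr
    _ = _ := by field_simp

lemma integrable_sq_one_add_hsNormSq (v : ℝ≥0) :
    Integrable (fun y ↦ (1 + hsNormSq (toMat y) / N) ^ 2) (ginibreLaw M N v) := by
  have h : (fun y : Fin M × Fin N → ℂ ↦ (1 + hsNormSq (toMat y) / N) ^ 2) = fun y ↦
      (1 + 2 / N * hsNormSq (toMat y)) + 1 / N ^ 2 * hsNormSq (toMat y) ^ 2 := by
    ext y
    ring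
  rw [h]
  exact ((integrable_const _).add ((integrable_hsNormSq v).const_mul _)).add
    ((integrable_hsNormSq_sq v).const_mul _)

lemma integral_sq_one_add_hsNormSq_le (hN : 0 < N) (hM : 0 < M) :
    ∫ y, (1 + hsNormSq (toMat y) / N) ^ 2 ∂(ginibreLaw M N (1 / (M : ℝ≥0))) ≤ 6 := by
  have hN' : (N : ℝ) ≠ 0 := by positivity
  have h2 := integral_hsNormSq_sq_le (M := M) (N := N) (one_div_natCast_ne_zero hM)
  rw [natCast_mul_one_div hM] at h2
  have i2 := integrable_hsNormSq_sq (M := M) (N := N) (1 / (M : ℝ≥0))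
  calc _ ≤ ∫ y, (2 + 2 / N ^ 2 * hsNormSq (toMat y) ^ 2) ∂(ginibreLaw M N (1 / (M : ℝ≥0))) := by
        refine integral_mono (integrable_sq_one_add_hsNormSq _)
          ((integrable_const _).add (i2.const_mul _)) fun y ↦ ?_
        have : 2 + 2 / (N : ℝ) ^ 2 * hsNormSq (toMat y) ^ 2 - (1 + hsNormSq (toMat y) / N) ^ 2 =
          (1 - hsNormSq (toMat y) / N) ^ 2 := by ring
        nlinarith [sq_nonneg (1 - hsNormSq (toMat y) / N)]
    _ = 2 + 2 / N ^ 2 * ∫ y, hsNormSq (toMat y) ^ 2 ∂(ginibreLaw M N (1 / (M : ℝ≥0))) := by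
        rw [integral_add (integrable_const _) (i2.const_mul _), integral_const_mul]
        simp
    _ ≤ 2 + 2 / N ^ 2 * (2 * (N : ℝ) ^ 2) := by gcongr
    _ = 6 := by
        field_simp
        norm_num

lemma integrable_prod_resolventDefect {l : ℝ} (hl : 0 ≤ l) (v : ℝ≥0) :
    Integrable (fun p : (Fin M × Fin N → ℂ) × ℝ ↦
      (1 + p.2 ^ 2) * resolventDefect l (toMat p.1) p.2 ^ 2) ((ginibreLaw M N v).prod volume) := by
  have := measurable_resolventDefect (M := M) (N := N) l
  refine ((integrable_sq_one_add_hsNormSq (M := M) (N := N) v).mul_prod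
    integrable_inv_one_add_sq).mono' (by fun_prop : Measurable _).aestronglyMeasurable ?_
  have h : ∀ᵐ p ∂((ginibreLaw M N v).prod (volume : Measure ℝ)), p.2 ≠ 0 :=
    Measure.quasiMeasurePreserving_snd.ae (Measure.ae_ne volume 0)
  filter_upwards [h] with p hp
  rw [Real.norm_of_nonneg (by positivity)]
  exact weighted_resolventDefect_sq_le hl _ hp

/-- The mean square of the defect at the scale `u`, with the weight for which its integral over `u`
controls the fluctuations of the normalized trace norm. -/
noncomputable def meanDefect (M N : ℕ) (l u : ℝ) : ℝ :=
  ∫ y, (1 + u ^ 2) * resolventDefect l (toMat y) u ^ 2 ∂(ginibreLaw M N (1 / (M : ℝ≥0)))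

lemma integrable_meanDefect {l : ℝ} (hl : 0 ≤ l) : Integrable (meanDefect M N l) :=
  (integrable_prod_resolventDefect hl _).integral_prod_right

lemma meanDefect_nonneg (l u : ℝ) : 0 ≤ meanDefect M N l u :=
  integral_nonneg fun y ↦ by positivity

lemma integrable_resolventDefect_sq {l : ℝ} (hl : 0 ≤ l) {u : ℝ} (hu : u ≠ 0) (v : ℝ≥0) :
    Integrable (fun y ↦ (1 + u ^ 2) * resolventDefect l (toMat y) u ^ 2) (ginibreLaw M N v) := by
  have hm : Measurable fun y : Fin M × Fin N → ℂ ↦ resolventDefect l (toMat y) u := by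
    have h : Measurable fun y : Fin M × Fin N → ℂ ↦ (y, u) := by fun_prop
    have h' := (measurable_resolventDefect (M := M) (N := N) l).comp h
    simp only [Function.comp_def] at h'
    exact h'
  refine ((integrable_sq_one_add_hsNormSq (M := M) (N := N) v).mul_const ((1 + u ^ 2)⁻¹)).mono'
    (by fun_prop : Measurable _).aestronglyMeasurable (ae_of_all _ fun y ↦ ?_)
  rw [Real.norm_of_nonneg (by positivity)]
  exact weighted_resolventDefect_sq_le hl _ hu

/-- The domination which is uniform in the dimensions. -/
lemma meanDefect_le_inv (hN : 0 < N) (hM : 0 < M) {l : ℝ} (hl : 0 ≤ l) {u : ℝ} (hu : u ≠ 0) :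
    meanDefect M N l u ≤ 6 * (1 + u ^ 2)⁻¹ := by
  refine (integral_mono (integrable_resolventDefect_sq hl hu _)
    ((integrable_sq_one_add_hsNormSq _).mul_const _) fun y ↦
      weighted_resolventDefect_sq_le hl (toMat y) hu).trans ?_
  rw [integral_mul_const]
  have := integral_sq_one_add_hsNormSq_le hN hM
  gcongr

/-- The loop equation and the stability of the Marchenko–Pastur equation bound the defect at a
fixed scale. -/
lemma meanDefect_le (hN : 0 < N) (hM : 0 < M) {l : ℝ} (hl : 0 ≤ l) (hl1 : l ≤ 1) {u : ℝ}
    (hu : u ≠ 0) : meanDefect M N l u ≤ (1 + u ^ 2) / u ^ 4 *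
      (2 * (3 * (1 + N / M + u ^ 2) / (N * M)) + 2 * (N / M - l) ^ 2) := by
  have ht : 0 < u ^ 2 := by positivity
  have hl' : (0 : ℝ) ≤ N / M := by positivity
  have loop := integral_mpPoly_gramTrace_sq_le hN hM ht
  have hφ : Integrable (fun y ↦ mpPoly (N / M) (u ^ 2) (gramTrace (toMat y) (u ^ 2)) ^ 2)
      (ginibreLaw M N (1 / (M : ℝ≥0))) := by
    have hc := continuous_gramTrace (M := M) (N := N) ht
    have hφc : Continuous fun y : Fin M × Fin N → ℂ ↦
        mpPoly (N / M) (u ^ 2) (gramTrace (toMat y) (u ^ 2)) ^ 2 := by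
      unfold mpPoly
      fun_prop
    refine Integrable.of_bound hφc.measurable.aestronglyMeasurable ((1 + N / M + u ^ 2) ^ 2)
      (ae_of_all _ fun y ↦ ?_)
    rw [Real.norm_eq_abs, abs_pow]
    exact pow_le_pow_left₀ (abs_nonneg _)
      (abs_mpPoly_le hl' ht.le (gramTrace_nonneg _ ht) (gramTrace_le_one _ ht)) 2
  have hle : ∀ y : Fin M × Fin N → ℂ, (1 + u ^ 2) * resolventDefect l (toMat y) u ^ 2 ≤
      (1 + u ^ 2) / u ^ 4 * (2 * mpPoly (N / M) (u ^ 2) (gramTrace (toMat y) (u ^ 2)) ^ 2 +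
        2 * (N / M - l) ^ 2) := by
    intro y
    have h0 := gramTrace_nonneg (toMat y) ht
    have h1 := gramTrace_le_one (toMat y) ht
    have hs := abs_sub_mpRoot_le ht.le hl hl1 h1
    rw [resolventDefect]
    generalize gramTrace (toMat y) (u ^ 2) = h at *
    -- replacing the ratio `N / M` by its limit `l` costs at most `|N / M - l|`
    have e : (1 - h) * (1 - l * h) - u ^ 2 * h =
        mpPoly (N / M) (u ^ 2) h + (N / M - l) * (h * (1 - h)) := by
      rw [mpPoly]
      ring
    rw [e] at hs
    have h2 : (h * (1 - h)) ^ 2 ≤ 1 := by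
      have : 0 ≤ h * (1 - h) := mul_nonneg h0 (by linarith)
      exact pow_le_one₀ this (by nlinarith)
    have h3 : (u ^ 2 * |h - mpRoot l (u ^ 2)|) ^ 2 ≤
        2 * mpPoly (N / M) (u ^ 2) h ^ 2 + 2 * (N / M - l) ^ 2 := by
      refine (pow_le_pow_left₀ (by positivity) hs 2).trans ?_
      rw [sq_abs]
      nlinarith [sq_nonneg (mpPoly (N / M) (u ^ 2) h - (N / M - l) * (h * (1 - h))),
        mul_le_mul_of_nonneg_left h2 (sq_nonneg ((N : ℝ) / M - l))]
    rw [mul_pow, sq_abs] at h3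
    have e2 : (1 + u ^ 2) * (h - mpRoot l (u ^ 2)) ^ 2 =
        (1 + u ^ 2) / u ^ 4 * ((u ^ 2) ^ 2 * (h - mpRoot l (u ^ 2)) ^ 2) := by
      field_simp
    rw [e2]
    gcongr
  refine (integral_mono (integrable_resolventDefect_sq hl hu _)
    (((hφ.const_mul _).add (integrable_const _)).const_mul _) hle).trans ?_
  rw [integral_const_mul]
  gcongr
  rw [integral_add' (hφ.const_mul _) (integrable_const _), integral_const_mul]
  simp only [integral_const, probReal_univ, one_smul]
  gcongr

lemma integrable_traceNorm (v : ℝ≥0) :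
    Integrable (fun y ↦ traceNorm (toMat y)) (ginibreLaw M N v) := by
  refine ((integrable_const 1).add (integrable_traceNorm_sq v)).mono'
    measurable_traceNorm.aestronglyMeasurable (ae_of_all _ fun y ↦ ?_)
  rw [Real.norm_eq_abs, Pi.add_apply]
  nlinarith [sq_nonneg (|traceNorm (toMat y)| - 1), sq_abs (traceNorm (toMat y))]

lemma integral_sq_traceNorm_sub_le (hN : 0 < N) {l : ℝ} (hl : 0 ≤ l) :
    ∫ y, (traceNorm (toMat y) / N - Real.pi⁻¹ * ∫ u, mpRoot l (u ^ 2)) ^ 2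
      ∂(ginibreLaw M N (1 / (M : ℝ≥0))) ≤ Real.pi⁻¹ * ∫ u, meanDefect M N l u := by
  have hi := integrable_prod_resolventDefect (M := M) (N := N) hl (1 / (M : ℝ≥0))
  have e : ∫ u, meanDefect M N l u = ∫ y, (∫ u, (1 + u ^ 2) * resolventDefect l (toMat y) u ^ 2)
      ∂(ginibreLaw M N (1 / (M : ℝ≥0))) := (integral_integral_swap hi).symm
  rw [e]
  exact (integral_mono_of_nonneg (ae_of_all _ fun y ↦ sq_nonneg _)
    (hi.integral_prod_left.const_mul _) (ae_of_all _ fun y ↦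
      sq_traceNorm_div_sub_le hN hl _)).trans_eq (integral_const_mul _ _)

/-! ### The limit of the constants -/

section Limit

variable {M N : ℕ → ℕ} {l : ℝ}

lemma tendsto_meanDefect (hl : 0 ≤ l) (hl1 : l ≤ 1) (hN : Tendsto N atTop atTop)
    (hM : Tendsto M atTop atTop) (hr : Tendsto (fun k ↦ (N k : ℝ) / M k) atTop (𝓝 l)) {u : ℝ}
    (hu : u ≠ 0) : Tendsto (fun k ↦ meanDefect (M k) (N k) l u) atTop (𝓝 0) := by
  have hN' : Tendsto (fun k ↦ (N k : ℝ)) atTop atTop := tendsto_natCast_atTop_atTop.comp hN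
  have hM' : Tendsto (fun k ↦ (M k : ℝ)) atTop atTop := tendsto_natCast_atTop_atTop.comp hM
  have h1 : Tendsto (fun k ↦ 3 * (1 + (N k : ℝ) / M k + u ^ 2) / (N k * M k)) atTop (𝓝 0) :=
    (((tendsto_const_nhds.add hr).add_const _).const_mul 3).div_atTop (hN'.atTop_mul_atTop₀ hM')
  have h2 : Tendsto (fun k ↦ (1 + u ^ 2) / u ^ 4 *
      (2 * (3 * (1 + (N k : ℝ) / M k + u ^ 2) / (N k * M k)) +
        2 * ((N k : ℝ) / M k - l) ^ 2)) atTop (𝓝 0) := by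
    have := ((h1.const_mul 2).add (((hr.sub_const l).pow 2).const_mul 2)).const_mul
      ((1 + u ^ 2) / u ^ 4)
    simpa using this
  refine tendsto_of_tendsto_of_tendsto_of_le_of_le' tendsto_const_nhds h2
    (Eventually.of_forall fun k ↦ meanDefect_nonneg l u) ?_
  filter_upwards [hN.eventually_gt_atTop 0, hM.eventually_gt_atTop 0] with k k1 k2
  exact meanDefect_le k1 k2 hl hl1 hu

lemma tendsto_integral_meanDefect (hl : 0 ≤ l) (hl1 : l ≤ 1) (hN : Tendsto N atTop atTop)
    (hM : Tendsto M atTop atTop) (hr : Tendsto (fun k ↦ (N k : ℝ) / M k) atTop (𝓝 l)) :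
    Tendsto (fun k ↦ ∫ u, meanDefect (M k) (N k) l u) atTop (𝓝 0) := by
  rw [← integral_zero ℝ ℝ (μ := volume)]
  refine tendsto_integral_filter_of_dominated_convergence (fun u ↦ 6 * (1 + u ^ 2)⁻¹)
    (Eventually.of_forall fun k ↦ (integrable_meanDefect hl).aestronglyMeasurable) ?_
    (integrable_inv_one_add_sq.const_mul 6) ?_
  · filter_upwards [hN.eventually_gt_atTop 0, hM.eventually_gt_atTop 0] with k k1 k2
    filter_upwards [Measure.ae_ne volume 0] with u hu
    rw [Real.norm_of_nonneg (meanDefect_nonneg l u)]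
    exact meanDefect_le_inv k1 k2 hl hu
  · filter_upwards [Measure.ae_ne volume 0] with u hu
    exact tendsto_meanDefect hl hl1 hN hM hr hu

/-- The normalized trace norm converges in `L²` to a constant, hence its second moment
converges. -/
lemma tendsto_integral_traceNorm_div_sq (hl : 0 ≤ l) (hl1 : l ≤ 1) (hN : Tendsto N atTop atTop)
    (hM : Tendsto M atTop atTop) (hr : Tendsto (fun k ↦ (N k : ℝ) / M k) atTop (𝓝 l)) :
    Tendsto (fun k ↦ ∫ y, (traceNorm (toMat y) / N k) ^ 2
        ∂(ginibreLaw (M k) (N k) (1 / (M k : ℝ≥0)))) atTop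
      (𝓝 ((Real.pi⁻¹ * ∫ u, mpRoot l (u ^ 2)) ^ 2)) := by
  set S := Real.pi⁻¹ * ∫ u, mpRoot l (u ^ 2) with hS
  let μ := fun k ↦ ginibreLaw (M k) (N k) (1 / (M k : ℝ≥0))
  let V := fun k ↦ ∫ y, (traceNorm (toMat y) / N k - S) ^ 2 ∂(μ k)
  let D := fun k ↦ ∫ y, (traceNorm (toMat y) / N k - S) ∂(μ k)
  have i1 : ∀ k, Integrable (fun y ↦ traceNorm (toMat y) / N k - S) (μ k) := fun k ↦
    ((integrable_traceNorm _).div_const _).sub (integrable_const _)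
  have i2 : ∀ k, Integrable (fun y ↦ (traceNorm (toMat y) / N k - S) ^ 2) (μ k) := by
    intro k
    have e : (fun y : Fin (M k) × Fin (N k) → ℂ ↦ (traceNorm (toMat y) / N k - S) ^ 2) = fun y ↦
        (1 / (N k : ℝ) ^ 2 * traceNorm (toMat y) ^ 2 - 2 * S / N k * traceNorm (toMat y)) +
          S ^ 2 := by
      ext y
      ring
    rw [e]
    exact (((integrable_traceNorm_sq _).const_mul _).sub
      ((integrable_traceNorm _).const_mul _)).add (integrable_const _)
  have hV0 : ∀ k, 0 ≤ V k := fun k ↦ integral_nonneg fun y ↦ sq_nonneg _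
  have hV : Tendsto V atTop (𝓝 0) := by
    have h2 := (tendsto_integral_meanDefect hl hl1 hN hM hr).const_mul Real.pi⁻¹
    rw [mul_zero] at h2
    refine tendsto_of_tendsto_of_tendsto_of_le_of_le' tendsto_const_nhds h2
      (Eventually.of_forall hV0) ?_
    filter_upwards [hN.eventually_gt_atTop 0] with k k1
    exact integral_sq_traceNorm_sub_le k1 hl
  have hD : Tendsto D atTop (𝓝 0) := by
    have h2 := hV.sqrt
    rw [Real.sqrt_zero] at h2
    refine squeeze_zero_norm (fun k ↦ ?_) h2
    rw [Real.norm_eq_abs]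
    exact Real.abs_le_sqrt (sq_integral_le (i1 k) (i2 k))
  have h := (hV.add (hD.const_mul (2 * S))).add_const (S ^ 2)
  rw [mul_zero, zero_add, zero_add] at h
  refine h.congr fun k ↦ ?_
  have e : ∀ y : Fin (M k) × Fin (N k) → ℂ, (traceNorm (toMat y) / N k) ^ 2 =
      ((traceNorm (toMat y) / N k - S) ^ 2 + 2 * S * (traceNorm (toMat y) / N k - S)) + S ^ 2 :=
    fun y ↦ by ring
  have hi : Integrable (fun y ↦ (traceNorm (toMat y) / N k - S) ^ 2 +
      2 * S * (traceNorm (toMat y) / N k - S)) (μ k) := (i2 k).add ((i1 k).const_mul _)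
  simp_rw [e]
  change _ = ∫ y, _ ∂(μ k)
  rw [integral_add hi (integrable_const _), integral_add (i2 k) ((i1 k).const_mul _),
    integral_const_mul]
  simp [V, D, μ]

lemma tendsto_chi {c : ℝ} (hc : 1 ≤ c) (hN : Tendsto N atTop atTop)
    (hr : Tendsto (fun k ↦ (M k : ℝ) / N k) atTop (𝓝 c)) :
    Tendsto (fun k ↦ chi (M k) (N k)) atTop (𝓝 (chiLim c)) := by
  have hc0 : 0 < c := zero_lt_one.trans_le hc
  have hN' : Tendsto (fun k ↦ (N k : ℝ)) atTop atTop := tendsto_natCast_atTop_atTop.comp hN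
  have hM : Tendsto M atTop atTop := by
    rw [← tendsto_natCast_atTop_iff (R := ℝ)]
    refine (hN'.atTop_mul_pos hc0 hr).congr' ?_
    filter_upwards [hN.eventually_gt_atTop 0] with k k1
    field_simp
  have hr' : Tendsto (fun k ↦ (N k : ℝ) / M k) atTop (𝓝 c⁻¹) :=
    (hr.inv₀ hc0.ne').congr fun k ↦ inv_div _ _
  have h := tendsto_integral_traceNorm_div_sq (inv_nonneg.2 hc0.le) (inv_le_one_of_one_le₀ hc)
    hN hM hr'
  rw [← chiLim_eq hc] at h
  have hz : Tendsto (fun k ↦ ((N k : ℝ) ^ 2)⁻¹) atTop (𝓝 0) :=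
    ((tendsto_pow_atTop two_ne_zero).comp hN').inv_tendsto_atTop
  have h2 := (h.sub hz).div (tendsto_const_nhds.sub hz : Tendsto (fun k ↦ 1 - ((N k : ℝ) ^ 2)⁻¹)
    atTop (𝓝 (1 - 0))) (by norm_num)
  rw [sub_zero, sub_zero, div_one] at h2
  refine h2.congr' ?_
  filter_upwards [hN.eventually_ge_atTop 2] with k k1
  have k2 : (2 : ℝ) ≤ N k := by exact_mod_cast k1
  have k3 : (N k : ℝ) ^ 2 - 1 ≠ 0 := by nlinarith
  have k4 : (N k : ℝ) ≠ 0 := by positivity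
  have k5 : 1 - ((N k : ℝ) ^ 2)⁻¹ ≠ 0 := by
    intro h0
    apply k3
    field_simp at h0
    simpa using h0
  rw [chi_eq, Pi.div_apply]
  simp_rw [div_pow]
  rw [integral_div, div_eq_div_iff k5 k3]
  field_simp

end Limit

end GinibreTensor

theorem lemma5p1 :
    -- the identity for the expectation of `|Y| ⊗ |Ȳ|`
    (∀ {Ω : Type*} [MeasurableSpace Ω] (P : Measure Ω) [IsProbabilityMeasure P]
        (M N : ℕ) (_ : 1 ≤ N) (_ : N ≤ M) (Y : Ω → Matrix (Fin M) (Fin N) ℂ)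
        (_ : GinibreTensor.IsGinibre (1 / (M : ℝ≥0)) Y P),
      (∀ p q, Integrable (fun w ↦ GinibreTensor.absTensor (Y w) p q) P) ∧
      Integrable (fun w ↦ GinibreTensor.traceNorm (Y w) ^ 2) P ∧
      GinibreTensor.chi M N =
        ((∫ w, GinibreTensor.traceNorm (Y w) ^ 2 ∂P) - 1) / ((N : ℝ) ^ 2 - 1) ∧
      (Matrix.of fun p q ↦ ∫ w, GinibreTensor.absTensor (Y w) p q ∂P) =
        GinibreTensor.maxEntangledState N +
          (GinibreTensor.chi M N : ℂ) • (1 - GinibreTensor.maxEntangledState N)) ∧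
    -- the lower bound at fixed dimensions
    (∀ M N : ℕ, 2 ≤ N → N ≤ M →
      1 / ((N : ℝ) + 1) ≤ GinibreTensor.chi M N ∧ 0 < 1 / ((N : ℝ) + 1)) ∧
    -- the limit along all sequences with `N → ∞` and `M ∼ cN`
    (∀ c : ℝ, 1 ≤ c →
      IntervalIntegrable (GinibreTensor.edgeIntegrand c) volume
        (GinibreTensor.edgeLow c) (GinibreTensor.edgeHigh c) ∧
      ∀ M N : ℕ → ℕ, Tendsto N atTop atTop →
        Tendsto (fun k ↦ (M k : ℝ) / (N k : ℝ)) atTop (𝓝 c) →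
        Tendsto (fun k ↦ GinibreTensor.chi (M k) (N k)) atTop (𝓝 (GinibreTensor.chiLim c))) ∧
    -- properties of the limiting constant
    StrictMonoOn GinibreTensor.chiLim (Set.Ici 1) ∧
    GinibreTensor.chiLim 1 = (8 / (3 * Real.pi)) ^ 2 ∧
    Tendsto GinibreTensor.chiLim atTop (𝓝 1) := by
  refine ⟨fun P _ M N hN hNM Y hY ↦ GinibreTensor.expectation_absTensor P hN (hN.trans hNM) Y hY,
    fun M N hN hNM ↦ ⟨GinibreTensor.le_chi hN (by omega), by positivity⟩,
    fun c hc ↦ ⟨GinibreTensor.intervalIntegrable_edgeIntegrand hc,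
      fun M N hN hr ↦ GinibreTensor.tendsto_chi hc hN hr⟩,
    GinibreTensor.strictMonoOn_chiLim, GinibreTensor.chiLim_one,
    GinibreTensor.tendsto_chiLim_atTop⟩
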